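/- Let $D=\mathbb R^d$ or $D=\mathbb T^d=\mathbb R^d/\mathbb Z^d$ with $d\in\{2,3\}$, let $s>1+d/2$, $T>0$, $\nu\ge 0$, and let $W$ be a $d$-dimensional Brownian motion on a probability space $(\Omega,\mathbb P)$, with expectation $\mathbb E_W$. **Spaces.** $H^r=H^r(D;\mathbb R^d)$ is the Sobolev space, and $H^r_\sigma$ is the closure in $H^r$ of the smooth divergence-free fields (of zero mean if $D=\mathbb T^d$). $\mathcal D^{r}$ is the space of bijections $\Phi:D\to D$ with $\Phi-\mathrm{id}\in H^r$ and $\Phi^{-1}-\mathrm{id}\in H^r$ (on $\mathbb T^d$: maps given by lifts with periodic displacement). $\tilde{\mathcal V}=L^2(\Omega;C^1([0,T];H^s))$, and $\tilde{\mathcal D}=L^\infty(\Omega;C^1([0,T];\mathcal D^{s+1}))$, where the bound over $\Omega$ concerns $X-\mathrm{id}$ and $\dot X$ as well as $X^{-1}-\mathrm{id}$. Elements of these spaces are identified with their continuous representatives. **Action.** Let $\mathbf T$ be a bounded, symmetric, positive definite linear operator from $H^{s+1}$ (zero-mean fields if $D=\mathbb T^d$) to $L^2$ that commutes with partial derivatives.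 For $(u,X,\tilde\xi)\in C([0,T];H^{s+1}_\sigma)\times\tilde{\mathcal D}\times\tilde{\mathcal V}$ put $X^\nu_t=X_t+\sqrt{2\nu}\,W_t$, $A^\nu_t=(X^\nu_t)^{-1}$ and $$\Psi(u,X,\tilde\xi)=\int_0^T \tfrac12\langle \mathbf T u_t,u_t\rangle_2+\mathbb E_W\langle\tilde\xi_t,\dot X_t-u_t(X^\nu_t)\rangle_2\,dt .$$ Call $(u,X,\tilde\xi)$ a critical point if the first variation of $\Psi$ vanishes in every direction $\delta u\in C([0,T];H^{s+1}_\sigma)$ and every direction $\delta\tilde\xi\in\tilde{\mathcal V}$, and along $X_\varepsilon=(\mathrm{id}+\varepsilon\,\delta X)\circ X$ for every random field $\delta X$ that is smooth in $(t,x)$ with bounds on all derivatives uniform in $\omega$ and support in a compact subset of $(0,T)\times D$ independent of $\omega$. **Vector measures.** Let $\mathcal M_\sigma$ be the set of $\mathbb R^d$-valued Borel measures $\mu$ on $D$ with $\int_D\nabla\varphi\cdot d\mu=0$ for all $\varphi\in C_c^\infty(D)$. Write $\langle\psi,\mu\rangle_*=\int_D\psi\cdot d\mu$. The push-forward $\Phi_\#\mu$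 by a $C^1$-diffeomorphism $\Phi$ is the vector measure with $(\Phi_\#\mu)(B)=\int_{\Phi^{-1}(B)}\nabla\Phi\,d\mu$, that is, $\langle\psi,\Phi_\#\mu\rangle_*=\langle\nabla^*\Phi\,(\psi\circ\Phi),\mu\rangle_*$, where $\nabla^*\Phi$ is the transpose of $\nabla\Phi$. Let $\mathbf P=\mathrm{Id}-\nabla\Delta^{-1}\nabla\cdot$ be the Leray projection, i.e. the orthogonal projection of $L^2(D;\mathbb R^d)$ onto the $L^2$-closure of the smooth divergence-free fields. **Theorem.** Let $(u,X,\tilde\xi)$ be a critical point of $\Psi$ with $X_0=\mathrm{id}$ and with deterministic initial momentum $\tilde\xi_0=\xi_0$. Put $\xi'_t=\tilde\xi_t\circ A^\nu_t$, and for each $t\in[0,T]$ let $\xi_t$ denote the ($H^s$, continuous) representative of $\mathbf P\,\mathbb E_W[\xi'_t]$. 1. (Pathwise Kelvin) For every $v\in\mathcal M_\sigma$, almost surely, for all $t\in[0,T]$, $\tilde v_t:=(X^\nu_t)_\#v$ belongs to $\mathcal M_\sigma$ and $$\langle\xi'_t,\tilde v_t\rangle_*=\langle\xi_0,v\rangle_*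 .$$ 2. (Statistical Kelvin) For every $\mu\in\mathcal M_\sigma$ and every $t\in[0,T]$, the expectation $\mathbb E_W(A^\nu_t)_\#\mu$ (taken on every Borel set) exists and is an element of $\mathcal M_\sigma$, and $$\langle\xi_t,\mu\rangle_*=\langle\mathbb E_W[\xi'_t],\mu\rangle_*=\langle\xi_0,\mathbb E_W(A^\nu_t)_\#\mu\rangle_* .$$ (In both parts $\xi_0$ on the right is the initial momentum $\tilde\xi_0$.) -/

import Mathlib

open MeasureTheory ProbabilityTheory Filter Set
open scoped ENNReal NNReal Topology InnerProductSpace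

noncomputable section

namespace Kelvin

/-- Euclidean space `ℝ^d`. -/
abbrev E (d : ℕ) : Type := EuclideanSpace ℝ (Fin d)

/-- The two physical domains `D`: the whole space `ℝ^d` and the flat torus `𝕋^d = ℝ^d / ℤ^d`.

Fields on the torus are `ℤ^d`-periodic functions on `ℝ^d`, maps of the torus are given by their
lifts `ℝ^d → ℝ^d` whose displacement is periodic, and Borel measures on the torus are measures
on `ℝ^d` that are concentrated on the unit cell `[0,1)^d`. -/
inductive Domain : Type
  | space
  | torus

variable {d : ℕ}

/-- The point of `ℝ^d` with integer coordinates `k`. -/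
def intPoint (k : Fin d → ℤ) : E d := WithLp.toLp 2 fun i => (k i : ℝ)

/-- A fundamental cell of the domain: `ℝ^d`, respectively `[0,1)^d`. -/
def cell (d : ℕ) : Domain → Set (E d)
  | .space => univ
  | .torus => {x | ∀ i, x i ∈ Ico (0 : ℝ) 1}

/-- Reduction of a point of `ℝ^d` to the fundamental cell. -/
def fold : Domain → E d → E d
  | .space => id
  | .torus => fun x => WithLp.toLp 2 fun i => Int.fract (x i)

/-- Lebesgue measure of the domain. -/
def vol (d : ℕ) (D : Domain) : Measure (E d) := volume.restrict (cell d D)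

/-- `f` is a function on the domain (on the torus: a `ℤ^d`-periodic function). -/
def IsOn {V : Type*} : Domain → (E d → V) → Prop
  | .space, _ => True
  | .torus, f => ∀ (x : E d) (k : Fin d → ℤ), f (x + intPoint k) = f x

/-- Compact support in the domain; this is no condition on the (compact) torus. -/
def HasCompactSupp {V : Type*} [Zero V] : Domain → (E d → V) → Prop
  | .space, f => HasCompactSupport f
  | .torus, _ => True

/-- Test functions and test fields: `C_c^∞(D; V)`. -/
def IsTest {V : Type*} [NormedAddCommGroup V] [NormedSpace ℝ V] (D : Domain) (φ : E d → V) :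
    Prop :=
  ContDiff ℝ (⊤ : ℕ∞) φ ∧ IsOn D φ ∧ HasCompactSupp D φ

/-- The standard basis vector `e_i`. -/
def basisVec (i : Fin d) : E d := EuclideanSpace.single i (1 : ℝ)

/-- The partial derivative `∂_i v`. -/
def partialDeriv (i : Fin d) (v : E d → E d) : E d → E d := fun x => fderiv ℝ v x (basisVec i)

/-- The divergence `∇ · v`. -/
def divergence (v : E d → E d) (x : E d) : ℝ := ∑ i, (fderiv ℝ v x (basisVec i)) i

/-- Zero mean on the torus (no condition on `ℝ^d`). -/
def MeanFree : Domain → (E d → E d) → Prop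
  | .space, _ => True
  | .torus, v => ∫ x, v x ∂(vol d .torus) = 0

/-- The `L²` pairing `⟨f, g⟩₂` of vector fields on the domain. -/
def pairL2 (D : Domain) (f g : E d → E d) : ℝ := ∫ x, ⟪f x, g x⟫_ℝ ∂(vol d D)

/-! ### Sobolev spaces -/

/-- The measure on frequencies: Lebesgue measure for `ℝ^d`, counting measure on `ℤ^d` for the
torus. -/
def freqMeasure (d : ℕ) : Domain → Measure (E d)
  | .space => volume
  | .torus => Measure.sum fun k : Fin d → ℤ => Measure.dirac (intPoint k)

/-- `F` is the Fourier transform (for the torus: the family of Fourier coefficients) of the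
continuous field `f`, that is `f(x) = ∫ e^{2πi k·x} F(k) dk` at every point, with `F` integrable
(for the torus: `f(x) = ∑_{k ∈ ℤ^d} e^{2πi k·x} F(k)`). -/
def IsFourierTransformOf (D : Domain) (F : E d → EuclideanSpace ℂ (Fin d)) (f : E d → E d) :
    Prop :=
  Integrable F (freqMeasure d D) ∧
    ∀ x i, ((f x i : ℝ) : ℂ) =
      ∫ k, Complex.exp (2 * Real.pi * Complex.I * (⟪k, x⟫_ℝ : ℝ)) * F k i ∂(freqMeasure d D)

/-- The Sobolev norm `‖f‖_{H^r} = (∫ (1 + |k|²)^r |f̂(k)|² dk)^{1/2}` of a vector field, `∞` if `f`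
is not in `H^r`. It is used for `r > d/2` only: then every element of `H^r` has an integrable
Fourier transform and is identified with its continuous representative. The Fourier transform is
unique almost everywhere, so that the infimum has at most one finite candidate. -/
def sobNorm (D : Domain) (r : ℝ) (f : E d → E d) : ℝ≥0∞ :=
  ⨅ (F : E d → EuclideanSpace ℂ (Fin d)) (_ : IsFourierTransformOf D F f),
    (∫⁻ k, ENNReal.ofReal ((1 + ‖k‖ ^ 2) ^ r) * ‖F k‖ₑ ^ 2 ∂(freqMeasure d D)) ^ (1 / 2 : ℝ)

/-- `f ∈ H^r(D; ℝ^d)`. -/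
def MemSob (D : Domain) (r : ℝ) (f : E d → E d) : Prop := sobNorm D r f < ∞

/-- `f ∈ H^r_σ`: the closure in `H^r` of the smooth divergence-free fields; on the torus all these
fields have zero mean. -/
def MemSobDivFree (D : Domain) (r : ℝ) (f : E d → E d) : Prop :=
  MemSob D r f ∧ MeanFree D f ∧
    ∀ ε : ℝ≥0∞, 0 < ε → ∃ φ : E d → E d, ContDiff ℝ (⊤ : ℕ∞) φ ∧ (∀ x, divergence φ x = 0) ∧
      sobNorm D r (f - φ) < ε

/-- `f ∈ C([0,T]; H^r)`. -/
def ContSob (D : Domain) (r T : ℝ) (f : ℝ → E d → E d) : Prop :=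
  ∀ t ∈ Icc 0 T, MemSob D r (f t) ∧
    Tendsto (fun τ => sobNorm D r (f τ - f t)) (𝓝[Icc 0 T] t) (𝓝 0)

/-- The time derivative `ḟ(t, x)` on `[0,T]`, one-sided at the end points. -/
def timeDeriv (T : ℝ) (f : ℝ → E d → E d) : ℝ → E d → E d :=
  fun t x => derivWithin (fun τ => f τ x) (Icc 0 T) t

/-- `f ∈ C¹([0,T]; H^r)`: the difference quotients converge to `ḟ` in `H^r`, and `f`, `ḟ` are
continuous with values in `H^r`. -/
def C1Sob (D : Domain) (r T : ℝ) (f : ℝ → E d → E d) : Prop :=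
  ContSob D r T f ∧ ContSob D r T (timeDeriv T f) ∧
    ∀ t ∈ Icc 0 T, Tendsto
      (fun τ => sobNorm D r ((τ - t)⁻¹ • (f τ - f t) - timeDeriv T f t)) (𝓝[Icc 0 T \ {t}] t) (𝓝 0)

/-- `u ∈ C([0,T]; H^r_σ)`. -/
def IsVelocity (D : Domain) (r T : ℝ) (u : ℝ → E d → E d) : Prop :=
  ContSob D r T u ∧ ∀ t ∈ Icc 0 T, MemSobDivFree D r (u t)

/-! ### Random fields -/

section Random

variable {Ω : Type*} [MeasurableSpace Ω]

/-- A `d`-dimensional Brownian motion: independent standard real Brownian motions as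
coordinates. -/
structure IsBrownianMotion (W : ℝ≥0 → Ω → E d) (P : Measure Ω) : Prop where
  coord : ∀ i, IsBrownianReal (fun t ω => W t ω i) P
  indep : iIndepFun (fun (i : Fin d) (ω : Ω) (t : ℝ≥0) => W t ω i) P

/-- The momentum space `L²(Ω; C¹([0,T]; H^r))`. Measurability with values in the separable space
`C¹([0,T]; H^r)` is measurability of all point evaluations, and `R` dominates the
`C¹([0,T]; H^r)`-norm. -/
structure IsMomentum (D : Domain) (r T : ℝ) (P : Measure Ω) (ξ : Ω → ℝ → E d → E d) : Prop where
  meas : ∀ t ∈ Icc 0 T, ∀ x, AEMeasurable (fun ω => ξ ω t x) P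
  path : ∀ᵐ ω ∂P, C1Sob D r T (ξ ω)
  bound : ∃ R : Ω → ℝ, MemLp R 2 P ∧ ∀ᵐ ω ∂P, ∀ t ∈ Icc 0 T,
    sobNorm D r (ξ ω t) + sobNorm D r (timeDeriv T (ξ ω) t) ≤ ENNReal.ofReal (R ω)

/-- The configuration space `L^∞(Ω; C¹([0,T]; 𝒟^r))`, where `𝒟^r` is the space of invertible `H^r`
maps of the domain with `H^r` inverse. As usual the displacement `X - id` is in `H^r`. -/
structure IsConfiguration (D : Domain) (r T : ℝ) (P : Measure Ω) (X : Ω → ℝ → E d → E d) :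
    Prop where
  meas : ∀ t ∈ Icc 0 T, ∀ x, AEMeasurable (fun ω => X ω t x) P
  path : ∀ᵐ ω ∂P, C1Sob D r T (fun t x => X ω t x - x)
  bij : ∀ᵐ ω ∂P, ∀ t ∈ Icc 0 T, Function.Bijective (X ω t)
  bound : ∃ C : ℝ≥0, ∀ᵐ ω ∂P, ∀ t ∈ Icc 0 T,
    sobNorm D r (fun x => X ω t x - x) ≤ C ∧ sobNorm D r (timeDeriv T (X ω) t) ≤ C ∧
      sobNorm D r (fun x => Function.invFun (X ω t) x - x) ≤ C

/-- The noisy flow `X_t^ν = X_t + √(2ν) W_t`. -/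
def noisyFlow (ν : ℝ) (W : ℝ≥0 → Ω → E d) (X : Ω → ℝ → E d → E d) : Ω → ℝ → E d → E d :=
  fun ω t x => X ω t x + Real.sqrt (2 * ν) • W t.toNNReal ω

/-- The back-to-label map `A_t^ν = (X_t^ν)⁻¹`. -/
def backToLabel (ν : ℝ) (W : ℝ≥0 → Ω → E d) (X : Ω → ℝ → E d → E d) : Ω → ℝ → E d → E d :=
  fun ω t => Function.invFun (noisyFlow ν W X ω t)

/-! ### The action functional and its critical points -/

/-- `S` is an inertia operator `H^r → L²`: linear, bounded, symmetric, positive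
definite, commuting with partial derivatives. On the torus it acts on fields of zero mean. -/
structure IsInertia (D : Domain) (r : ℝ) (S : (E d → E d) → Lp (E d) 2 (vol d D)) : Prop where
  map_add : ∀ v w, MemSob D r v → MeanFree D v → MemSob D r w → MeanFree D w →
    S (v + w) = S v + S w
  map_smul : ∀ (c : ℝ) v, MemSob D r v → MeanFree D v → S (c • v) = c • S v
  bounded : ∃ C : ℝ≥0, ∀ v, MemSob D r v → MeanFree D v → ‖S v‖ₑ ≤ C * sobNorm D r v
  symm : ∀ v w, MemSob D r v → MeanFree D v → MemSob D r w → MeanFree D w →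
    pairL2 D (S v) w = pairL2 D v (S w)
  pos : ∀ v, MemSob D r v → MeanFree D v → v ≠ 0 → 0 < pairL2 D (S v) v
  comm : ∀ v i, MemSob D r v → MeanFree D v → MemSob D r (partialDeriv i v) →
    ∀ φ : E d → E d, IsTest D φ →
      pairL2 D (S (partialDeriv i v)) φ = - pairL2 D (S v) (partialDeriv i φ)

/-- The Hamilton-Pontryagin action without potential,
`Ψ(u, X, ξ̃) = ∫₀ᵀ ½⟨S u_t, u_t⟩₂ + 𝔼⟨ξ̃_t, Ẋ_t - u_t(X_t^ν)⟩₂ dt`. -/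
def action (D : Domain) (T ν : ℝ) (P : Measure Ω) (W : ℝ≥0 → Ω → E d)
    (S : (E d → E d) → Lp (E d) 2 (vol d D))
    (u : ℝ → E d → E d) (X ξ : Ω → ℝ → E d → E d) : ℝ :=
  ∫ t in (0 : ℝ)..T, ((1 / 2) * pairL2 D (S (u t)) (u t) +
    ∫ ω, pairL2 D (ξ ω t) (fun x => timeDeriv T (X ω) t x - u t (noisyFlow ν W X ω t x)) ∂P)

/-- Random test fields `δX(ω, t, x)`: smooth in `(t, x)` with bounds on all derivatives that are
uniform in `ω`, and supported in a compact subset of `(0,T) × D` that does not depend on `ω`. -/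
structure IsRandomTest (D : Domain) (T : ℝ) (δX : Ω → ℝ → E d → E d) : Prop where
  meas : ∀ t x, Measurable (fun ω => δX ω t x)
  smooth : ∀ ω, ContDiff ℝ (⊤ : ℕ∞) (fun z : ℝ × E d => δX ω z.1 z.2)
  bound : ∀ n : ℕ, ∃ C : ℝ, ∀ ω z,
    ‖iteratedFDeriv ℝ n (fun z : ℝ × E d => δX ω z.1 z.2) z‖ ≤ C
  isOn : ∀ ω t, IsOn D (δX ω t)
  suppTime : ∃ a b, 0 < a ∧ b < T ∧ ∀ ω t, t ∉ Icc a b → δX ω t = 0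
  suppSpace : D = .space → ∃ R : ℝ, ∀ ω t x, R < ‖x‖ → δX ω t x = 0

/-- `(u, X, ξ̃)` is a critical point of the action: the first variation vanishes in all directions,
where `u` is varied in `C([0,T]; H_σ^{s+1})`, `ξ̃` in `L²(Ω; C¹([0,T]; H^s))`, and `X` by
`X_ε = (id + ε δX) ∘ X` with random test fields `δX`. -/
structure IsCritical (D : Domain) (s T ν : ℝ) (P : Measure Ω) (W : ℝ≥0 → Ω → E d)
    (S : (E d → E d) → Lp (E d) 2 (vol d D))
    (u : ℝ → E d → E d) (X ξ : Ω → ℝ → E d → E d) : Prop where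
  velocity : IsVelocity D (s + 1) T u
  configuration : IsConfiguration D (s + 1) T P X
  momentum : IsMomentum D s T P ξ
  var_velocity : ∀ δu, IsVelocity D (s + 1) T δu →
    HasDerivAt (fun ε : ℝ => action D T ν P W S (u + ε • δu) X ξ) 0 0
  var_configuration : ∀ δX, IsRandomTest D T δX →
    HasDerivAt (fun ε : ℝ =>
      action D T ν P W S u (fun ω t x => X ω t x + ε • δX ω t (X ω t x)) ξ) 0 0
  var_momentum : ∀ δξ, IsMomentum D s T P δξ →
    HasDerivAt (fun ε : ℝ => action D T ν P W S u X (ξ + ε • δξ)) 0 0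

end Random

/-! ### The Leray projection -/

/-- `H_σ`: the closure in `L²(D; ℝ^d)` of the smooth divergence-free fields. -/
def solenoidalL2 (d : ℕ) (D : Domain) : Submodule ℝ (Lp (E d) 2 (vol d D)) :=
  (Submodule.span ℝ {f : Lp (E d) 2 (vol d D) | ∃ φ : E d → E d, ContDiff ℝ (⊤ : ℕ∞) φ ∧ IsOn D φ ∧ (∀ x, divergence φ x = 0) ∧
    f =ᵐ[vol d D] φ}).topologicalClosure

instance (D : Domain) : CompleteSpace (solenoidalL2 d D) :=
  (Submodule.isClosed_topologicalClosure _).completeSpace_coe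

/-- `z ∈ H^r` is the Leray projection `𝐏w` of `w ∈ L²`, the orthogonal projection of `w` onto
`H_σ` (in closed form `𝐏 = Id - ∇Δ⁻¹∇·`). -/
def IsLerayProjection (D : Domain) (r : ℝ) (w z : E d → E d) : Prop :=
  MemSob D r z ∧ ∃ hw : MemLp w 2 (vol d D),
    z =ᵐ[vol d D] ((solenoidalL2 d D).starProjection (hw.toLp w) : E d → E d)

/-! ### Vector measures -/

/-- The pairing `⟨ψ, μ⟩_* = ∫_D ψ · dμ` of a vector field with a vector measure. -/
def pairMeasure (ψ : E d → E d) (μ : VectorMeasure (E d) (E d)) : ℝ :=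
  ∫ᵛ x, ψ x ∂[innerSL ℝ; μ]

/-- `μ ∈ ℳ_σ(D)`: a divergence-free `ℝ^d`-valued measure on the domain,
`∫_D ∇φ · dμ = 0` for all `φ ∈ C_c^∞(D)`. -/
def IsDivFreeMeasure (D : Domain) (μ : VectorMeasure (E d) (E d)) : Prop :=
  (∀ B, Disjoint B (cell d D) → μ B = 0) ∧
    ∀ φ : E d → ℝ, IsTest D φ → pairMeasure (gradient φ) μ = 0

/-- The push-forward `Φ_# μ` of a vector measure, `(Φ_# μ)(B) = ∫_{Φ⁻¹(B)} ∇Φ dμ`. It satisfies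
`⟨ψ, Φ_# μ⟩_* = ⟨(∇^*Φ) (ψ ∘ Φ), μ⟩_*`. -/
def pushMeasure (D : Domain) (Φ : E d → E d) (μ : VectorMeasure (E d) (E d)) :
    VectorMeasure (E d) (E d) :=
  (μ.withDensity (fun x => fderiv ℝ Φ x) (ContinuousLinearMap.id ℝ (E d →L[ℝ] E d))).map
    (fun x => fold D (Φ x))

/-- `m` is the expectation `𝔼 N` of the random vector measure `N`. -/
def IsExpectation {Ω : Type*} [MeasurableSpace Ω] (P : Measure Ω)
    (N : Ω → VectorMeasure (E d) (E d)) (m : VectorMeasure (E d) (E d)) : Prop :=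
  ∀ B, MeasurableSet B → Integrable (fun ω => N ω B) P ∧ ∫ ω, N ω B ∂P = m B

end Kelvin

end

/-! The coupling term is linear in the multiplier, so stationarity in `δξ` says that Ẋ_t -
u_t(X^ν_t) is orthogonal to every admissible momentum. This forces the kinematic equation Ẋ_t =
u_t(X^ν_t), almost surely at all times and points. Varying the flow along (id + ε 1_A θ φ) ∘ X and
integrating by parts in time gives the momentum equation ∂_t ξ̃_t + (∇u_t)^*(X^ν_t) ξ̃_t = 0.

The noise shifts X by a vector that does not depend on x. Hence ∇X^ν = ∇X is differentiable in time
along almost every path and solves ∂_t ∇X = ∇u(X^ν) ∇X, and no stochastic calculus is needed. This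
linear equation and the momentum equation are adjoint to each other, so ⟨ξ̃_t(x), ∇X_t(x) e⟩ keeps
its initial value ⟨ξ_0(x), e⟩ for every vector e. This is `IsCritical.ae_conservation`, and both
circulation theorems are integrated forms of it.

Pathwise part: a vector measure has an integrable density h with respect to a finite measure m, and
the pairing with the push-forward becomes ∫ ⟨ξ̃_t, ∇X_t h⟩ dm = ∫ ⟨ξ_0, h⟩ dm. The push-forward is
again divergence-free by the chain rule. There the test function is composed with a flow that is
only C¹, so the vanishing on gradients is first extended to C¹ potentials with bounded gradient
(`AnnihilatesGradients.integral_eq_zero`).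

Statistical part: read through the inverse flow, the invariant is ξ'_t = (∇A_t)^* ξ_0(A_t). The
averaged push-forward is realised as the image of one vector measure on Ω × D, and Fubini's theorem
gives the identity for 𝔼 ξ'_t. To replace 𝔼 ξ'_t by its Leray projection, let g be their difference:
a bounded continuous field orthogonal to all divergence-free test fields. Its mollifications have
symmetric derivative, so they are gradients of potentials (periodic on the torus, because the mean
vanishes) and integrate to zero against divergence-free measures. Letting the mollification shrink
gives the same for g (`integral_inner_eq_zero_of_orthogonal`).

The analytic input is that s > 1 + d/2 makes the Sobolev norm control a field and its gradient
uniformly. All localisations use countably many separable test fields, so that one exceptional null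
set serves all times and points. -/

noncomputable section

namespace Kelvin

variable {d : ℕ}

/-! ### Vector measures with densities: integrals, images and push-forwards. -/

section VectorMeasures

variable {α : Type*} [MeasurableSpace α]

/-- A vector measure with values in `ℝ^d` has an integrable density with respect to a finite
positive measure. -/
theorem exists_withDensityᵥ_eq (μ : VectorMeasure α (E d)) :
    ∃ m : Measure α, IsFiniteMeasure m ∧ ∃ h : α → E d, Integrable h m ∧ μ = m.withDensityᵥ h := by
  let s : Fin d → SignedMeasure α := fun i =>
    μ.mapRange (EuclideanSpace.proj (𝕜 := ℝ) i : E d →L[ℝ] ℝ).toLinearMap.toAddMonoidHom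
      (EuclideanSpace.proj (𝕜 := ℝ) i : E d →L[ℝ] ℝ).continuous
  have hs : ∀ i B, s i B = μ B i := fun i B => rfl
  -- The sum of the coordinate variations dominates every coordinate, so one reference measure
  -- serves the Radon-Nikodym theorem for all of them.
  let m : Measure α := ∑ i, (s i).totalVariation
  have hac : ∀ i, s i ≪ᵥ m.toENNRealVectorMeasure := by
    intro i
    refine VectorMeasure.AbsolutelyContinuous.mk fun B hB h0 => ?_
    rw [Measure.toENNRealVectorMeasure_apply_measurable hB] at h0
    have h1 : (s i).totalVariation B = 0 := by
      simp only [m, Measure.finsetSum_apply] at h0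
      exact (Finset.sum_eq_zero_iff.1 h0) i (Finset.mem_univ i)
    have h2 := (s i).enorm_le_totalVariation B
    rw [h1] at h2
    simpa using h2
  have hfin : IsFiniteMeasure m := by
    constructor
    simp only [m, Measure.finsetSum_apply]
    exact ENNReal.sum_lt_top.2 fun i _ => measure_lt_top _ _
  let h : α → E d := fun x => WithLp.toLp 2 fun i => (s i).rnDeriv m x
  have hi : ∀ i, Integrable (fun x => h x i) m := fun i => SignedMeasure.integrable_rnDeriv _ _
  have hh : Integrable h m := by
    exact Integrable.of_eval_piLp hi
  refine ⟨m, hfin, h, hh, ?_⟩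
  ext1 B hB
  rw [withDensityᵥ_apply hh hB]
  ext i
  have h1 := SignedMeasure.withDensityᵥ_rnDeriv_eq (s i) m (hac i)
  have h2 : (EuclideanSpace.proj (𝕜 := ℝ) i : E d →L[ℝ] ℝ) (∫ x in B, h x ∂m)
      = ∫ x in B, h x i ∂m :=
    (ContinuousLinearMap.integral_comp_comm _ hh.integrableOn).symm
  have h3 : s i B = ∫ x in B, h x i ∂m := by
    rw [← h1, withDensityᵥ_apply (SignedMeasure.integrable_rnDeriv _ _) hB]
  rw [hs] at h3
  rw [h3]
  exact h2.symm

variable {G₁ G₂ G₃ : Type*} [NormedAddCommGroup G₁] [NormedSpace ℝ G₁]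
  [NormedAddCommGroup G₂] [NormedSpace ℝ G₂] [CompleteSpace G₂]
  [NormedAddCommGroup G₃] [NormedSpace ℝ G₃] [CompleteSpace G₃]

omit [NormedSpace ℝ G₁] in
theorem integrable_withDensityᵥ_of_bounded {M : Measure α} {g : α → G₂} (hg : Integrable g M)
    {f : α → G₁} (hf : StronglyMeasurable f) {C : ℝ} (hC : ∀ x, ‖f x‖ ≤ C) :
    (M.withDensityᵥ g).Integrable f := by
  rw [VectorMeasure.Integrable, Measure.variation_withDensityᵥ hg]
  have : IsFiniteMeasure (M.withDensity fun x => ‖g x‖ₑ) := isFiniteMeasure_withDensity hg.2.ne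
  exact Integrable.of_bound hf.aestronglyMeasurable C (Eventually.of_forall hC)

/-- The integral against a vector measure with a density. -/
theorem integral_withDensityᵥ {M : Measure α} {g : α → G₂} (hg : Integrable g M)
    {f : α → G₁} (hf : StronglyMeasurable f) {C : ℝ} (hC : ∀ x, ‖f x‖ ≤ C)
    (B : G₁ →L[ℝ] G₂ →L[ℝ] G₃) :
    ∫ᵛ x, f x ∂[B; M.withDensityᵥ g] = ∫ x, B (f x) (g x) ∂M := by
  have hfin : IsFiniteMeasure (M.withDensityᵥ g).variation := by
    rw [Measure.variation_withDensityᵥ hg]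
    exact isFiniteMeasure_withDensity hg.2.ne
  have hint : ∀ (c : G₁ →L[ℝ] G₂ →L[ℝ] G₃) (F : α → G₁), StronglyMeasurable F → 
      (∃ K, ∀ x, ‖F x‖ ≤ K) → Integrable (fun x => c (F x) (g x)) M := by
    rintro c F hF ⟨K, hK⟩
    refine Integrable.mono' ((hg.norm.const_mul (‖c‖ * K)))
      ((c.aestronglyMeasurable_comp₂ hF.aestronglyMeasurable hg.1)) ?_
    filter_upwards with x
    refine (c.le_opNorm₂ _ _).trans ?_
    gcongr
    exact hK x
  -- Both sides are additive in the integrand, so simple functions suffice; bounded approximation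
  -- and dominated convergence on each side give the rest.
  have hsimple : ∀ F : SimpleFunc α G₁,
      ∫ᵛ x, F x ∂[B; M.withDensityᵥ g] = ∫ x, B (F x) (g x) ∂M := by
    intro F
    induction F using SimpleFunc.induction with
    | const c hs =>
      rename_i s
      classical
      have h0 : s.piecewise (Function.const α c) (Function.const α (0 : G₁))
          = s.indicator (Function.const α c) := Set.piecewise_eq_indicator
      have h0' : ⇑(SimpleFunc.piecewise s hs (SimpleFunc.const α c) (SimpleFunc.const α 0))
          = s.indicator (Function.const α c) := by
        rw [SimpleFunc.coe_piecewise, SimpleFunc.coe_const, SimpleFunc.coe_const, ← h0]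
      rw [h0']
      rw [VectorMeasure.integral_indicator hs]
      have h1 : (fun x => B (s.indicator (Function.const α c) x) (g x))
          = s.indicator (fun x => B c (g x)) := by
        ext x
        by_cases hx : x ∈ s <;> simp [hx]
      rw [h1, integral_indicator hs, ContinuousLinearMap.integral_comp_comm _ hg.integrableOn]
      have h2 : ((M.withDensityᵥ g).restrict s) = (M.restrict s).withDensityᵥ g := by
        ext1 t ht
        rw [VectorMeasure.restrict_apply _ hs ht, withDensityᵥ_apply hg (ht.inter hs),
          withDensityᵥ_apply hg.integrableOn ht, Measure.restrict_restrict ht]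
      rw [h2]
      have hfin' : IsFiniteMeasure ((M.restrict s).withDensityᵥ g).variation := by
        rw [← h2]; infer_instance
      have := VectorMeasure.integral_const (μ := (M.restrict s).withDensityᵥ g) (B := B) c
      simp only [Function.const_apply]
      rw [this, withDensityᵥ_apply hg.integrableOn MeasurableSet.univ, Measure.restrict_univ]
    | add hd h1 h2 =>
      rename_i f1 f2
      have b : ∀ F : SimpleFunc α G₁, ∃ K, ∀ x, ‖F x‖ ≤ K := fun F => F.exists_forall_norm_le
      obtain ⟨K1, hK1⟩ := b f1
      obtain ⟨K2, hK2⟩ := b f2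
      simp only [SimpleFunc.coe_add, Pi.add_apply, map_add, add_apply]
      rw [VectorMeasure.integral_fun_add (integrable_withDensityᵥ_of_bounded hg f1.stronglyMeasurable hK1)
        (integrable_withDensityᵥ_of_bounded hg f2.stronglyMeasurable hK2), h1, h2,
        integral_add (hint B f1 f1.stronglyMeasurable ⟨K1, hK1⟩) (hint B f2 f2.stronglyMeasurable ⟨K2, hK2⟩)]
  let F : ℕ → SimpleFunc α G₁ := hf.approxBounded C
  have hFlim : ∀ x, Tendsto (fun n => F n x) atTop (𝓝 (f x)) := fun x =>
    hf.tendsto_approxBounded_of_norm_le (hC x)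
  by_cases hα : Nonempty α
  swap
  · rw [not_nonempty_iff] at hα
    simp [VectorMeasure.integral_of_isEmpty, Measure.eq_zero_of_isEmpty M]
  have hC0 : 0 ≤ C := (norm_nonneg _).trans (hC hα.some)
  have hFb : ∀ n x, ‖F n x‖ ≤ C := fun n x => hf.norm_approxBounded_le hC0 n x
  have hL : Tendsto (fun n => ∫ᵛ x, F n x ∂[B; M.withDensityᵥ g]) atTop
      (𝓝 (∫ᵛ x, f x ∂[B; M.withDensityᵥ g])) :=
    VectorMeasure.tendsto_integral_of_dominated_convergence (fun _ => C) (fun n => (F n).stronglyMeasurable.aestronglyMeasurable)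
    (integrable_const C) (fun n => Eventually.of_forall (hFb n)) (Eventually.of_forall hFlim)
  have hR : Tendsto (fun n => ∫ x, B (F n x) (g x) ∂M) atTop (𝓝 (∫ x, B (f x) (g x) ∂M)) := by
    refine tendsto_integral_of_dominated_convergence (fun x => ‖B‖ * C * ‖g x‖)
      (fun n => (hint B (F n) (F n).stronglyMeasurable ⟨C, hFb n⟩).1) (hg.norm.const_mul _)
      (fun n => Eventually.of_forall fun x => ?_) (Eventually.of_forall fun x => ?_)
    · refine (B.le_opNorm₂ _ _).trans ?_
      gcongr
      exact hFb n x
    · exact ((B.flip (g x)).continuous.tendsto _).comp (hFlim x)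
  simp only [hsimple] at hL
  exact tendsto_nhds_unique hL hR

end VectorMeasures

theorem measurable_fold (D : Domain) : Measurable (fold D : E d → E d) := by
  cases D
  · exact measurable_id
  · exact (WithLp.measurable_toLp 2 _).comp (measurable_pi_lambda _ fun i =>
      measurable_fract.comp (by fun_prop))

/-- The pairing with the image of a vector measure with density. -/
theorem pairMeasure_map_withDensityᵥ {α : Type*} [MeasurableSpace α] {M : Measure α}
    {g : α → E d} (hg : Integrable g M) {F : α → E d} (hF : Measurable F)
    {ψ : E d → E d} (hψ : StronglyMeasurable ψ) {C : ℝ} (hC : ∀ x, ‖ψ x‖ ≤ C) :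
    pairMeasure ψ ((M.withDensityᵥ g).map F) = ∫ z, ⟪ψ (F z), g z⟫_ℝ ∂M := by
  have hm : StronglyMeasurable (ψ ∘ F) := hψ.comp_measurable hF
  rw [pairMeasure, VectorMeasure.integral_map hF hψ.aestronglyMeasurable
    (integrable_withDensityᵥ_of_bounded hg hm fun x => hC _)]
  exact integral_withDensityᵥ hg hm (fun x => hC _) (innerSL ℝ)

theorem pairMeasure_withDensityᵥ {M : Measure (E d)}
    {g : E d → E d} (hg : Integrable g M)
    {ψ : E d → E d} (hψ : StronglyMeasurable ψ) {C : ℝ} (hC : ∀ x, ‖ψ x‖ ≤ C) :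
    pairMeasure ψ (M.withDensityᵥ g) = ∫ z, ⟪ψ z, g z⟫_ℝ ∂M :=
  integral_withDensityᵥ hg hψ hC (innerSL ℝ)

/-- The derivative of an arbitrary map is a measurable function of the point, so no smoothness of
`Φ` enters here. -/
theorem integrable_fderiv_apply {M : Measure (E d)} {h : E d → E d} (hh : Integrable h M)
    {Φ : E d → E d} {C : ℝ} (hC : ∀ x, ‖fderiv ℝ Φ x‖ ≤ C) :
    Integrable (fun x => fderiv ℝ Φ x (h x)) M := by
  refine Integrable.mono' (hh.norm.const_mul C) ?_ (Eventually.of_forall fun x => ?_)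
  · exact (ContinuousLinearMap.id ℝ (E d →L[ℝ] E d)).aestronglyMeasurable_comp₂
      (measurable_fderiv ℝ Φ).stronglyMeasurable.aestronglyMeasurable hh.1
  · exact (ContinuousLinearMap.le_opNorm _ _).trans (by gcongr; exact hC x)

/-- The push-forward of a vector measure with density. -/
theorem pushMeasure_withDensityᵥ {M : Measure (E d)} {h : E d → E d} (hh : Integrable h M)
    (D : Domain) {Φ : E d → E d} {C : ℝ} (hC : ∀ x, ‖fderiv ℝ Φ x‖ ≤ C) :
    pushMeasure D Φ (M.withDensityᵥ h)
      = (M.withDensityᵥ fun x => fderiv ℝ Φ x (h x)).map fun x => fold D (Φ x) := by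
  unfold pushMeasure
  congr 1
  have hm : StronglyMeasurable (fderiv ℝ Φ) := (measurable_fderiv ℝ Φ).stronglyMeasurable
  ext1 B hB
  rw [VectorMeasure.withDensity_apply (integrable_withDensityᵥ_of_bounded hh hm hC),
    withDensityᵥ_apply (integrable_fderiv_apply hh hC) hB]
  have h2 : ((M.withDensityᵥ h).restrict B) = (M.restrict B).withDensityᵥ h := by
    ext1 t ht
    rw [VectorMeasure.restrict_apply _ hB ht, withDensityᵥ_apply hh (ht.inter hB),
      withDensityᵥ_apply hh.integrableOn ht, Measure.restrict_restrict ht]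
  rw [h2, integral_withDensityᵥ hh.integrableOn hm hC]
  rfl

end Kelvin

end

/-! ### Fourier synthesis and integrability of the Sobolev weights. -/

noncomputable section

namespace Kelvin

variable {d : ℕ}

/-- Real parts of the coordinates of a complex vector. -/
def reMap (d : ℕ) : EuclideanSpace ℂ (Fin d) →L[ℝ] E d :=
  (EuclideanSpace.equiv (Fin d) ℝ).symm.toContinuousLinearMap ∘L
    ContinuousLinearMap.pi fun i =>
      Complex.reCLM ∘L (EuclideanSpace.proj (𝕜 := ℂ) i).restrictScalars ℝ

theorem reMap_apply (z : EuclideanSpace ℂ (Fin d)) (i : Fin d) : reMap d z i = (z i).re := rfl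

theorem norm_reMap_le (z : EuclideanSpace ℂ (Fin d)) : ‖reMap d z‖ ≤ ‖z‖ := by
  rw [EuclideanSpace.norm_eq, EuclideanSpace.norm_eq]
  refine Real.sqrt_le_sqrt (Finset.sum_le_sum fun i _ => ?_)
  have h := Complex.abs_re_le_norm (z i)
  simpa [reMap_apply] using pow_le_pow_left₀ (abs_nonneg _) h 2

/-- The inverse Fourier transform with respect to the measure on frequencies. -/
def fourierSynth (D : Domain) (F : E d → EuclideanSpace ℂ (Fin d)) :
    E d → EuclideanSpace ℂ (Fin d) :=
  VectorFourier.fourierIntegral Real.fourierChar (freqMeasure d D)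
    (-innerSL ℝ : E d →L[ℝ] E d →L[ℝ] ℝ).toLinearMap₁₂ F

/-- The pairing is the negative inner product because `VectorFourier.fourierIntegral` evaluates the
character at minus the pairing; the two signs cancel. -/
theorem fourierSynth_integrand (k x : E d) (z : EuclideanSpace ℂ (Fin d)) :
    Real.fourierChar (-((-innerSL ℝ : E d →L[ℝ] E d →L[ℝ] ℝ).toLinearMap₁₂ k x)) • z
      = Complex.exp (2 * Real.pi * Complex.I * (⟪k, x⟫_ℝ : ℝ)) • z := by
  have h : (-((-innerSL ℝ : E d →L[ℝ] E d →L[ℝ] ℝ).toLinearMap₁₂ k x)) = ⟪k, x⟫_ℝ := by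
    simp
  rw [h, Circle.smul_def, Real.fourierChar_apply]
  congr 2
  push_cast
  ring

/-- The synthesised complex field is real valued, so its real part loses nothing. This transfers
continuity and differentiability of Fourier integrals to `f`, for both frequency measures at once.
-/
theorem IsFourierTransformOf.eq_reMap {D : Domain} {F : E d → EuclideanSpace ℂ (Fin d)}
    {f : E d → E d} (hF : IsFourierTransformOf D F f) (x : E d) :
    f x = reMap d (fourierSynth D F x) := by
  ext i
  rw [reMap_apply]
  have h := hF.2 x i
  have hL : Continuous fun p : E d × E d =>
      (-innerSL ℝ : E d →L[ℝ] E d →L[ℝ] ℝ).toLinearMap₁₂ p.1 p.2 := by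
    have : (fun p : E d × E d => (-innerSL ℝ : E d →L[ℝ] E d →L[ℝ] ℝ).toLinearMap₁₂ p.1 p.2)
      = fun p => - ⟪p.1, p.2⟫_ℝ := by ext p; simp
    rw [this]
    fun_prop
  have hint := (VectorFourier.fourierIntegral_convergent_iff (μ := freqMeasure d D)
    Real.continuous_fourierChar hL x).2 hF.1
  have h2 : fourierSynth D F x i
      = ∫ k, Complex.exp (2 * Real.pi * Complex.I * (⟪k, x⟫_ℝ : ℝ)) * F k i ∂(freqMeasure d D) := by
    have h3 := (EuclideanSpace.proj (𝕜 := ℂ) i : EuclideanSpace ℂ (Fin d) →L[ℂ] ℂ).integral_comp_comm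
      hint
    refine Eq.trans h3.symm ?_
    refine integral_congr_ae (Eventually.of_forall fun k => ?_)
    have h4 := congrArg (fun z : EuclideanSpace ℂ (Fin d) => z i)
      (fourierSynth_integrand k x (F k))
    exact h4
  rw [h2, ← h, Complex.ofReal_re]

/-- The weight `1 + |k|²`. -/
theorem one_add_sq_pos (k : E d) : 0 < 1 + ‖k‖ ^ 2 := by positivity

/-- Integral of a negative power of the weight over the frequencies. -/
def weightIntegral (d : ℕ) (D : Domain) (σ : ℝ) : ℝ≥0∞ :=
  ∫⁻ k : E d, ENNReal.ofReal ((1 + ‖k‖ ^ 2) ^ (-σ)) ∂(freqMeasure d D)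

theorem measurable_ofReal_weight (σ : ℝ) :
    Measurable fun k : E d => ENNReal.ofReal ((1 + ‖k‖ ^ 2) ^ σ) :=
  ENNReal.measurable_ofReal.comp (Measurable.pow_const (by fun_prop) _)

theorem intPoint_injective : Function.Injective (intPoint : (Fin d → ℤ) → E d) := by
  intro k l h
  ext i
  have := congrFun (congrArg WithLp.ofLp h) i
  simpa [intPoint] using this

theorem intPoint_zero : (intPoint 0 : E d) = 0 := by
  ext i
  simp [intPoint]

/-- The integer points lie in the lattice spanned by the standard basis, which has rank `d`, and
powers of the norm below minus the rank are summable over a lattice. -/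
theorem summable_norm_intPoint_rpow {τ : ℝ} (hτ : τ < -(d : ℝ)) :
    Summable fun k : Fin d → ℤ => ‖(intPoint k : E d)‖ ^ τ := by
  obtain ⟨b, hb⟩ : ∃ b : Module.Basis (Fin d) ℝ (E d), ∀ i, b i = basisVec i :=
    ⟨(EuclideanSpace.basisFun (Fin d) ℝ).toBasis, fun i => by simp [basisVec]⟩
  have hmem : ∀ k : Fin d → ℤ, (intPoint k : E d) ∈ Submodule.span ℤ (Set.range b) := by
    intro k
    have : (intPoint k : E d) = ∑ i, k i • b i := by
      ext j
      simp [intPoint, hb, basisVec, Finset.sum_apply, Pi.single_apply]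
    rw [this]
    exact Submodule.sum_mem _ fun i _ => Submodule.smul_mem _ _
      (Submodule.subset_span (Set.mem_range_self i))
  have hrank : Module.finrank ℤ (Submodule.span ℤ (Set.range b)) = d := by
    rw [Module.finrank_eq_card_basis (b.restrictScalars ℤ), Fintype.card_fin]
  have hs := ZLattice.summable_norm_rpow (Submodule.span ℤ (Set.range b)) τ (by rw [hrank]; exact hτ)
  have hinj : Function.Injective
      fun k : Fin d → ℤ => (⟨intPoint k, hmem k⟩ : Submodule.span ℤ (Set.range b)) :=
    fun k l h => intPoint_injective (congrArg Subtype.val h)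
  have h5 := hs.comp_injective hinj
  simpa only [Function.comp_def, Submodule.coe_norm] using h5

theorem summable_weight_intPoint {σ : ℝ} (hσ : (d : ℝ) / 2 < σ) :
    Summable fun k : Fin d → ℤ => (1 + ‖(intPoint k : E d)‖ ^ 2) ^ (-σ) := by
  have hσ0 : 0 ≤ σ := le_trans (by positivity) hσ.le
  refine Summable.of_norm_bounded_eventually
    (summable_norm_intPoint_rpow (τ := -(2 * σ)) (by linarith)) ?_
  rw [Filter.eventually_cofinite]
  -- The comparison fails only at the origin, where the negative power of zero has the value 0 while
  -- the weight is 1.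
  refine (Set.finite_singleton (0 : Fin d → ℤ)).subset fun k hk => ?_
  by_contra hk0
  refine hk ?_
  have hpos : 0 < ‖(intPoint k : E d)‖ := by
    rw [norm_pos_iff]
    intro h0
    exact hk0 (intPoint_injective (h0.trans intPoint_zero.symm))
  rw [Real.norm_of_nonneg (Real.rpow_nonneg (by positivity) _)]
  calc (1 + ‖(intPoint k : E d)‖ ^ 2) ^ (-σ) ≤ (‖(intPoint k : E d)‖ ^ 2) ^ (-σ) :=
        Real.rpow_le_rpow_of_nonpos (by positivity) (by linarith) (by linarith)
    _ = ‖(intPoint k : E d)‖ ^ (-(2 * σ)) := by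
        rw [← Real.rpow_natCast, ← Real.rpow_mul hpos.le]
        congr 1
        push_cast
        ring

theorem weightIntegral_lt_top (D : Domain) {σ : ℝ} (hσ : (d : ℝ) / 2 < σ) :
    weightIntegral d D σ < ∞ := by
  cases D
  · have h : Integrable (fun k : E d => (1 + ‖k‖ ^ 2) ^ (-(2 * σ) / 2)) :=
      integrable_rpow_neg_one_add_norm_sq (by simp; linarith)
    have h2 := h.lintegral_lt_top
    unfold weightIntegral freqMeasure
    refine lt_of_eq_of_lt (lintegral_congr fun k => ?_) h2
    congr 2
    ring
  · unfold weightIntegral freqMeasure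
    rw [lintegral_sum_measure]
    simp only [lintegral_dirac]
    exact (summable_weight_intPoint hσ).tsum_ofReal_lt_top

/-- The constant of the Sobolev embedding of `H^r` into the space of functions with bounded first
derivatives. -/
def sobConst (d : ℕ) (D : Domain) (r : ℝ) : ℝ≥0∞ :=
  weightIntegral d D (r - 1) ^ (1 / 2 : ℝ)

theorem sobConst_lt_top (D : Domain) {r : ℝ} (hr : 1 + (d : ℝ) / 2 < r) : sobConst d D r < ∞ :=
  ENNReal.rpow_lt_top_of_nonneg (by norm_num) (weightIntegral_lt_top D (by linarith)).ne

/-- Cauchy-Schwarz for the splitting of the exponent 1/2 as (1 - r)/2 + r/2. The first factor has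
finite square integral once r - 1 > d/2. The left side dominates the integrals of |F| and of |k||F|,
hence the sup norms of the field and of its gradient up to 2π. -/
theorem lintegral_weight_mul_le (D : Domain) (r : ℝ) {F : E d → EuclideanSpace ℂ (Fin d)}
    (hF : AEStronglyMeasurable F (freqMeasure d D)) :
    ∫⁻ k, ENNReal.ofReal ((1 + ‖k‖ ^ 2) ^ (1 / 2 : ℝ)) * ‖F k‖ₑ ∂(freqMeasure d D) ≤
      sobConst d D r *
        (∫⁻ k, ENNReal.ofReal ((1 + ‖k‖ ^ 2) ^ r) * ‖F k‖ₑ ^ 2 ∂(freqMeasure d D)) ^ (1 / 2 : ℝ) := by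
  have h := ENNReal.lintegral_mul_le_Lp_mul_Lq (freqMeasure d D) (Real.HolderConjugate.two_two)
    (f := fun k : E d => ENNReal.ofReal ((1 + ‖k‖ ^ 2) ^ ((1 - r) / 2)))
    (g := fun k => ENNReal.ofReal ((1 + ‖k‖ ^ 2) ^ (r / 2)) * ‖F k‖ₑ)
    (measurable_ofReal_weight _).aemeasurable
    ((measurable_ofReal_weight _).aemeasurable.mul hF.enorm)
  refine le_trans (le_of_eq ?_) (h.trans (le_of_eq ?_))
  · refine lintegral_congr fun k => ?_
    simp only [Pi.mul_apply]
    rw [← mul_assoc, ← ENNReal.ofReal_mul (by positivity), ← Real.rpow_add (one_add_sq_pos k)]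
    congr 4
    ring
  · unfold sobConst weightIntegral
    congr 2
    · refine lintegral_congr fun k => ?_
      rw [ENNReal.ofReal_rpow_of_nonneg (by positivity) (by norm_num),
        ← Real.rpow_mul (one_add_sq_pos k).le]
      congr 2
      ring
    · refine lintegral_congr fun k => ?_
      rw [ENNReal.mul_rpow_of_nonneg _ _ (by norm_num),
        ENNReal.ofReal_rpow_of_nonneg (by positivity) (by norm_num),
        ← Real.rpow_mul (one_add_sq_pos k).le]
      congr 1
      · congr 2
        ring
      · exact ENNReal.rpow_two _

/-- A bound valid for every transform passes to the infimum, so uniqueness of the Fourier transform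
is never needed. Membership in the space matters only for K = 0, where one transform must exist. -/
theorem le_mul_sobNorm {D : Domain} {r : ℝ} {f : E d → E d} {a K : ℝ≥0∞} (hK : K ≠ ∞)
    (h : ∀ F, IsFourierTransformOf D F f → a ≤ K *
      (∫⁻ k, ENNReal.ofReal ((1 + ‖k‖ ^ 2) ^ r) * ‖F k‖ₑ ^ 2 ∂(freqMeasure d D)) ^ (1 / 2 : ℝ))
    (hf : MemSob D r f) :
    a ≤ K * sobNorm D r f := by
  unfold sobNorm
  have hne : ∃ F, IsFourierTransformOf D F f := by
    by_contra hcon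
    push Not at hcon
    refine hf.ne ?_
    unfold sobNorm
    simp [hcon]
  by_cases hK0 : K = 0
  · obtain ⟨F, hF⟩ := hne
    have := h F hF
    simp only [hK0, zero_mul] at this
    simp [le_zero_iff.1 this]
  · rw [mul_comm, ← ENNReal.div_le_iff_le_mul (Or.inl hK0) (Or.inl hK)]
    refine le_iInf₂ fun F hF => ?_
    rw [ENNReal.div_le_iff_le_mul (Or.inl hK0) (Or.inl hK), mul_comm]
    exact h F hF

end Kelvin

end

/-! ### Sobolev embedding into bounded C¹ fields. -/

noncomputable section

namespace Kelvin

variable {d : ℕ}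

theorem continuous_freqPairing : Continuous fun p : E d × E d =>
    (-innerSL ℝ : E d →L[ℝ] E d →L[ℝ] ℝ).toLinearMap₁₂ p.1 p.2 := by
  have : (fun p : E d × E d => (-innerSL ℝ : E d →L[ℝ] E d →L[ℝ] ℝ).toLinearMap₁₂ p.1 p.2)
    = fun p => - ⟪p.1, p.2⟫_ℝ := by ext p; simp
  rw [this]
  fun_prop

theorem norm_le_weight (k : E d) : ‖k‖ ≤ (1 + ‖k‖ ^ 2) ^ (1 / 2 : ℝ) := by
  rw [← Real.sqrt_eq_rpow]
  exact Real.le_sqrt_of_sq_le (by linarith)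

theorem one_le_weight (k : E d) : 1 ≤ (1 + ‖k‖ ^ 2) ^ (1 / 2 : ℝ) := by
  rw [← Real.sqrt_eq_rpow]
  exact Real.le_sqrt_of_sq_le (by nlinarith [sq_nonneg ‖k‖])

section Embedding

variable {D : Domain} {r : ℝ} {F : E d → EuclideanSpace ℂ (Fin d)} {f : E d → E d}

/-- The `L²` norm of the Fourier transform with Sobolev weight. -/
def weightedNorm (D : Domain) (r : ℝ) (F : E d → EuclideanSpace ℂ (Fin d)) : ℝ≥0∞ :=
  (∫⁻ k, ENNReal.ofReal ((1 + ‖k‖ ^ 2) ^ r) * ‖F k‖ₑ ^ 2 ∂(freqMeasure d D)) ^ (1 / 2 : ℝ)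

theorem MemSob.exists_transform (hf : MemSob D r f) :
    ∃ F, IsFourierTransformOf D F f ∧ weightedNorm D r F < ∞ := by
  have h : sobNorm D r f < ∞ := hf
  unfold sobNorm at h
  simp only [iInf_lt_iff] at h
  obtain ⟨F, hF, h⟩ := h
  exact ⟨F, hF, h⟩

theorem IsFourierTransformOf.enorm_le (hF : IsFourierTransformOf D F f) (x : E d) :
    ‖f x‖ₑ ≤ sobConst d D r * weightedNorm D r F := by
  refine le_trans ?_ (lintegral_weight_mul_le D r hF.1.1)
  have h1 : ‖f x‖ₑ ≤ ‖fourierSynth D F x‖ₑ := by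
    rw [hF.eq_reMap x]
    exact enorm_le_iff_norm_le.2 (norm_reMap_le _)
  refine h1.trans ((enorm_integral_le_lintegral_enorm _).trans (lintegral_mono fun k => ?_))
  simp only
  rw [fourierSynth_integrand, enorm_smul]
  refine mul_le_mul' ?_ le_rfl
  rw [← ofReal_norm, Complex.norm_exp]
  refine ENNReal.ofReal_le_ofReal ?_
  simp only [Complex.mul_re, Complex.re_ofNat, Complex.ofReal_re, Complex.im_ofNat,
    Complex.ofReal_im, mul_zero, sub_zero, Complex.I_re, Complex.mul_im, zero_mul, add_zero,
    Complex.I_im, mul_one, sub_self, Real.exp_zero]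
  simpa using one_le_weight k

theorem IsFourierTransformOf.integrable_norm_mul (hF : IsFourierTransformOf D F f)
    (hr : 1 + (d : ℝ) / 2 < r) (hw : weightedNorm D r F < ∞) :
    Integrable (fun k => ‖k‖ * ‖F k‖) (freqMeasure d D) := by
  have hlt := (lintegral_weight_mul_le D r hF.1.1).trans_lt
    (ENNReal.mul_lt_top (sobConst_lt_top D hr) hw)
  refine ⟨(measurable_norm.aestronglyMeasurable.mul hF.1.1.norm), ?_⟩
  refine lt_of_le_of_lt (lintegral_mono fun k => ?_) hlt
  simp only [enorm_mul, enorm_norm]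
  refine mul_le_mul' ?_ le_rfl
  rw [← ofReal_norm]
  exact ENNReal.ofReal_le_ofReal (norm_le_weight k)

theorem IsFourierTransformOf.hasFDerivAt (hF : IsFourierTransformOf D F f)
    (hr : 1 + (d : ℝ) / 2 < r) (hw : weightedNorm D r F < ∞) (x : E d) :
    HasFDerivAt f (reMap d ∘L VectorFourier.fourierIntegral Real.fourierChar (freqMeasure d D)
      (-innerSL ℝ : E d →L[ℝ] E d →L[ℝ] ℝ).toLinearMap₁₂
      (VectorFourier.fourierSMulRight (-innerSL ℝ : E d →L[ℝ] E d →L[ℝ] ℝ) F) x) x := by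
  have h := VectorFourier.hasFDerivAt_fourierIntegral (-innerSL ℝ : E d →L[ℝ] E d →L[ℝ] ℝ) hF.1
    (hF.integrable_norm_mul hr hw) x
  have h2 := (reMap d).hasFDerivAt.comp x h
  exact h2.congr_of_eventuallyEq (Eventually.of_forall hF.eq_reMap)

theorem norm_fourierSMulRight_inner_le (k : E d) :
    ‖VectorFourier.fourierSMulRight (-innerSL ℝ : E d →L[ℝ] E d →L[ℝ] ℝ) F k‖
      ≤ 2 * Real.pi * ‖k‖ * ‖F k‖ := by
  rw [VectorFourier.norm_fourierSMulRight]
  have : ‖(-innerSL ℝ : E d →L[ℝ] E d →L[ℝ] ℝ) k‖ = ‖k‖ := by simp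
  rw [this]

theorem IsFourierTransformOf.integrable_fourierSMulRight (hF : IsFourierTransformOf D F f)
    (hr : 1 + (d : ℝ) / 2 < r) (hw : weightedNorm D r F < ∞) :
    Integrable (VectorFourier.fourierSMulRight (-innerSL ℝ : E d →L[ℝ] E d →L[ℝ] ℝ) F)
      (freqMeasure d D) := by
  refine Integrable.mono' ((hF.integrable_norm_mul hr hw).const_mul (2 * Real.pi))
    hF.1.1.fourierSMulRight (Eventually.of_forall fun k => ?_)
  refine (norm_fourierSMulRight_inner_le k).trans (le_of_eq (by ring))

theorem norm_reMap_comp_le {V : Type*} [NormedAddCommGroup V] [NormedSpace ℝ V]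
    (A : V →L[ℝ] EuclideanSpace ℂ (Fin d)) : ‖reMap d ∘L A‖ ≤ ‖A‖ :=
  ContinuousLinearMap.opNorm_le_bound _ (norm_nonneg _) fun v =>
    (norm_reMap_le _).trans (A.le_opNorm v)

theorem MemSob.contDiff (hf : MemSob D r f) (hr : 1 + (d : ℝ) / 2 < r) : ContDiff ℝ 1 f := by
  obtain ⟨F, hF, hw⟩ := hf.exists_transform
  rw [contDiff_one_iff_fderiv]
  refine ⟨fun x => (hF.hasFDerivAt hr hw x).differentiableAt, ?_⟩
  have : fderiv ℝ f = fun x => reMap d ∘L VectorFourier.fourierIntegral Real.fourierChar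
      (freqMeasure d D) (-innerSL ℝ : E d →L[ℝ] E d →L[ℝ] ℝ).toLinearMap₁₂
      (VectorFourier.fourierSMulRight (-innerSL ℝ : E d →L[ℝ] E d →L[ℝ] ℝ) F) x :=
    funext fun x => (hF.hasFDerivAt hr hw x).fderiv
  rw [this]
  exact ((ContinuousLinearMap.compL ℝ (E d) _ _ (reMap d)).continuous).comp
    (VectorFourier.fourierIntegral_continuous Real.continuous_fourierChar continuous_freqPairing
      (hF.integrable_fourierSMulRight hr hw))

theorem MemSob.enorm_le (hf : MemSob D r f) (hr : 1 + (d : ℝ) / 2 < r) (x : E d) :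
    ‖f x‖ₑ ≤ sobConst d D r * sobNorm D r f :=
  le_mul_sobNorm (sobConst_lt_top D hr).ne (fun _ hF => hF.enorm_le x) hf

theorem MemSob.enorm_fderiv_le (hf : MemSob D r f) (hr : 1 + (d : ℝ) / 2 < r) (x : E d) :
    ‖fderiv ℝ f x‖ₑ ≤ (ENNReal.ofReal (2 * Real.pi) * sobConst d D r) * sobNorm D r f := by
  refine le_mul_sobNorm
    (ENNReal.mul_lt_top ENNReal.ofReal_lt_top (sobConst_lt_top D hr)).ne (fun F hF => ?_) hf
  by_cases hw : weightedNorm D r F < ∞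
  · rw [(hF.hasFDerivAt hr hw x).fderiv]
    refine (enorm_le_iff_norm_le.2 (norm_reMap_comp_le _)).trans ?_
    refine (enorm_integral_le_lintegral_enorm _).trans ?_
    rw [mul_assoc]
    refine le_trans ?_ (mul_le_mul' le_rfl (lintegral_weight_mul_le D r hF.1.1))
    rw [← lintegral_const_mul' _ _ ENNReal.ofReal_ne_top]
    refine lintegral_mono fun k => ?_
    simp only
    rw [← mul_assoc, ← ENNReal.ofReal_mul (by positivity), ← ofReal_norm, Circle.norm_smul,
      ← ofReal_norm, ← ENNReal.ofReal_mul (by positivity)]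
    refine ENNReal.ofReal_le_ofReal ((norm_fourierSMulRight_inner_le k).trans ?_)
    gcongr
    exact norm_le_weight k
  · have : weightedNorm D r F = ∞ := by simpa using hw
    unfold weightedNorm at this
    rw [this]
    -- With an infinite weighted norm the bound is trivial unless the constant vanishes, and in that
    -- degenerate case the sup bound already forces f = 0.
    by_cases h0 : sobConst d D r = 0
    · have hfz : f = 0 := by
        ext1 y
        have := hf.enorm_le hr y
        rw [h0, zero_mul] at this
        simpa using this
      have h1 : fderiv ℝ f x = 0 := by
        rw [hfz]
        exact fderiv_const_apply 0
      rw [h1, ← ofReal_norm, norm_zero, ENNReal.ofReal_zero]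
      exact zero_le
    · rw [ENNReal.mul_top]
      · exact le_top
      · simp [h0, Real.pi_pos]

/-- On the torus all frequencies are integer points; their pairing with an integer shift is an
integer, so every exponential in the series is unchanged. -/
theorem MemSob.isOn (hf : MemSob D r f) : IsOn D f := by
  obtain ⟨F, hF, hw⟩ := hf.exists_transform
  cases D
  · trivial
  · intro x l
    ext i
    have h1 := hF.2 x i
    have h2 := hF.2 (x + intPoint l) i
    have h3 : ((f (x + intPoint l) i : ℝ) : ℂ) = (f x i : ℝ) := by
      rw [h1, h2]
      refine integral_congr_ae ?_
      unfold freqMeasure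
      rw [Filter.EventuallyEq, Measure.ae_sum_iff]
      intro k
      rw [ae_dirac_eq]
      simp only [Filter.eventually_pure]
      congr 1
      have h4 : (⟪(intPoint k : E d), x + intPoint l⟫_ℝ : ℝ)
          = ⟪(intPoint k : E d), x⟫_ℝ + ((∑ i, k i * l i : ℤ) : ℝ) := by
        rw [inner_add_right]
        congr 1
        simp [intPoint, PiLp.inner_apply, mul_comm]
      rw [h4]
      push_cast
      rw [mul_add, Complex.exp_add]
      have h5 : Complex.exp (2 * Real.pi * Complex.I * (∑ i, (k i : ℂ) * (l i : ℂ))) = 1 := by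
        rw [Complex.exp_eq_one_iff]
        exact ⟨∑ i, k i * l i, by push_cast; ring⟩
      rw [h5, mul_one]
    exact_mod_cast h3

end Embedding

theorem sobNorm_smul_le (D : Domain) (r : ℝ) (c : ℝ) {f : E d → E d} (hf : MemSob D r f) :
    sobNorm D r (c • f) ≤ ‖c‖ₑ * sobNorm D r f := by
  refine le_mul_sobNorm (by simp) (fun F hF => ?_) hf
  have hF' : IsFourierTransformOf D ((c : ℂ) • F) (c • f) := by
    refine ⟨hF.1.smul (c : ℂ), fun x i => ?_⟩
    simp only [Pi.smul_apply, PiLp.smul_apply, smul_eq_mul, Complex.ofReal_mul]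
    rw [hF.2 x i, ← integral_const_mul]
    congr 1
    ext k
    ring
  refine (iInf₂_le ((c : ℂ) • F) hF').trans ?_
  · have h : ∀ k, ENNReal.ofReal ((1 + ‖k‖ ^ 2) ^ r) * ‖((c : ℂ) • F) k‖ₑ ^ 2
        = ‖c‖ₑ ^ 2 * (ENNReal.ofReal ((1 + ‖k‖ ^ 2) ^ r) * ‖F k‖ₑ ^ 2) := by
      intro k
      have : ‖(c : ℂ)‖ₑ = ‖c‖ₑ := by
        rw [← ofReal_norm, ← ofReal_norm, Complex.norm_real]
      rw [Pi.smul_apply, enorm_smul, mul_pow, this]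
      ring
    simp only [h]
    rw [lintegral_const_mul' _ _ (by simp), ENNReal.mul_rpow_of_nonneg _ _ (by norm_num)]
    refine mul_le_mul' (le_of_eq ?_) le_rfl
    rw [← ENNReal.rpow_natCast, ← ENNReal.rpow_mul]
    norm_num

theorem MemSob.const_smul {D : Domain} {r : ℝ} {f : E d → E d} (hf : MemSob D r f) (c : ℝ) :
    MemSob D r (c • f) :=
  (sobNorm_smul_le D r c hf).trans_lt (ENNReal.mul_lt_top (by simp) hf)

end Kelvin

end

/-! ### Plancherel's theorem and smooth compactly supported fields on the whole space. -/

noncomputable section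

namespace Kelvin

variable {d : ℕ}

section Plancherel

open scoped FourierTransform SchwartzMap

theorem fourierSynth_space (F : E d → EuclideanSpace ℂ (Fin d)) :
    fourierSynth .space F = 𝓕⁻ F := by
  ext1 x
  rw [Real.fourierInv_eq]
  refine integral_congr_ae (Eventually.of_forall fun k => ?_)
  simp

/-- The multiplication formula, a case of Fubini's theorem. It identifies the pointwise inverse
Fourier integral with the inverse transform of tempered distributions. -/
theorem integral_smul_fourierInv_eq {F : E d → EuclideanSpace ℂ (Fin d)}
    (hF : Integrable F volume) (ψ : 𝓢(E d, ℂ)) :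
    ∫ x, ψ x • 𝓕⁻ F x = ∫ k, 𝓕⁻ (ψ : E d → ℂ) k • F k := by
  have h := VectorFourier.integral_fourierIntegral_smul_eq_flip (μ := (volume : Measure (E d)))
    (ν := (volume : Measure (E d)))
    (L := (-innerSL ℝ : E d →L[ℝ] E d →L[ℝ] ℝ).toLinearMap₁₂) (f := ψ) (g := F)
    Real.continuous_fourierChar continuous_freqPairing ψ.integrable hF
  have e1 : ∀ x, VectorFourier.fourierIntegral Real.fourierChar volume
      (-innerSL ℝ : E d →L[ℝ] E d →L[ℝ] ℝ).toLinearMap₁₂ ψ x = 𝓕⁻ (ψ : E d → ℂ) x := by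
    intro x
    rw [Real.fourierInv_eq]
    refine integral_congr_ae (Eventually.of_forall fun k => ?_)
    simp
  have e2 : ∀ x, VectorFourier.fourierIntegral Real.fourierChar volume
      (-innerSL ℝ : E d →L[ℝ] E d →L[ℝ] ℝ).toLinearMap₁₂.flip F x = 𝓕⁻ F x := by
    intro x
    rw [Real.fourierInv_eq]
    refine integral_congr_ae (Eventually.of_forall fun k => ?_)
    simp [real_inner_comm]
  simp only [e1, e2] at h
  exact h.symm

theorem continuous_fourierInv_of_integrable {F : E d → EuclideanSpace ℂ (Fin d)}
    (hF : Integrable F volume) : Continuous (𝓕⁻ F) := by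
  rw [← fourierSynth_space]
  exact VectorFourier.fourierIntegral_continuous Real.continuous_fourierChar
    continuous_freqPairing hF

/-- Plancherel's theorem for the Fourier integral of a function in `L¹ ∩ L²`. -/
theorem eLpNorm_fourierInv_eq {F : E d → EuclideanSpace ℂ (Fin d)}
    (hF : Integrable F volume) (hF2 : MemLp F 2 volume) :
    eLpNorm (𝓕⁻ F) 2 volume = eLpNorm F 2 volume := by
  obtain ⟨Fp, hFp⟩ : ∃ Fp : Lp (EuclideanSpace ℂ (Fin d)) 2 (volume : Measure (E d)),
    Fp =ᵐ[volume] F := ⟨hF2.toLp, hF2.coeFn_toLp⟩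
  obtain ⟨H, hH⟩ : ∃ H : Lp (EuclideanSpace ℂ (Fin d)) 2 (volume : Measure (E d)),
    H = 𝓕⁻ Fp := ⟨_, rfl⟩
  have hHm : MemLp H 2 (volume : Measure (E d)) := Lp.memLp H
  -- The Fourier integral of F and the abstract inverse transform in L² act alike on test functions,
  -- so they agree almost everywhere, and the isometry property of the latter passes to the former.
  have hae : 𝓕⁻ F =ᵐ[volume] H := by
    refine ae_eq_of_integral_contDiff_smul_eq
      (continuous_fourierInv_of_integrable hF).locallyIntegrable
      (hHm.locallyIntegrable (by norm_num)) fun g hg hgc => ?_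
    have hgC : ContDiff ℝ (⊤ : ℕ∞) fun x => (g x : ℂ) := Complex.ofRealCLM.contDiff.comp hg
    have hgcC : HasCompactSupport fun x => (g x : ℂ) := hgc.comp_left (g := fun t : ℝ => (t : ℂ)) (by simp)
    obtain ⟨ψ, hψ⟩ : ∃ ψ : 𝓢(E d, ℂ), ∀ x, ψ x = g x :=
      ⟨hgcC.toSchwartzMap hgC, fun x => rfl⟩
    have h1 := integral_smul_fourierInv_eq hF ψ
    have h2 : (H : 𝓢'(E d, EuclideanSpace ℂ (Fin d))) ψ = ∫ x, ψ x • H x :=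
      Lp.toTemperedDistribution_apply H ψ
    rw [hH, ← Lp.fourierInv_toTemperedDistribution_eq, TemperedDistribution.fourierInv_apply,
      Lp.toTemperedDistribution_apply, SchwartzMap.fourierInv_coe, ← hH] at h2
    have h3 : ∫ k, 𝓕⁻ (ψ : E d → ℂ) k • Fp k = ∫ k, 𝓕⁻ (ψ : E d → ℂ) k • F k := by
      refine integral_congr_ae ?_
      filter_upwards [hFp] with k hk
      rw [hk]
    rw [h3, ← h1] at h2
    have h4 : ∀ (z : EuclideanSpace ℂ (Fin d)) x, ψ x • z = g x • z := fun z x => by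
      rw [hψ, Complex.coe_smul]
    simpa only [h4] using h2
  rw [eLpNorm_congr_ae hae]
  have h4 : ‖H‖ = ‖Fp‖ := by
    rw [← Lp.norm_fourier_eq H, hH, FourierTransform.fourier_fourierInv_eq]
  rw [Lp.norm_def, Lp.norm_def,
    ENNReal.toReal_eq_toReal_iff' (Lp.memLp _).eLpNorm_lt_top.ne (Lp.memLp _).eLpNorm_lt_top.ne] at h4
  rw [h4]
  exact eLpNorm_congr_ae hFp

/-- For r ≥ 0 the weight is at least one, so the weighted norm dominates the L² norm of the
transform; Plancherel turns this into the L² norm of the field. -/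
theorem IsFourierTransformOf.eLpNorm_le_space {r : ℝ} (hr : 0 ≤ r)
    {F : E d → EuclideanSpace ℂ (Fin d)} {f : E d → E d} (hF : IsFourierTransformOf .space F f) :
    eLpNorm f 2 (vol d .space) ≤ weightedNorm .space r F := by
  have hvol : vol d .space = volume := by simp [vol, cell]
  rw [hvol]
  have hle : eLpNorm F 2 volume ≤ weightedNorm .space r F := by
    rw [eLpNorm_eq_lintegral_rpow_enorm_toReal (by norm_num) (by norm_num)]
    unfold weightedNorm freqMeasure
    simp only [ENNReal.toReal_ofNat, ENNReal.rpow_ofNat]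
    gcongr with k
    refine le_mul_of_one_le_left' ?_
    rw [← ENNReal.ofReal_one]
    exact ENNReal.ofReal_le_ofReal (Real.one_le_rpow (by nlinarith [sq_nonneg ‖k‖]) hr)
  by_cases hw : weightedNorm .space r F = ∞
  · rw [hw]; exact le_top
  have hF2 : MemLp F 2 volume := ⟨hF.1.1, hle.trans_lt (lt_top_iff_ne_top.2 hw)⟩
  refine le_trans ?_ ((eLpNorm_fourierInv_eq hF.1 hF2).le.trans hle)
  refine eLpNorm_mono fun x => ?_
  rw [hF.eq_reMap x, ← fourierSynth_space]
  exact norm_reMap_le _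

/-- Smooth compactly supported fields on `ℝ^d` are in every Sobolev space. -/
theorem memSob_space_of_contDiff {φ : E d → E d} (hφ : ContDiff ℝ (⊤ : ℕ∞) φ)
    (hc : HasCompactSupport φ) (r : ℝ) : MemSob .space r φ := by
  let J : E d →L[ℝ] EuclideanSpace ℂ (Fin d) :=
    ((EuclideanSpace.equiv (Fin d) ℂ).symm.toContinuousLinearMap.restrictScalars ℝ) ∘L
      ContinuousLinearMap.pi fun i => Complex.ofRealCLM ∘L EuclideanSpace.proj (𝕜 := ℝ) i
  have hJ : ∀ x i, J x i = (x i : ℂ) := fun x i => rfl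
  have hsm : ContDiff ℝ (⊤ : ℕ∞) fun x => J (φ x) := J.contDiff.comp hφ
  have hcs : HasCompactSupport fun x => J (φ x) := hc.comp_left (map_zero J)
  let ψ : 𝓢(E d, EuclideanSpace ℂ (Fin d)) := hcs.toSchwartzMap hsm
  have hψ : ∀ x, ψ x = J (φ x) := fun x => rfl
  let F : 𝓢(E d, EuclideanSpace ℂ (Fin d)) := 𝓕 ψ
  have hinv : 𝓕⁻ (F : E d → EuclideanSpace ℂ (Fin d)) = ψ := by
    rw [← SchwartzMap.fourierInv_coe]
    simp [F]
  have hT : IsFourierTransformOf .space F φ := by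
    refine ⟨F.integrable (μ := volume), fun x i => ?_⟩
    rw [← hJ, ← hψ, ← hinv, Real.fourierInv_eq']
    have hint : Integrable (fun k => Complex.exp (↑(2 * Real.pi * ⟪k, x⟫_ℝ) * Complex.I) • F k) := by
      have := (VectorFourier.fourierIntegral_convergent_iff (μ := (volume : Measure (E d)))
        Real.continuous_fourierChar continuous_freqPairing x (f := F)).2 F.integrable
      refine this.congr (Eventually.of_forall fun k => ?_)
      simp only
      rw [fourierSynth_integrand]
      congr 2
      push_cast
      ring
    have h3 := (EuclideanSpace.proj (𝕜 := ℂ) i :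
      EuclideanSpace ℂ (Fin d) →L[ℂ] ℂ).integral_comp_comm hint
    refine h3.symm.trans (integral_congr_ae (Eventually.of_forall fun k => ?_))
    simp only [map_smul, smul_eq_mul, EuclideanSpace.coe_proj]
    congr 2
    push_cast
    ring
  refine (iInf₂_le (F : E d → EuclideanSpace ℂ (Fin d)) hT).trans_lt ?_
  refine ENNReal.rpow_lt_top_of_nonneg (by norm_num) (ne_of_lt ?_)
  -- Multiplication by the weight preserves Schwartz functions, so the weighted transform is again
  -- Schwartz and therefore square integrable.
  have htg : (fun k : E d => (((1 + ‖k‖ ^ 2) ^ (r / 2) : ℝ))).HasTemperateGrowth :=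
    Function.hasTemperateGrowth_one_add_norm_sq_rpow _ _
  let H := SchwartzMap.smulLeftCLM (EuclideanSpace ℂ (Fin d))
    (fun k : E d => ((1 + ‖k‖ ^ 2) ^ (r / 2) : ℝ)) F
  have hH := (H.memLp 2 (volume : Measure (E d))).eLpNorm_lt_top
  rw [eLpNorm_lt_top_iff_lintegral_rpow_enorm_lt_top (by norm_num) (by norm_num)] at hH
  refine lt_of_eq_of_lt (lintegral_congr fun k => ?_) hH
  simp only [H, SchwartzMap.smulLeftCLM_apply_apply htg, ENNReal.toReal_ofNat, ENNReal.rpow_ofNat]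
  rw [enorm_smul, mul_pow]
  congr 1
  rw [Real.enorm_of_nonneg (by positivity), ← ENNReal.ofReal_pow (by positivity),
    ← Real.rpow_mul_natCast (by positivity)]
  congr 2
  push_cast
  ring

end Plancherel

end Kelvin

end

/-! ### The unit cell, L² bounds and Fourier series on the torus. -/

noncomputable section

namespace Kelvin

variable {d : ℕ}

theorem measurableSet_cell (d : ℕ) (D : Domain) : MeasurableSet (cell d D) := by
  cases D
  · exact MeasurableSet.univ
  · simp only [cell, Set.ofPred_forall]
    exact MeasurableSet.iInter fun i => measurableSet_Ico.preimage (by fun_prop)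

/-- The cell with the opposite faces included is the one used for integrals over `UnitAddTorus`; the
faces are null sets. -/
theorem cell_torus_ae_eq : cell d .torus =ᵐ[volume]
    (WithLp.ofLp ⁻¹' {x : Fin d → ℝ | ∀ i, x i ∈ Ioc (0 : ℝ) (0 + 1)} : Set (E d)) := by
  have h1 : (Set.univ.pi fun i : Fin d => Ico (0 : ℝ) 1) =ᵐ[volume]
      (Set.univ.pi fun i : Fin d => Ioc (0 : ℝ) 1) :=
    (Measure.univ_pi_Ico_ae_eq_Icc (f := fun _ : Fin d => (0 : ℝ)) (g := fun _ => 1)).trans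
      (Measure.univ_pi_Ioc_ae_eq_Icc (f := fun _ : Fin d => (0 : ℝ)) (g := fun _ => 1)).symm
  have h2 := (PiLp.volume_preserving_ofLp (Fin d)).quasiMeasurePreserving.preimage_ae_eq h1
  have e1 : cell d .torus = WithLp.ofLp ⁻¹' (Set.univ.pi fun _ : Fin d => Ico (0 : ℝ) 1) := by
    ext x; simp [cell, Set.mem_pi]
  have e2 : (WithLp.ofLp ⁻¹' {x : Fin d → ℝ | ∀ i, x i ∈ Ioc (0 : ℝ) (0 + 1)} : Set (E d)) =
      WithLp.ofLp ⁻¹' (Set.univ.pi fun _ : Fin d => Ioc (0 : ℝ) 1) := by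
    ext x; simp [Set.mem_pi]
  rw [e1, e2]
  exact h2

theorem setIntegral_vol_torus {V : Type*} [NormedAddCommGroup V] [NormedSpace ℝ V]
    (f : E d → V) :
    ∫ x, f x ∂(vol d .torus) =
      ∫ x in {x : Fin d → ℝ | ∀ i, x i ∈ Ioc (0 : ℝ) (0 + 1)}, f (WithLp.toLp 2 x) := by
  rw [vol, Measure.restrict_congr_set cell_torus_ae_eq]
  have h := (PiLp.volume_preserving_ofLp (Fin d)).setIntegral_preimage_emb
    (MeasurableEquiv.toLp 2 (Fin d → ℝ)).symm.measurableEmbedding (fun x => f (WithLp.toLp 2 x))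
    {x : Fin d → ℝ | ∀ i, x i ∈ Ioc (0 : ℝ) (0 + 1)}
  exact h

instance : IsProbabilityMeasure (vol d .torus) := by
  constructor
  rw [vol, Measure.restrict_apply_univ]
  have h : cell d .torus = WithLp.ofLp ⁻¹' (Set.univ.pi fun _ : Fin d => Ico (0 : ℝ) 1) := by
    ext x; simp [cell, Set.mem_pi]
  rw [h, (PiLp.volume_preserving_ofLp (Fin d)).measure_preimage
    (MeasurableSet.univ_pi fun _ => measurableSet_Ico).nullMeasurableSet, Real.volume_pi_Ico]
  simp

instance (D : Domain) : SigmaFinite (vol d D) := by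
  unfold vol; infer_instance

/-- The two summands of the constant serve the two domains: Plancherel gives 1 on the whole space,
and on the torus, of total mass one, the sup bound is enough. -/
theorem MemSob.eLpNorm_le {D : Domain} {r : ℝ} {f : E d → E d} (hf : MemSob D r f)
    (hr : 1 + (d : ℝ) / 2 < r) :
    eLpNorm f 2 (vol d D) ≤ (1 + sobConst d D r) * sobNorm D r f := by
  cases D
  · refine le_trans ?_ (mul_le_mul' le_self_add le_rfl)
    refine le_mul_sobNorm (by simp) (fun F hF => ?_) hf
    rw [one_mul]
    exact hF.eLpNorm_le_space (le_trans (by positivity) hr.le)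
  · refine le_trans ?_ (mul_le_mul' le_add_self le_rfl)
    have hK : sobConst d .torus r * sobNorm .torus r f ≠ ∞ :=
      (ENNReal.mul_lt_top (sobConst_lt_top _ hr) hf).ne
    have := eLpNorm_le_of_ae_bound (p := 2) (μ := vol d .torus) (f := f)
      (C := (sobConst d .torus r * sobNorm .torus r f).toReal) (Eventually.of_forall fun x => by
        rw [← toReal_enorm]
        exact ENNReal.toReal_mono hK (hf.enorm_le hr x))
    rw [ENNReal.ofReal_toReal hK] at this
    simpa using this

section TorusFourier

theorem mFourier_coe (n : Fin d → ℤ) (x : Fin d → ℝ) :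
    UnitAddTorus.mFourier n (fun i => (x i : UnitAddCircle)) =
      Complex.exp (2 * Real.pi * Complex.I *
        (⟪(intPoint n : E d), WithLp.toLp 2 x⟫_ℝ : ℝ)) := by
  simp only [UnitAddTorus.mFourier, ContinuousMap.coe_mk, fourier_coe_apply]
  rw [← Complex.exp_sum]
  congr 1
  simp only [intPoint, PiLp.inner_apply, RCLike.inner_apply, conj_trivial]
  push_cast
  rw [Finset.mul_sum]
  refine Finset.sum_congr rfl fun i _ => ?_
  ring

/-- A periodic function descends to the torus. -/
theorem IsOn.exists_descend {V : Type*} {f : E d → V} (hp : IsOn .torus f) :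
    ∃ g : UnitAddTorus (Fin d) → V, ∀ x : Fin d → ℝ,
      g (fun i => (x i : UnitAddCircle)) = f (WithLp.toLp 2 x) := by
  let π : (Fin d → ℝ) → UnitAddTorus (Fin d) := fun x i => (x i : UnitAddCircle)
  have hπ : IsOpenQuotientMap π :=
    IsOpenQuotientMap.piMap fun _ => QuotientAddGroup.isOpenQuotientMap_mk
  let s : UnitAddTorus (Fin d) → (Fin d → ℝ) := Function.surjInv hπ.surjective
  have hs : ∀ z, π (s z) = z := Function.surjInv_eq hπ.surjective
  refine ⟨fun z => f (WithLp.toLp 2 (s z)), fun x => ?_⟩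
  have h1 : ∀ i, ∃ k : ℤ, s (π x) i = x i + k := by
    intro i
    have h2 : ((s (π x) i : ℝ) : UnitAddCircle) = (x i : UnitAddCircle) := congrFun (hs (π x)) i
    rw [← sub_eq_zero, ← AddCircle.coe_sub, AddCircle.coe_eq_zero_iff] at h2
    obtain ⟨k, hk⟩ := h2
    refine ⟨k, ?_⟩
    simp only [zsmul_eq_mul, mul_one] at hk
    linarith
  choose k hk using h1
  have : (WithLp.toLp 2 (s (π x)) : E d) = WithLp.toLp 2 x + intPoint k := by
    ext i
    simp [intPoint, hk]
  change f (WithLp.toLp 2 (s (π x))) = _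
  rw [this]
  exact hp _ k

/-- A continuous periodic function descends to a continuous function on the torus. -/
theorem exists_continuousMap_torus {f : E d → ℂ} (hf : Continuous f) (hp : IsOn .torus f) :
    ∃ g : C(UnitAddTorus (Fin d), ℂ), ∀ x : Fin d → ℝ,
      g (fun i => (x i : UnitAddCircle)) = f (WithLp.toLp 2 x) := by
  obtain ⟨g, hg⟩ := hp.exists_descend
  have hπ : IsOpenQuotientMap fun (x : Fin d → ℝ) i => (x i : UnitAddCircle) :=
    IsOpenQuotientMap.piMap fun _ => QuotientAddGroup.isOpenQuotientMap_mk
  refine ⟨⟨g, ?_⟩, hg⟩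
  rw [hπ.isQuotientMap.continuous_iff]
  exact (hf.comp (PiLp.continuous_toLp 2 _)).congr fun x => (hg x).symm

/-- A continuous periodic function with vanishing Fourier coefficients is zero. -/
theorem eq_zero_of_trig_integral_eq_zero {g : E d → ℝ} (hg : Continuous g) (hp : IsOn .torus g)
    (hc : ∀ n : Fin d → ℤ, ∫ x, Real.cos (2 * Real.pi * ⟪intPoint n, x⟫_ℝ) * g x ∂(vol d .torus) = 0)
    (hsn : ∀ n : Fin d → ℤ, ∫ x, Real.sin (2 * Real.pi * ⟪intPoint n, x⟫_ℝ) * g x ∂(vol d .torus) = 0) :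
    g = 0 := by
  obtain ⟨G, hG⟩ := exists_continuousMap_torus (f := fun x => (g x : ℂ))
    (Complex.continuous_ofReal.comp hg) (fun x k => congrArg _ (hp x k))
  obtain ⟨M, hM⟩ : ∃ M, ∀ x, ‖g x‖ ≤ M := by
    obtain ⟨M, hM⟩ := (isCompact_range G.continuous).isBounded.exists_norm_le
    refine ⟨M, fun x => ?_⟩
    have := hM _ ⟨fun i => (x i : UnitAddCircle), rfl⟩
    rw [hG] at this
    simpa using this
  have hcoef : ∀ n, UnitAddTorus.mFourierCoeff G n = 0 := by
    intro n
    rw [UnitAddTorus.mFourierCoeff_eq_integral _ _ (fun _ => 0)]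
    have h1 := setIntegral_vol_torus (fun x : E d => Complex.exp (2 * Real.pi * Complex.I *
        (⟪(intPoint (-n) : E d), x⟫_ℝ : ℝ)) • (g x : ℂ))
    simp only [mFourier_coe, hG]
    refine h1.symm.trans ?_
    have h2 : ∀ x : E d, Complex.exp (2 * Real.pi * Complex.I *
        (⟪(intPoint (-n) : E d), x⟫_ℝ : ℝ)) • (g x : ℂ)
        = ((Real.cos (2 * Real.pi * ⟪intPoint (-n), x⟫_ℝ) * g x : ℝ) : ℂ)
          + Complex.I * ((Real.sin (2 * Real.pi * ⟪intPoint (-n), x⟫_ℝ) * g x : ℝ) : ℂ) := by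
      intro x
      have h3 : (2 * Real.pi * Complex.I * (⟪(intPoint (-n) : E d), x⟫_ℝ : ℝ) : ℂ)
        = ((2 * Real.pi * ⟪(intPoint (-n) : E d), x⟫_ℝ : ℝ) : ℂ) * Complex.I := by push_cast; ring
      rw [h3, Complex.exp_mul_I, ← Complex.ofReal_cos, ← Complex.ofReal_sin, smul_eq_mul]
      push_cast
      ring
    simp only [h2]
    have hb1 : Integrable (fun x => Real.cos (2 * Real.pi * ⟪intPoint (-n), x⟫_ℝ) * g x) (vol d .torus) :=
      Integrable.of_bound (by fun_prop) M (Eventually.of_forall fun x => by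
        rw [norm_mul]
        exact (mul_le_of_le_one_left (norm_nonneg _) (Real.abs_cos_le_one _)).trans (hM x))
    have hb2 : Integrable (fun x => Real.sin (2 * Real.pi * ⟪intPoint (-n), x⟫_ℝ) * g x) (vol d .torus) :=
      Integrable.of_bound (by fun_prop) M (Eventually.of_forall fun x => by
        rw [norm_mul]
        exact (mul_le_of_le_one_left (norm_nonneg _) (Real.abs_sin_le_one _)).trans (hM x))
    rw [integral_add hb1.ofReal (hb2.ofReal.const_mul _), integral_const_mul]
    rw [integral_complex_ofReal, integral_complex_ofReal, hc, hsn]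
    simp
  ext x
  -- Vanishing coefficients are summable, so the Fourier series of the continuous function converges
  -- to it at every point, here to zero.
  have h3 := UnitAddTorus.hasSum_mFourier_series_apply_of_summable (f := G)
    (by rw [funext hcoef]; exact summable_zero) (fun i => (x i : UnitAddCircle))
  simp only [hcoef, zero_smul] at h3
  have h4 := h3.unique hasSum_zero
  rw [hG] at h4
  simpa using h4

/-- The coefficients of a real trigonometric monomial. -/
def trigCoeff (n : Fin d → ℤ) (c : ℂ) (i : Fin d) : E d → EuclideanSpace ℂ (Fin d) :=
  ({intPoint n} : Set (E d)).indicator (fun _ => EuclideanSpace.single i (c / 2)) +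
    ({intPoint (-n)} : Set (E d)).indicator (fun _ => EuclideanSpace.single i (star c / 2))

theorem freqMeasure_torus_singleton (n : Fin d → ℤ) :
    freqMeasure d .torus {(intPoint n : E d)} = 1 := by
  rw [freqMeasure, Measure.sum_apply _ (measurableSet_singleton _), tsum_eq_single n]
  · simp
  · intro k hk
    rw [Measure.dirac_apply' _ (measurableSet_singleton _)]
    simp [intPoint_injective.ne hk]

/-- The identity Re z = (z + z̄)/2 puts one atom at n and one at -n. For n = 0 the two atoms
coincide and their values add, which is why the coefficients are a sum of indicators. -/
theorem isFourierTransformOf_trig (n : Fin d → ℤ) (c : ℂ) (i : Fin d) :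
    IsFourierTransformOf .torus (trigCoeff n c i) fun x =>
      (c * Complex.exp (2 * Real.pi * Complex.I * (⟪(intPoint n : E d), x⟫_ℝ : ℝ))).re • basisVec i := by
  have hi : ∀ (k : Fin d → ℤ) (z : EuclideanSpace ℂ (Fin d)), Integrable
      (({intPoint k} : Set (E d)).indicator (fun _ => z)) (freqMeasure d .torus) := fun k z =>
    (integrable_indicator_iff (measurableSet_singleton _)).2
      (integrableOn_const (by simp [freqMeasure_torus_singleton]))
  refine ⟨(hi _ _).add (hi _ _), fun x j => ?_⟩
  have h1 : ∀ (k : Fin d → ℤ) (a : ℂ),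
      ∫ y, Complex.exp (2 * Real.pi * Complex.I * (⟪y, x⟫_ℝ : ℝ)) *
        (({intPoint k} : Set (E d)).indicator (fun _ => EuclideanSpace.single i a) y) j
          ∂(freqMeasure d .torus)
      = Complex.exp (2 * Real.pi * Complex.I * (⟪(intPoint k : E d), x⟫_ℝ : ℝ)) *
        (EuclideanSpace.single i a : EuclideanSpace ℂ (Fin d)) j := by
    intro k a
    have h2 : ∀ y, Complex.exp (2 * Real.pi * Complex.I * (⟪y, x⟫_ℝ : ℝ)) *
        (({intPoint k} : Set (E d)).indicator (fun _ => EuclideanSpace.single i a) y) j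
        = ({intPoint k} : Set (E d)).indicator (fun _ =>
          Complex.exp (2 * Real.pi * Complex.I * (⟪(intPoint k : E d), x⟫_ℝ : ℝ)) *
            (EuclideanSpace.single i a : EuclideanSpace ℂ (Fin d)) j) y := by
      intro y
      by_cases hy : y = intPoint k
      · subst hy; simp
      · simp [hy]
    simp only [h2]
    rw [integral_indicator (measurableSet_singleton _), setIntegral_const]
    simp [measureReal_def, freqMeasure_torus_singleton]
  have h3 : ∀ (k : Fin d → ℤ) (a : ℂ), Integrable (fun y =>
      Complex.exp (2 * Real.pi * Complex.I * (⟪y, x⟫_ℝ : ℝ)) *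
        (({intPoint k} : Set (E d)).indicator (fun _ => EuclideanSpace.single i a) y) j)
        (freqMeasure d .torus) := by
    intro k a
    have h2 : (fun y => Complex.exp (2 * Real.pi * Complex.I * (⟪y, x⟫_ℝ : ℝ)) *
        (({intPoint k} : Set (E d)).indicator (fun _ => EuclideanSpace.single i a) y) j)
        = ({intPoint k} : Set (E d)).indicator (fun _ =>
          Complex.exp (2 * Real.pi * Complex.I * (⟪(intPoint k : E d), x⟫_ℝ : ℝ)) *
            (EuclideanSpace.single i a : EuclideanSpace ℂ (Fin d)) j) := by
      ext y
      by_cases hy : y = intPoint k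
      · subst hy; simp
      · simp [hy]
    rw [h2]
    exact (integrable_indicator_iff (measurableSet_singleton _)).2
      (integrableOn_const (by simp [freqMeasure_torus_singleton]))
  simp only [trigCoeff, Pi.add_apply, PiLp.add_apply, mul_add]
  rw [integral_add (h3 _ _) (h3 _ _), h1, h1]
  have h4 : (2 * Real.pi * Complex.I * (⟪(intPoint (-n) : E d), x⟫_ℝ : ℝ) : ℂ)
      = star (2 * Real.pi * Complex.I * (⟪(intPoint n : E d), x⟫_ℝ : ℝ)) := by
    have : (intPoint (-n) : E d) = - intPoint n := by ext i; simp [intPoint]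
    rw [this, inner_neg_left]
    simp
  by_cases hj : j = i
  · subst hj
    rw [h4]
    have h5 : ∀ z : ℂ, Complex.exp (star z) = star (Complex.exp z) := fun z => Complex.exp_conj z
    rw [h5]
    simp only [basisVec, PiLp.smul_apply, smul_eq_mul, PiLp.single_apply, if_true, mul_one,
      Complex.re_eq_add_conj]
    simp
    ring
  · simp [basisVec, hj]

theorem memSob_trig (n : Fin d → ℤ) (c : ℂ) (i : Fin d) (r : ℝ) :
    MemSob .torus r fun x : E d =>
      (c * Complex.exp (2 * Real.pi * Complex.I * (⟪(intPoint n : E d), x⟫_ℝ : ℝ))).re • basisVec i := by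
  refine (iInf₂_le (trigCoeff n c i) (isFourierTransformOf_trig n c i)).trans_lt ?_
  refine ENNReal.rpow_lt_top_of_nonneg (by norm_num) (ne_of_lt ?_)
  let s : Set (E d) := {intPoint n} ∪ {intPoint (-n)}
  have h1 : ∀ k, ENNReal.ofReal ((1 + ‖k‖ ^ 2) ^ r) * ‖trigCoeff n c i k‖ₑ ^ 2
      = s.indicator (fun k => ENNReal.ofReal ((1 + ‖k‖ ^ 2) ^ r) * ‖trigCoeff n c i k‖ₑ ^ 2) k := by
    intro k
    by_cases hk : k ∈ s
    · rw [Set.indicator_of_mem hk]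
    · rw [Set.indicator_of_notMem hk]
      simp only [s, Set.mem_union, Set.mem_singleton_iff, not_or] at hk
      simp [trigCoeff, hk.1, hk.2]
  rw [lintegral_congr h1, lintegral_indicator ((measurableSet_singleton _).union (measurableSet_singleton _))]
  refine (lintegral_union_le _ _ _).trans_lt ?_
  rw [lintegral_singleton, lintegral_singleton, freqMeasure_torus_singleton,
    freqMeasure_torus_singleton]
  refine ENNReal.add_lt_top.2 ⟨?_, ?_⟩ <;>
  · rw [mul_one]
    exact ENNReal.mul_lt_top ENNReal.ofReal_lt_top (ENNReal.pow_lt_top enorm_lt_top)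

end TorusFourier

end Kelvin

end

/-! ### Measurability of random continuous fields and of their inverses. -/

noncomputable section

namespace Kelvin

variable {d : ℕ}

section Caratheodory

variable {Ω Y V : Type*} [MeasurableSpace Ω]

/-- A random continuous function can be made measurable off a measurable null set. -/
theorem exists_null_set_of_continuous [TopologicalSpace Y]
    [TopologicalSpace.MetrizableSpace Y] [SecondCountableTopology Y] [NormedAddCommGroup V]
    {P : Measure Ω} {f : Ω → Y → V} {p : Ω → Prop}
    (hm : ∀ y, AEStronglyMeasurable (fun ω => f ω y) P) (hp : ∀ᵐ ω ∂P, p ω)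
    (hc : ∀ ω, p ω → Continuous (f ω)) :
    ∃ N : Set Ω, MeasurableSet N ∧ P N = 0 ∧ (∀ ω ∉ N, p ω) ∧
      ∀ y, StronglyMeasurable (Nᶜ.indicator fun ω => f ω y) := by
  let := TopologicalSpace.metrizableSpaceMetric Y
  rcases isEmpty_or_nonempty Y with hY | hY
  · obtain ⟨N, hN, hNm, hNP⟩ := exists_measurable_superset_of_null (ae_iff.1 hp)
    exact ⟨N, hNm, hNP, fun ω hω => by_contra fun h => hω (hN h), fun y => (IsEmpty.false y).elim⟩
  let y := TopologicalSpace.denseSeq Y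
  -- Off one null set the field agrees with measurable versions at all points of a dense sequence;
  -- continuity then determines it everywhere.
  have hall : ∀ᵐ ω ∂P, p ω ∧ ∀ n, f ω (y n) = (hm (y n)).mk _ ω :=
    hp.and (ae_all_iff.2 fun n => (hm (y n)).ae_eq_mk)
  obtain ⟨N, hN, hNm, hNP⟩ := exists_measurable_superset_of_null (ae_iff.1 hall)
  have hgood : ∀ ω ∉ N, p ω ∧ ∀ n, f ω (y n) = (hm (y n)).mk _ ω := by
    intro ω hω
    by_contra h
    exact hω (hN h)
  refine ⟨N, hNm, hNP, fun ω hω => (hgood ω hω).1, ?_⟩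
  let g : Y → Ω → V := fun z => Nᶜ.indicator fun ω => f ω z
  have hgc : ∀ ω, Continuous fun z => g z ω := by
    intro ω
    by_cases hω : ω ∈ N
    · simp only [g, Set.indicator_of_notMem (show ω ∉ Nᶜ from fun h => h hω)]
      exact continuous_const
    · simp only [g, Set.indicator_of_mem (show ω ∈ Nᶜ from hω)]
      exact hc ω (hgood ω hω).1
  have hgn : ∀ n, StronglyMeasurable (g (y n)) := by
    intro n
    have : g (y n) = Nᶜ.indicator ((hm (y n)).mk _) := by
      ext ω
      by_cases hω : ω ∈ N
      · simp [g, hω]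
      · simp [g, hω, (hgood ω hω).2 n]
    rw [this]
    exact (hm (y n)).stronglyMeasurable_mk.indicator hNm.compl
  intro z
  obtain ⟨n, hn⟩ : ∃ n : ℕ → ℕ, Tendsto (fun k => y (n k)) atTop (𝓝 z) := by
    have hz : ∀ k : ℕ, ∃ n, dist z (y n) < 1 / ((k : ℝ) + 1) := fun k =>
      (TopologicalSpace.denseRange_denseSeq Y).exists_dist_lt z (by positivity)
    choose n hn using hz
    refine ⟨n, tendsto_iff_dist_tendsto_zero.2 (squeeze_zero (fun _ => dist_nonneg)
      (fun k => ?_) tendsto_one_div_add_atTop_nhds_zero_nat)⟩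
    rw [dist_comm]; exact (hn k).le
  refine stronglyMeasurable_of_tendsto atTop (fun k => hgn (n k)) ?_
  exact tendsto_pi_nhds.2 fun ω => ((hgc ω).tendsto z).comp hn

/-- A Carathéodory function is jointly measurable. -/
theorem aestronglyMeasurable_uncurry_of_continuous [TopologicalSpace Y]
    [TopologicalSpace.MetrizableSpace Y] [SecondCountableTopology Y] [MeasurableSpace Y]
    [OpensMeasurableSpace Y] [NormedAddCommGroup V]
    {P : Measure Ω} [SFinite P] (κ : Measure Y) [SFinite κ] {f : Ω → Y → V}
    (hm : ∀ y, AEStronglyMeasurable (fun ω => f ω y) P) (hc : ∀ᵐ ω ∂P, Continuous (f ω)) :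
    AEStronglyMeasurable (fun z : Ω × Y => f z.1 z.2) (P.prod κ) := by
  obtain ⟨N, hNm, hNP, hgood, hgm⟩ := exists_null_set_of_continuous hm hc fun _ h => h
  let g : Y → Ω → V := fun z => Nᶜ.indicator fun ω => f ω z
  have hgc : ∀ ω, Continuous fun z => g z ω := by
    intro ω
    by_cases hω : ω ∈ N
    · simp only [g, Set.indicator_of_notMem (show ω ∉ Nᶜ from fun h => h hω)]
      exact continuous_const
    · simp only [g, Set.indicator_of_mem (show ω ∈ Nᶜ from hω)]
      exact hgood ω hω
  have hg := (stronglyMeasurable_uncurry_of_continuous_of_stronglyMeasurable hgc hgm).comp_measurable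
    (measurable_swap : Measurable (Prod.swap : Ω × Y → Y × Ω))
  refine ⟨_, hg, ?_⟩
  have hN' : ∀ᵐ z ∂(P.prod κ), z.1 ∉ N :=
    Measure.quasiMeasurePreserving_fst.ae (measure_eq_zero_iff_ae_notMem.1 hNP)
  filter_upwards [hN'] with z hz
  exact (Set.indicator_of_mem (s := Nᶜ) hz fun ω => f ω z.2).symm

/-- For closed F, the value g_ω(y) lies in F exactly when y is approximated by values f_ω(x) with x
in a countable dense subset of F: continuity of f_ω gives one direction, continuity of g_ω the
other. This is a countable description of the event. -/
theorem aestronglyMeasurable_inverse [NormedAddCommGroup Y] [NormedAddCommGroup V]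
    [SecondCountableTopology Y] [SecondCountableTopology V] [MeasurableSpace Y] [BorelSpace Y]
    {P : Measure Ω} {f : Ω → Y → V} {g : Ω → V → Y}
    (hm : ∀ x, AEStronglyMeasurable (fun ω => f ω x) P)
    (h : ∀ᵐ ω ∂P, Continuous (f ω) ∧ Continuous (g ω) ∧ Function.LeftInverse (g ω) (f ω) ∧
      Function.RightInverse (g ω) (f ω)) (y : V) :
    AEStronglyMeasurable (fun ω => g ω y) P := by
  obtain ⟨N, hNm, hNP, hgood, hfm⟩ := exists_null_set_of_continuous hm h fun _ h => h.1
  have hmeas : Measurable (Nᶜ.indicator fun ω => g ω y) := by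
    refine measurable_of_isClosed fun F hF => ?_
    obtain ⟨q, hqF, hqc, hq⟩ :=
      (TopologicalSpace.IsSeparable.of_separableSpace F).exists_countable_dense_subset
    have hset : (Nᶜ.indicator fun ω => g ω y) ⁻¹' F =
        (Nᶜ ∩ ⋂ n : ℕ, ⋃ x ∈ q, {ω | ‖Nᶜ.indicator (fun ω => f ω x) ω - y‖ < 1 / ((n : ℝ) + 1)}) ∪
        (N ∩ {_ω | (0 : Y) ∈ F}) := by
      ext ω
      by_cases hω : ω ∈ N
      · simp [hω]
      · obtain ⟨h1, h2, h3, h4⟩ := hgood ω hω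
        have hω' : ω ∈ Nᶜ := hω
        simp only [mem_preimage, Set.indicator_of_mem hω', mem_union, mem_inter_iff, hω', true_and,
          hω, false_and, or_false, mem_iInter, mem_iUnion, mem_ofPred_eq, exists_prop]
        constructor
        · intro hF' n
          have hcl := hq hF'
          have hcont : ContinuousAt (f ω) (g ω y) := h1.continuousAt
          obtain ⟨δ, hδ, hball⟩ := Metric.continuousAt_iff.1 hcont (1 / ((n : ℝ) + 1)) (by positivity)
          obtain ⟨x, hxq, hx⟩ := Metric.mem_closure_iff.1 hcl δ hδ
          refine ⟨x, hxq, ?_⟩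
          have := hball (by rwa [dist_comm])
          rwa [h4 y, dist_eq_norm] at this
        · intro hn
          choose x hxq hx using hn
          have hlim : Tendsto (fun n => f ω (x n)) atTop (𝓝 y) :=
            tendsto_iff_norm_sub_tendsto_zero.2 (squeeze_zero (fun _ => norm_nonneg _)
              (fun n => (hx n).le) tendsto_one_div_add_atTop_nhds_zero_nat)
          have hlim2 := (h2.tendsto y).comp hlim
          simp only [Function.comp_def, h3 _] at hlim2
          exact hF.mem_of_tendsto hlim2 (Eventually.of_forall fun n => hqF (hxq n))
    rw [hset]
    refine (hNm.compl.inter (MeasurableSet.iInter fun n =>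
      MeasurableSet.biUnion hqc fun x _ => ?_)).union (hNm.inter (MeasurableSet.const _))
    exact ((hfm x).sub stronglyMeasurable_const).norm.measurable measurableSet_Iio
  refine ⟨_, hmeas.stronglyMeasurable, ?_⟩
  filter_upwards [measure_eq_zero_iff_ae_notMem.1 hNP] with ω hω
  exact (Set.indicator_of_mem (s := Nᶜ) hω fun ω => g ω y).symm

end Caratheodory

section Product

variable {Ω : Type*} [MeasurableSpace Ω]

/-- The Carathéodory argument separates ω from (t, x), whereas the action integrates time outermost.
-/
theorem measurePreserving_rotate (τ : Measure ℝ) [SFinite τ] (P : Measure Ω) [SFinite P]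
    (κ : Measure (E d)) [SFinite κ] :
    MeasurePreserving (fun z : ℝ × (Ω × E d) => (z.2.1, (z.1, z.2.2)))
      (τ.prod (P.prod κ)) (P.prod (τ.prod κ)) := by
  have h1 : MeasurePreserving (MeasurableEquiv.prodAssoc (α := ℝ) (β := Ω) (γ := E d)).symm
      (τ.prod (P.prod κ)) ((τ.prod P).prod κ) :=
    (measurePreserving_prodAssoc τ P κ).symm _
  have h2 : MeasurePreserving (Prod.map Prod.swap id : (ℝ × Ω) × E d → (Ω × ℝ) × E d)
      ((τ.prod P).prod κ) ((P.prod τ).prod κ) :=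
    (Measure.measurePreserving_swap).prod (MeasurePreserving.id κ)
  have h3 : MeasurePreserving (MeasurableEquiv.prodAssoc (α := Ω) (β := ℝ) (γ := E d))
      ((P.prod τ).prod κ) (P.prod (τ.prod κ)) := measurePreserving_prodAssoc P τ κ
  exact h3.comp (h2.comp h1)

/-- Lebesgue measure on the time interval. -/
def timeMeasure (T : ℝ) : Measure ℝ := volume.restrict (Ioc 0 T)

instance (T : ℝ) : IsFiniteMeasure (timeMeasure T) := by unfold timeMeasure; infer_instance

theorem ae_timeMeasure (T : ℝ) : ∀ᵐ t ∂timeMeasure T, t ∈ Icc 0 T :=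
  (ae_restrict_mem measurableSet_Ioc).mono fun _ h => Ioc_subset_Icc_self h

/-- The measure `dt ⊗ P ⊗ dx`. -/
def tripleMeasure (D : Domain) (T : ℝ) (P : Measure Ω) : Measure (ℝ × (Ω × E d)) :=
  (timeMeasure T).prod (P.prod (vol d D))

theorem ae_triple_of_ae {D : Domain} {T : ℝ} {P : Measure Ω} [SFinite P] {p : Ω → ℝ → E d → Prop}
    (h : ∀ᵐ ω ∂P, ∀ t ∈ Icc 0 T, ∀ x, p ω t x) :
    ∀ᵐ z ∂(tripleMeasure (d := d) D T P), p z.2.1 z.1 z.2.2 := by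
  have h1 : ∀ᵐ z ∂(tripleMeasure (d := d) D T P), z.1 ∈ Icc 0 T :=
    Measure.quasiMeasurePreserving_fst.ae (ae_timeMeasure T)
  have h2 : ∀ᵐ z ∂(tripleMeasure (d := d) D T P), ∀ t ∈ Icc 0 T, ∀ x, p z.2.1 t x :=
    (Measure.quasiMeasurePreserving_fst.comp Measure.quasiMeasurePreserving_snd).ae h
  filter_upwards [h1, h2] with z hz hz'
  exact hz' _ hz _

theorem aestronglyMeasurable_triple {V : Type*} [NormedAddCommGroup V] {D : Domain} {T : ℝ}
    (hT : 0 ≤ T) {P : Measure Ω} [SFinite P] {f : Ω → ℝ → E d → V}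
    (hm : ∀ t ∈ Icc 0 T, ∀ x, AEStronglyMeasurable (fun ω => f ω t x) P)
    (hc : ∀ᵐ ω ∂P, ContinuousOn (fun z : ℝ × E d => f ω z.1 z.2) (Icc 0 T ×ˢ univ)) :
    AEStronglyMeasurable (fun z : ℝ × (Ω × E d) => f z.2.1 z.1 z.2.2) (tripleMeasure D T P) := by
  -- Clamping time to [0,T] makes the field continuous on all of ℝ × ℝ^d and changes nothing where
  -- the time measure lives.
  have h := aestronglyMeasurable_uncurry_of_continuous ((timeMeasure T).prod (vol d D))
    (P := P) (f := fun ω (z : ℝ × E d) => f ω (projIcc 0 T hT z.1) z.2)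
    (fun z => hm _ (projIcc 0 T hT z.1).2 _) (by
      filter_upwards [hc] with ω hω
      exact hω.comp_continuous (f := fun z : ℝ × E d => ((projIcc 0 T hT z.1 : ℝ), z.2))
        (by fun_prop) (fun z => ⟨(projIcc 0 T hT z.1).2, mem_univ _⟩))
  have h' := h.comp_quasiMeasurePreserving
    (measurePreserving_rotate (timeMeasure T) P (vol d D)).quasiMeasurePreserving
  refine h'.congr ?_
  have h1 : ∀ᵐ z ∂((timeMeasure T).prod (P.prod (vol d D))), z.1 ∈ Icc 0 T :=
    Measure.quasiMeasurePreserving_fst.ae (ae_timeMeasure T)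
  filter_upwards [h1] with z hz
  simp [projIcc_of_mem hT hz]

theorem aestronglyMeasurable_slice {V : Type*} [NormedAddCommGroup V] {D : Domain}
    {P : Measure Ω} [SFinite P] {f : Ω → E d → V}
    (hm : ∀ x, AEStronglyMeasurable (fun ω => f ω x) P)
    (hc : ∀ᵐ ω ∂P, Continuous (f ω)) :
    AEStronglyMeasurable (fun z : Ω × E d => f z.1 z.2) (P.prod (vol d D)) :=
  aestronglyMeasurable_uncurry_of_continuous _ hm hc

end Product

end Kelvin

end

/-! ### Pointwise regularity of Sobolev-valued paths. -/

noncomputable section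

namespace Kelvin

variable {d : ℕ}

section Regular

/-- A time dependent field that is `C¹` in time with values in the `C¹` fields, together with its
time derivative `g`. -/
structure IsRegular (T : ℝ) (f g : ℝ → E d → E d) : Prop where
  cont : ContinuousOn (fun z : ℝ × E d => f z.1 z.2) (Icc 0 T ×ˢ univ)
  contDiff : ∀ t ∈ Icc 0 T, ContDiff ℝ 1 (f t)
  cont_fderiv : ContinuousOn (fun z : ℝ × E d => fderiv ℝ (f z.1) z.2) (Icc 0 T ×ˢ univ)
  cont' : ContinuousOn (fun z : ℝ × E d => g z.1 z.2) (Icc 0 T ×ˢ univ)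
  contDiff' : ∀ t ∈ Icc 0 T, ContDiff ℝ 1 (g t)
  deriv : ∀ t ∈ Icc 0 T, ∀ x, HasDerivWithinAt (fun τ => f τ x) (g t x) (Icc 0 T) t
  deriv_fderiv : ∀ t ∈ Icc 0 T, ∀ x,
    HasDerivWithinAt (fun τ => fderiv ℝ (f τ) x) (fderiv ℝ (g t) x) (Icc 0 T) t

/-- Continuity in time that is uniform in space, together with continuity of each time slice, gives
joint continuity. -/
theorem continuousOn_prod_of_uniform {V : Type*} [NormedAddCommGroup V] {I : Set ℝ}
    {F : ℝ → E d → V} (hF : ∀ t ∈ I, Continuous (F t)) {c : ℝ → ℝ → ℝ≥0∞}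
    (hc : ∀ t ∈ I, Tendsto (c t) (𝓝[I] t) (𝓝 0))
    (h : ∀ t ∈ I, ∀ᶠ τ in 𝓝[I] t, ∀ x, ‖F τ x - F t x‖ₑ ≤ c t τ) :
    ContinuousOn (fun z : ℝ × E d => F z.1 z.2) (I ×ˢ univ) := by
  rintro ⟨t, x⟩ ⟨ht, -⟩
  have ht : t ∈ I := ht
  have hu : TendstoUniformly F (F t) (𝓝[I] t) := by
    rw [EMetric.tendstoUniformly_iff]
    intro ε hε
    filter_upwards [h t ht, (hc t ht).eventually (gt_mem_nhds hε)] with τ h1 h2 y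
    rw [edist_comm, edist_eq_enorm_sub]
    exact (h1 y).trans_lt h2
  have h1 : Tendsto (fun z : ℝ × E d => F z.1 z.2) (𝓝[I] t ×ˢ 𝓝 x) (𝓝 (F t x)) :=
    TendstoUniformly.tendsto_comp (F := fun z : ℝ × E d => F z.1) (g := fun z => z.2)
      (fun v hv => tendsto_fst.eventually (hu v hv)) (hF t ht).continuousAt tendsto_snd
  rw [ContinuousWithinAt, nhdsWithin_prod_eq, nhdsWithin_univ]
  exact h1

theorem ContSob.continuousOn {D : Domain} {r T : ℝ} {f : ℝ → E d → E d} (hf : ContSob D r T f)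
    (hr : 1 + (d : ℝ) / 2 < r) :
    ContinuousOn (fun z : ℝ × E d => f z.1 z.2) (Icc 0 T ×ˢ univ) := by
  refine continuousOn_prod_of_uniform (fun t ht => ((hf t ht).1.contDiff hr).continuous)
    (c := fun t τ => sobConst d D r * sobNorm D r (f τ - f t)) (fun t ht => ?_) (fun t ht => ?_)
  · have := ENNReal.Tendsto.const_mul (a := sobConst d D r) (hf t ht).2
      (Or.inr (sobConst_lt_top D hr).ne)
    simpa using this
  · filter_upwards [(hf t ht).2.eventually (gt_mem_nhds ENNReal.zero_lt_top)] with τ hτ x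
    exact MemSob.enorm_le hτ hr x

theorem ContSob.continuousOn_fderiv {D : Domain} {r T : ℝ} {f : ℝ → E d → E d}
    (hf : ContSob D r T f) (hr : 1 + (d : ℝ) / 2 < r) :
    ContinuousOn (fun z : ℝ × E d => fderiv ℝ (f z.1) z.2) (Icc 0 T ×ˢ univ) := by
  refine continuousOn_prod_of_uniform (F := fun t => fderiv ℝ (f t))
    (fun t ht => ((hf t ht).1.contDiff hr).continuous_fderiv (by norm_num))
    (c := fun t τ => (ENNReal.ofReal (2 * Real.pi) * sobConst d D r) * sobNorm D r (f τ - f t))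
    (fun t ht => ?_) (fun t ht => ?_)
  · have := ENNReal.Tendsto.const_mul (a := ENNReal.ofReal (2 * Real.pi) * sobConst d D r)
      (hf t ht).2 (Or.inr (ENNReal.mul_lt_top ENNReal.ofReal_lt_top (sobConst_lt_top D hr)).ne)
    simpa using this
  · filter_upwards [(hf t ht).2.eventually (gt_mem_nhds ENNReal.zero_lt_top),
      self_mem_nhdsWithin] with τ hτ hτI x
    have := MemSob.enorm_fderiv_le hτ hr x
    rwa [fderiv_sub (((hf τ hτI).1.contDiff hr).differentiable (by norm_num) x)
      (((hf t ht).1.contDiff hr).differentiable (by norm_num) x)] at this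

theorem tendsto_of_enorm_sub_le {V : Type*} [NormedAddCommGroup V] {l : Filter ℝ} {F : ℝ → V}
    {a : V} {c : ℝ → ℝ≥0∞} {K : ℝ≥0∞} (hK : K < ∞) (hc : Tendsto c l (𝓝 0))
    (h : ∀ᶠ τ in l, ‖F τ - a‖ₑ ≤ K * c τ) : Tendsto F l (𝓝 a) := by
  rw [tendsto_iff_edist_tendsto_0]
  have := ENNReal.Tendsto.const_mul (a := K) hc (Or.inr hK.ne)
  rw [mul_zero] at this
  refine tendsto_of_tendsto_of_tendsto_of_le_of_le' tendsto_const_nhds this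
    (Eventually.of_forall fun _ => zero_le) ?_
  simpa only [edist_eq_enorm_sub] using h

/-- Difference quotients in time converge in `H^r`, hence uniformly together with their spatial
gradients; therefore the time derivative commutes with the gradient. -/
theorem C1Sob.isRegular {D : Domain} {r T : ℝ} {f : ℝ → E d → E d} (hf : C1Sob D r T f)
    (hr : 1 + (d : ℝ) / 2 < r) : IsRegular T f (timeDeriv T f) where
  cont := hf.1.continuousOn hr
  contDiff t ht := (hf.1 t ht).1.contDiff hr
  cont_fderiv := hf.1.continuousOn_fderiv hr
  cont' := hf.2.1.continuousOn hr
  contDiff' t ht := (hf.2.1 t ht).1.contDiff hr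
  deriv t ht x := by
    rw [hasDerivWithinAt_iff_tendsto_slope]
    refine tendsto_of_enorm_sub_le (sobConst_lt_top D hr) (hf.2.2 t ht) ?_
    filter_upwards [(hf.2.2 t ht).eventually (gt_mem_nhds ENNReal.zero_lt_top)] with τ hτ
    exact MemSob.enorm_le hτ hr x
  deriv_fderiv t ht x := by
    rw [hasDerivWithinAt_iff_tendsto_slope]
    refine tendsto_of_enorm_sub_le (K := ENNReal.ofReal (2 * Real.pi) * sobConst d D r)
      (ENNReal.mul_lt_top ENNReal.ofReal_lt_top (sobConst_lt_top D hr)) (hf.2.2 t ht) ?_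
    filter_upwards [(hf.2.2 t ht).eventually (gt_mem_nhds ENNReal.zero_lt_top),
      self_mem_nhdsWithin] with τ hτ hτI
    have h1 := MemSob.enorm_fderiv_le hτ hr x
    have d1 := ((hf.1 τ hτI.1).1.contDiff hr).differentiable (by norm_num) x
    have d2 := ((hf.1 t ht).1.contDiff hr).differentiable (by norm_num) x
    have d3 := ((hf.2.1 t ht).1.contDiff hr).differentiable (by norm_num) x
    rwa [fderiv_sub ((d1.sub d2).const_smul _) d3, fderiv_const_smul (d1.sub d2),
      fderiv_sub d1 d2] at h1

/-- Only the displacement lies in a Sobolev space. Adding the identity shifts the gradient by a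
constant and leaves the time derivative alone. -/
theorem IsRegular.add_id {T : ℝ} {X g : ℝ → E d → E d}
    (h : IsRegular T (fun t x => X t x - x) g) : IsRegular T X g := by
  have hD : ∀ t ∈ Icc 0 T, ∀ x, fderiv ℝ (X t) x =
      fderiv ℝ (fun x => X t x - x) x + ContinuousLinearMap.id ℝ (E d) := by
    intro t ht x
    have h1 := (h.contDiff t ht).differentiable (by norm_num) x
    have h2 : X t = fun x => (X t x - x) + x := by ext1 x; simp
    conv_lhs => rw [h2]
    rw [fderiv_fun_add h1 differentiableAt_fun_id, fderiv_fun_id]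
  refine ⟨?_, ?_, ?_, h.cont', h.contDiff', ?_, ?_⟩
  · exact (h.cont.add continuousOn_snd).congr fun z _ => by simp
  · intro t ht
    simpa using (h.contDiff t ht).add contDiff_id
  · exact (h.cont_fderiv.add continuousOn_const).congr fun z hz => hD _ hz.1 _
  · intro t ht x
    simpa using (h.deriv t ht x).add_const x
  · intro t ht x
    exact ((h.deriv_fderiv t ht x).add_const (ContinuousLinearMap.id ℝ (E d))).congr
      (fun τ hτ => hD τ hτ x) (hD t ht x)

theorem timeDeriv_sub_id (T : ℝ) (X : ℝ → E d → E d) :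
    timeDeriv T (fun t x => X t x - x) = timeDeriv T X := by
  ext1 t; ext1 x
  simp only [timeDeriv]
  exact derivWithin_sub_const _

variable {Ω : Type*} [MeasurableSpace Ω]

theorem aestronglyMeasurable_deriv {T : ℝ} (hT : 0 < T) {V : Type*} [NormedAddCommGroup V]
    [NormedSpace ℝ V] {P : Measure Ω} {f : Ω → ℝ → V} {g : Ω → V} {t : ℝ} (ht : t ∈ Icc 0 T)
    (hm : ∀ t ∈ Icc 0 T, AEStronglyMeasurable (fun ω => f ω t) P)
    (hd : ∀ᵐ ω ∂P, HasDerivWithinAt (f ω) (g ω) (Icc 0 T) t) :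
    AEStronglyMeasurable g P := by
  -- Every time of the interval, end points included, is a limit of other times of it, so one
  -- sequence of difference quotients gives the one-sided derivative as well.
  have : (𝓝[Icc 0 T \ {t}] t).NeBot :=
    accPt_principal_iff_clusterPt.1 (uniqueDiffWithinAt_iff_accPt.1 (uniqueDiffOn_Icc hT t ht))
  obtain ⟨τ, hτ⟩ := exists_seq_tendsto (𝓝[Icc 0 T \ {t}] t)
  have hmem := hτ.eventually self_mem_nhdsWithin
  obtain ⟨N, hN⟩ := eventually_atTop.1 hmem
  refine aestronglyMeasurable_of_tendsto_ae atTop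
    (f := fun n ω => slope (f ω) t (τ (n + N))) (fun n => ?_) ?_
  · simp only [slope, vsub_eq_sub]
    exact ((hm _ (hN _ (Nat.le_add_left _ _)).1).sub (hm t ht)).const_smul _
  · filter_upwards [hd] with ω hω
    exact (hasDerivWithinAt_iff_tendsto_slope.1 hω).comp (hτ.comp (tendsto_add_atTop_nat N))

theorem aestronglyMeasurable_fderiv {P : Measure Ω} {f : Ω → E d → E d} {x : E d}
    (hm : ∀ x, AEStronglyMeasurable (fun ω => f ω x) P)
    (hd : ∀ᵐ ω ∂P, DifferentiableAt ℝ (f ω) x) :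
    AEStronglyMeasurable (fun ω => fderiv ℝ (f ω) x) P := by
  have h1 : ∀ v, AEStronglyMeasurable (fun ω => fderiv ℝ (f ω) x v) P := by
    intro v
    refine aestronglyMeasurable_of_tendsto_ae atTop
      (f := fun (n : ℕ) ω => ((n : ℝ) + 1) • (f ω (x + ((n : ℝ) + 1)⁻¹ • v) - f ω x))
      (fun n => ((hm (x + ((n : ℝ) + 1)⁻¹ • v)).sub (hm x)).const_smul ((n : ℝ) + 1)) ?_
    filter_upwards [hd] with ω hω
    exact (hω.hasFDerivAt.lim_real v).comp
      (tendsto_atTop_add_const_right _ (1 : ℝ) tendsto_natCast_atTop_atTop)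
  let b := (EuclideanSpace.basisFun (Fin d) ℝ).toBasis
  have h2 : (fun ω => fderiv ℝ (f ω) x) = fun ω => ∑ i,
      (ContinuousLinearMap.toSpanSingleton ℝ (fderiv ℝ (f ω) x (basisVec i))).comp
        (EuclideanSpace.proj i : E d →L[ℝ] ℝ) := by
    ext1 ω
    refine ContinuousLinearMap.ext fun v => ?_
    have hv : v = ∑ i, v i • basisVec i := by
      simpa [basisVec] using ((EuclideanSpace.basisFun (Fin d) ℝ).sum_repr v).symm
    conv_lhs => rw [hv, map_sum]
    simp [basisVec]
  rw [h2]
  refine Finset.aestronglyMeasurable_fun_sum _ fun i _ => ?_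
  have hc : Continuous fun w : E d => (ContinuousLinearMap.toSpanSingleton ℝ w).comp
      (EuclideanSpace.proj i : E d →L[ℝ] ℝ) := by
    have h3 : Continuous fun w : E d => ContinuousLinearMap.toSpanSingleton ℝ w :=
      (ContinuousLinearMap.toSpanSingletonCLE (𝕜 := ℝ) (E := E d)).continuous
    exact h3.clm_comp continuous_const
  exact hc.comp_aestronglyMeasurable (h1 _)

end Regular

end Kelvin

end

/-! ### Bounds uniform in time for velocities, momenta and flows. -/

noncomputable section

namespace Kelvin

variable {d : ℕ}

section Bounds

/-- The constant of the embedding of `H^r` into the `C¹` fields and into `L²`. -/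
def embConst (d : ℕ) (D : Domain) (r : ℝ) : ℝ≥0∞ :=
  1 + sobConst d D r + ENNReal.ofReal (2 * Real.pi) * sobConst d D r

theorem embConst_lt_top (D : Domain) {r : ℝ} (hr : 1 + (d : ℝ) / 2 < r) :
    embConst d D r < ∞ := by
  have := sobConst_lt_top D hr
  exact ENNReal.add_lt_top.2 ⟨ENNReal.add_lt_top.2 ⟨ENNReal.one_lt_top, this⟩,
    ENNReal.mul_lt_top ENNReal.ofReal_lt_top this⟩

/-- The sum of the `C¹` norm and the `L²` norm of a field. -/
def strongNorm (D : Domain) (f : E d → E d) : ℝ≥0∞ :=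
  (⨆ x, ‖f x‖ₑ) + (⨆ x, ‖fderiv ℝ f x‖ₑ) + eLpNorm f 2 (vol d D)

theorem MemSob.strongNorm_le {D : Domain} {r : ℝ} {f : E d → E d} (hf : MemSob D r f)
    (hr : 1 + (d : ℝ) / 2 < r) : strongNorm D f ≤ 3 * (embConst d D r * sobNorm D r f) := by
  have h1 : (⨆ x, ‖f x‖ₑ) ≤ embConst d D r * sobNorm D r f :=
    iSup_le fun x => (hf.enorm_le hr x).trans
      (mul_le_mul' (le_add_right le_add_self) le_rfl)
  have h2 : (⨆ x, ‖fderiv ℝ f x‖ₑ) ≤ embConst d D r * sobNorm D r f :=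
    iSup_le fun x => (hf.enorm_fderiv_le hr x).trans (mul_le_mul' le_add_self le_rfl)
  have h3 : eLpNorm f 2 (vol d D) ≤ embConst d D r * sobNorm D r f :=
    (hf.eLpNorm_le hr).trans (mul_le_mul' le_self_add le_rfl)
  calc strongNorm D f ≤ _ := add_le_add (add_le_add h1 h2) h3
    _ = _ := by ring

theorem strongNorm_add_le (D : Domain) {f g : E d → E d} (hf : ContDiff ℝ 1 f)
    (hg : ContDiff ℝ 1 g) : strongNorm D (f + g) ≤ strongNorm D f + strongNorm D g := by
  have h1 : (⨆ x, ‖(f + g) x‖ₑ) ≤ (⨆ x, ‖f x‖ₑ) + ⨆ x, ‖g x‖ₑ :=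
    iSup_le fun x => (enorm_add_le _ _).trans
      (add_le_add (le_iSup (fun x => ‖f x‖ₑ) x) (le_iSup (fun x => ‖g x‖ₑ) x))
  have h2 : (⨆ x, ‖fderiv ℝ (f + g) x‖ₑ) ≤ (⨆ x, ‖fderiv ℝ f x‖ₑ) + ⨆ x, ‖fderiv ℝ g x‖ₑ := by
    refine iSup_le fun x => ?_
    rw [fderiv_add (hf.differentiable (by norm_num) x) (hg.differentiable (by norm_num) x)]
    refine (enorm_add_le (fderiv ℝ f x) (fderiv ℝ g x)).trans ?_
    gcongr
    · exact le_iSup (fun x => ‖fderiv ℝ f x‖ₑ) x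
    · exact le_iSup (fun x => ‖fderiv ℝ g x‖ₑ) x
  have h3 : eLpNorm (f + g) 2 (vol d D) ≤ eLpNorm f 2 (vol d D) + eLpNorm g 2 (vol d D) :=
    eLpNorm_add_le hf.continuous.aestronglyMeasurable hg.continuous.aestronglyMeasurable
      (by norm_num)
  calc strongNorm D (f + g) ≤ _ := add_le_add (add_le_add h1 h2) h3
    _ = _ := by unfold strongNorm; ring

/-- Compactness of the interval turns local boundedness into a global bound; continuity of the norm
in time is not required. -/
theorem exists_bound_Icc {T : ℝ} {N : ℝ → ℝ≥0∞}
    (h : ∀ t ∈ Icc 0 T, ∃ C : ℝ≥0∞, C < ∞ ∧ ∀ᶠ τ in 𝓝[Icc 0 T] t, N τ ≤ C) :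
    ∃ C : ℝ≥0∞, C < ∞ ∧ ∀ t ∈ Icc 0 T, N t ≤ C := by
  refine isCompact_Icc.induction_on (p := fun s => ∃ C : ℝ≥0∞, C < ∞ ∧ ∀ t ∈ s, N t ≤ C)
    ⟨0, ENNReal.zero_lt_top, by simp⟩ ?_ ?_ ?_
  · rintro s t hst ⟨C, hC, h⟩
    exact ⟨C, hC, fun x hx => h x (hst hx)⟩
  · rintro s t ⟨C, hC, h⟩ ⟨C', hC', h'⟩
    refine ⟨max C C', max_lt hC hC', fun x hx => ?_⟩
    rcases hx with hx | hx
    · exact (h x hx).trans (le_max_left _ _)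
    · exact (h' x hx).trans (le_max_right _ _)
  · intro t ht
    obtain ⟨C, hC, h⟩ := h t ht
    exact ⟨{τ | N τ ≤ C}, h, C, hC, fun τ hτ => hτ⟩

/-- The triangle inequality is applied to `strongNorm`, after conversion from the Sobolev norms, so
none is needed for `sobNorm` itself. -/
theorem ContSob.exists_strongNorm_le {D : Domain} {r T : ℝ} {f : ℝ → E d → E d}
    (hf : ContSob D r T f) (hr : 1 + (d : ℝ) / 2 < r) :
    ∃ C : ℝ≥0∞, C < ∞ ∧ ∀ t ∈ Icc 0 T, strongNorm D (f t) ≤ C := by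
  refine exists_bound_Icc fun t ht => ⟨3 * (embConst d D r * 1) + 3 * (embConst d D r * sobNorm D r (f t)),
    ?_, ?_⟩
  · have := embConst_lt_top (d := d) D hr
    exact ENNReal.add_lt_top.2
      ⟨ENNReal.mul_lt_top (by norm_num) (ENNReal.mul_lt_top this ENNReal.one_lt_top),
       ENNReal.mul_lt_top (by norm_num) (ENNReal.mul_lt_top this (hf t ht).1)⟩
  · filter_upwards [(hf t ht).2.eventually (gt_mem_nhds zero_lt_one), self_mem_nhdsWithin]
      with τ hτ hτI
    have hM : MemSob D r (f τ - f t) := hτ.trans ENNReal.one_lt_top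
    have h1 : f τ = (f τ - f t) + f t := by simp
    rw [h1]
    refine (strongNorm_add_le D (hM.contDiff hr) ((hf t ht).1.contDiff hr)).trans
      (add_le_add ((hM.strongNorm_le hr).trans ?_) ((hf t ht).1.strongNorm_le hr))
    gcongr

theorem norm_le_of_strongNorm_le {D : Domain} {f : E d → E d} {C : ℝ}
    (h : strongNorm D f ≤ ENNReal.ofReal C) (hC : 0 ≤ C) (x : E d) :
    ‖f x‖ ≤ C := by
  have h1 : ‖f x‖ₑ ≤ ENNReal.ofReal C :=
    (le_iSup (fun x => ‖f x‖ₑ) x).trans ((le_self_add.trans le_self_add).trans h)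
  rwa [← ofReal_norm, ENNReal.ofReal_le_ofReal_iff hC] at h1

theorem norm_fderiv_le_of_strongNorm_le {D : Domain} {f : E d → E d} {C : ℝ}
    (h : strongNorm D f ≤ ENNReal.ofReal C) (hC : 0 ≤ C) (x : E d) :
    ‖fderiv ℝ f x‖ ≤ C := by
  have h1 : ‖fderiv ℝ f x‖ₑ ≤ ENNReal.ofReal C :=
    (le_iSup (fun x => ‖fderiv ℝ f x‖ₑ) x).trans ((le_add_self.trans le_self_add).trans h)
  rwa [← ofReal_norm, ENNReal.ofReal_le_ofReal_iff hC] at h1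

theorem eLpNorm_le_of_strongNorm_le {D : Domain} {f : E d → E d} {C : ℝ}
    (h : strongNorm D f ≤ ENNReal.ofReal C) : eLpNorm f 2 (vol d D) ≤ ENNReal.ofReal C :=
  le_add_self.trans h

end Bounds

section Structures

/-- A velocity field with bounds that are uniform in time. -/
structure IsBddVelocity (D : Domain) (T C : ℝ) (u : ℝ → E d → E d) : Prop where
  cont : ContinuousOn (fun z : ℝ × E d => u z.1 z.2) (Icc 0 T ×ˢ univ)
  contDiff : ∀ t ∈ Icc 0 T, ContDiff ℝ 1 (u t)
  cont_fderiv : ContinuousOn (fun z : ℝ × E d => fderiv ℝ (u z.1) z.2) (Icc 0 T ×ˢ univ)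
  isOn : ∀ t ∈ Icc 0 T, IsOn D (u t)
  strong_le : ∀ t ∈ Icc 0 T, strongNorm D (u t) ≤ ENNReal.ofReal C

theorem ContSob.exists_isBddVelocity {D : Domain} {r T : ℝ} {u : ℝ → E d → E d}
    (hu : ContSob D r T u) (hr : 1 + (d : ℝ) / 2 < r) :
    ∃ C, 0 ≤ C ∧ IsBddVelocity D T C u := by
  obtain ⟨C, hC, h⟩ := hu.exists_strongNorm_le hr
  exact ⟨C.toReal, ENNReal.toReal_nonneg, hu.continuousOn hr, fun t ht => (hu t ht).1.contDiff hr,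
    hu.continuousOn_fderiv hr, fun t ht => (hu t ht).1.isOn, fun t ht => by
      rw [ENNReal.ofReal_toReal hC.ne]; exact h t ht⟩

/-- A momentum path with bounds that are uniform in time. -/
structure IsBddMomentum (D : Domain) (T R : ℝ) (ξ : ℝ → E d → E d) : Prop where
  regular : IsRegular T ξ (timeDeriv T ξ)
  isOn : ∀ t ∈ Icc 0 T, IsOn D (ξ t)
  isOn' : ∀ t ∈ Icc 0 T, IsOn D (timeDeriv T ξ t)
  nonneg : 0 ≤ R
  strong_le : ∀ t ∈ Icc 0 T, strongNorm D (ξ t) ≤ ENNReal.ofReal R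
  strong_le' : ∀ t ∈ Icc 0 T, strongNorm D (timeDeriv T ξ t) ≤ ENNReal.ofReal R

variable {Ω : Type*} [MeasurableSpace Ω]

theorem IsMomentum.exists_isBddMomentum {D : Domain} {r T : ℝ} {P : Measure Ω}
    {ξ : Ω → ℝ → E d → E d} (h : IsMomentum D r T P ξ) (hr : 1 + (d : ℝ) / 2 < r) :
    ∃ R : Ω → ℝ, MemLp R 2 P ∧ ∀ᵐ ω ∂P, IsBddMomentum D T (R ω) (ξ ω) := by
  obtain ⟨R, hR, hb⟩ := h.bound
  refine ⟨fun ω => (3 * embConst d D r).toReal * ‖R ω‖, hR.norm.const_mul _, ?_⟩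
  filter_upwards [hb, h.path] with ω hω hp
  have key : ∀ f : E d → E d, MemSob D r f → sobNorm D r f ≤ ENNReal.ofReal (R ω) →
      strongNorm D f ≤ ENNReal.ofReal ((3 * embConst d D r).toReal * ‖R ω‖) := by
    intro f hf hle
    refine (hf.strongNorm_le hr).trans ?_
    rw [ENNReal.ofReal_mul ENNReal.toReal_nonneg, ENNReal.ofReal_toReal
      (ENNReal.mul_lt_top (by norm_num) (embConst_lt_top D hr)).ne, ← mul_assoc]
    gcongr
    exact hle.trans (ENNReal.ofReal_le_ofReal (Real.le_norm_self _))
  exact ⟨hp.isRegular hr, fun t ht => (hp.1 t ht).1.isOn,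
    fun t ht => (hp.2.1 t ht).1.isOn, by positivity,
    fun t ht => key _ (hp.1 t ht).1 (le_self_add.trans (hω t ht)),
    fun t ht => key _ (hp.2.1 t ht).1 (le_add_self.trans (hω t ht))⟩

/-- A path of diffeomorphisms with bounds that are uniform in time. -/
structure IsBddFlow (D : Domain) (T C : ℝ) (X : ℝ → E d → E d) : Prop where
  regular : IsRegular T X (timeDeriv T X)
  bij : ∀ t ∈ Icc 0 T, Function.Bijective (X t)
  isOn : ∀ t ∈ Icc 0 T, IsOn D (fun x => X t x - x)
  isOn' : ∀ t ∈ Icc 0 T, IsOn D (timeDeriv T X t)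
  contDiff_inv : ∀ t ∈ Icc 0 T, ContDiff ℝ 1 (Function.invFun (X t))
  disp_le : ∀ t ∈ Icc 0 T, ∀ x, ‖X t x - x‖ ≤ C
  fderiv_le : ∀ t ∈ Icc 0 T, ∀ x, ‖fderiv ℝ (X t) x‖ ≤ C
  deriv_strong_le : ∀ t ∈ Icc 0 T, strongNorm D (timeDeriv T X t) ≤ ENNReal.ofReal C
  inv_fderiv_le : ∀ t ∈ Icc 0 T, ∀ x, ‖fderiv ℝ (Function.invFun (X t)) x‖ ≤ C

theorem fderiv_eq_of_sub_id {f : E d → E d} (hf : ContDiff ℝ 1 fun x => f x - x) (x : E d) :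
    fderiv ℝ f x = fderiv ℝ (fun x => f x - x) x + ContinuousLinearMap.id ℝ (E d) := by
  have h2 : f = fun x => (f x - x) + x := by ext1 x; simp
  conv_lhs => rw [h2]
  rw [fderiv_fun_add (hf.differentiable (by norm_num) x) differentiableAt_fun_id, fderiv_fun_id]

theorem IsConfiguration.exists_isBddFlow {D : Domain} {r T : ℝ} {P : Measure Ω}
    {X : Ω → ℝ → E d → E d} (h : IsConfiguration D r T P X) (hr : 1 + (d : ℝ) / 2 < r) :
    ∃ C : ℝ, 0 ≤ C ∧ ∀ᵐ ω ∂P, IsBddFlow D T C (X ω) := by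
  obtain ⟨C, hb⟩ := h.bound
  let K : ℝ := (3 * (embConst d D r * C)).toReal
  have hK : ENNReal.ofReal K = 3 * (embConst d D r * C) := ENNReal.ofReal_toReal
    (ENNReal.mul_lt_top (by norm_num) (ENNReal.mul_lt_top (embConst_lt_top D hr)
      ENNReal.coe_lt_top)).ne
  have hK0 : 0 ≤ K := ENNReal.toReal_nonneg
  -- The bound K is for displacements; the additional 1 accounts for the derivative of the identity.
  refine ⟨K + 1, by positivity, ?_⟩
  filter_upwards [hb, h.path, h.bij] with ω hω hp hbij
  have key : ∀ f : E d → E d, sobNorm D r f ≤ C → MemSob D r f ∧ strongNorm D f ≤ ENNReal.ofReal K := by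
    intro f hle
    have hf : MemSob D r f := hle.trans_lt ENNReal.coe_lt_top
    refine ⟨hf, (hf.strongNorm_le hr).trans ?_⟩
    rw [hK]
    gcongr
  have hid : ∀ x : E d, ∀ f : E d → E d, sobNorm D r (fun x => f x - x) ≤ C →
      ‖fderiv ℝ f x‖ ≤ K + 1 := by
    intro x f hf
    rw [fderiv_eq_of_sub_id ((key _ hf).1.contDiff hr)]
    refine (norm_add_le _ _).trans (add_le_add ?_ ContinuousLinearMap.norm_id_le)
    exact norm_fderiv_le_of_strongNorm_le (key _ hf).2 hK0 x
  have hreg := hp.isRegular hr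
  refine ⟨?_, hbij, fun t ht => (hp.1 t ht).1.isOn, ?_, ?_, ?_, ?_, ?_, ?_⟩
  · have := hreg.add_id
    rwa [timeDeriv_sub_id] at this
  · intro t ht
    exact (key _ (hω t ht).2.1).1.isOn
  · intro t ht
    simpa using ((key _ (hω t ht).2.2).1.contDiff hr).add contDiff_id
  · intro t ht x
    exact (norm_le_of_strongNorm_le (key _ (hω t ht).1).2 hK0 x).trans (by linarith)
  · exact fun t ht x => hid x _ (hω t ht).1
  · intro t ht
    exact (key _ (hω t ht).2.1).2.trans (ENNReal.ofReal_le_ofReal (by linarith))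
  · exact fun t ht x => hid x _ (hω t ht).2.2

end Structures

end Kelvin

end

/-! ### Inverse maps, change of variables and integrability along the noisy flow. -/

noncomputable section

namespace Kelvin

variable {d : ℕ}

section Inverse

theorem bijective_add_const {f : E d → E d} (hf : Function.Bijective f) (c : E d) :
    Function.Bijective fun x => f x + c :=
  (Equiv.addRight c).bijective.comp hf

theorem invFun_add_const {f : E d → E d} (hf : Function.Bijective f) (c : E d) :
    Function.invFun (fun x => f x + c) = fun y => Function.invFun f (y - c) := by
  ext1 y
  apply (bijective_add_const hf c).1
  rw [Function.rightInverse_invFun (bijective_add_const hf c).2 y]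
  simp [Function.rightInverse_invFun hf.2 (y - c)]

theorem exists_abs_det_le (d : ℕ) (C : ℝ) :
    ∃ K : ℝ, 0 ≤ K ∧ ∀ L : E d →L[ℝ] E d, ‖L‖ ≤ C → |L.det| ≤ K := by
  have : ProperSpace (E d →L[ℝ] E d) := FiniteDimensional.proper ℝ _
  obtain ⟨K, hK⟩ := (isCompact_closedBall (0 : E d →L[ℝ] E d) C).exists_bound_of_continuousOn
    (f := fun L => L.det) ContinuousLinearMap.continuous_det.continuousOn
  exact ⟨max K 0, le_max_right _ _, fun L hL =>
    (hK L (by simpa using hL)).trans (le_max_left _ _)⟩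

/-- Change of variables x = A(y): the Jacobian determinant of the inverse map is at most K. The
determinant bound is kept as a hypothesis so that one K serves all ω and t. -/
theorem lintegral_comp_le_of_inverse {Φ A : E d → E d} (hA : ContDiff ℝ 1 A)
    (h1 : Function.LeftInverse Φ A) (h2 : Function.RightInverse Φ A) {C K : ℝ}
    (hC : ∀ x, ‖fderiv ℝ A x‖ ≤ C) (hK : ∀ L : E d →L[ℝ] E d, ‖L‖ ≤ C → |L.det| ≤ K)
    (f : E d → ℝ≥0∞) :
    ∫⁻ x, f (Φ x) ≤ ENNReal.ofReal K * ∫⁻ x, f x := by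
  have h := lintegral_image_eq_lintegral_abs_det_fderiv_mul volume MeasurableSet.univ
    (fun x _ => (hA.differentiable (by norm_num) x).hasFDerivAt.hasFDerivWithinAt)
    h1.injective.injOn (fun x => f (Φ x))
  rw [image_univ, h2.surjective.range_eq] at h
  simp only [Measure.restrict_univ] at h
  rw [h, ← lintegral_const_mul' _ _ ENNReal.ofReal_ne_top]
  refine lintegral_mono fun x => ?_
  rw [h1 x]
  gcongr
  exact hK _ (hC x)

theorem IsOn.comp_of_sub_id {V : Type*} {D : Domain} {f : E d → V} {Φ : E d → E d} (hf : IsOn D f)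
    (hΦ : IsOn D fun x => Φ x - x) : IsOn D fun x => f (Φ x) := by
  cases D
  · trivial
  · intro x k
    have h1 : Φ (x + intPoint k) = Φ x + intPoint k := by
      have h2 : Φ (x + intPoint k) - (x + intPoint k) = Φ x - x := hΦ x k
      have h3 : Φ (x + intPoint k) = Φ x - x + (x + intPoint k) := by rw [← h2]; abel
      rw [h3]; abel
    change f (Φ (x + intPoint k)) = _
    rw [h1, hf]

theorem IsOn.fderiv {V : Type*} [NormedAddCommGroup V] [NormedSpace ℝ V] {D : Domain}
    {f : E d → V} (hf : IsOn D f) : IsOn D fun x => fderiv ℝ f x := by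
  cases D
  · trivial
  · intro x k
    have h : (fun y => f (y + intPoint k)) = f := funext fun y => hf y k
    change _root_.fderiv ℝ f (x + intPoint k) = _
    rw [← fderiv_comp_add_right, h]

/-- A periodic displacement means that the map commutes with lattice translations, and then so does
its inverse. -/
theorem IsOn.sub_id_inverse {D : Domain} {Φ A : E d → E d} (hΦ : IsOn D fun x => Φ x - x)
    (h1 : Function.LeftInverse Φ A) (h2 : Function.RightInverse Φ A) :
    IsOn D fun x => A x - x := by
  cases D
  · trivial
  · intro x k
    have h3 : A (x + intPoint k) = A x + intPoint k := by
      apply h2.injective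
      have h4 : Φ (A x + intPoint k) - (A x + intPoint k) = Φ (A x) - A x := hΦ (A x) k
      have h5 : Φ (A x + intPoint k) = Φ (A x) - A x + (A x + intPoint k) := by rw [← h4]; abel
      rw [h1, h5, h1]; abel
    change A (x + intPoint k) - (x + intPoint k) = A x - x
    rw [h3]; abel

end Inverse

section Noisy

variable {D : Domain} {T C : ℝ} {X u : ℝ → E d → E d} {b : ℝ → E d}

theorem IsBddFlow.invFun_right (hX : IsBddFlow D T C X) {t : ℝ} (ht : t ∈ Icc 0 T) (x : E d) :
    X t (Function.invFun (X t) x) = x := Function.rightInverse_invFun (hX.bij t ht).2 x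

theorem IsBddFlow.invFun_left (hX : IsBddFlow D T C X) {t : ℝ} (ht : t ∈ Icc 0 T) (x : E d) :
    Function.invFun (X t) (X t x) = x := Function.leftInverse_invFun (hX.bij t ht).1 x

/-- On the whole space a sup bound does not give square integrability, so the flow is undone by a
change of variables; on the torus the sup bound suffices. -/
theorem IsBddFlow.eLpNorm_comp_le (hX : IsBddFlow D T C X) {Cu K : ℝ}
    (hu : IsBddVelocity D T Cu u) (hCu : 0 ≤ Cu)
    (hK : ∀ L : E d →L[ℝ] E d, ‖L‖ ≤ C → |L.det| ≤ K)
    {t : ℝ} (ht : t ∈ Icc 0 T) :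
    eLpNorm (fun x => u t (X t x + b t)) 2 (vol d D) ≤
      (1 + ENNReal.ofReal K ^ (1 / 2 : ℝ)) * ENNReal.ofReal Cu := by
  cases D
  · refine le_trans ?_ (mul_le_mul' le_add_self le_rfl)
    refine le_trans ?_ (mul_le_mul' le_rfl (eLpNorm_le_of_strongNorm_le (hu.strong_le t ht)))
    simp only [eLpNorm_eq_lintegral_rpow_enorm_toReal (p := 2) (by norm_num) (by norm_num), vol,
      cell, Measure.restrict_univ]
    rw [ENNReal.toReal_ofNat, ← ENNReal.mul_rpow_of_nonneg _ _ (by norm_num)]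
    gcongr
    have h := lintegral_comp_le_of_inverse (Φ := fun x => X t x + b t)
      (A := fun x => Function.invFun (X t) (x - b t))
      ((hX.contDiff_inv t ht).comp (contDiff_id.sub contDiff_const))
      (fun x => by simp [hX.invFun_right ht]) (fun x => by simp [hX.invFun_left ht])
      (C := C) (K := K) (fun x => by
        rw [fderiv_comp_sub]; exact hX.inv_fderiv_le t ht _) hK
      (fun x => ‖u t x‖ₑ ^ (2 : ℝ))
    exact h
  · refine le_trans ?_ (mul_le_mul' le_self_add le_rfl)
    refine (eLpNorm_le_of_ae_bound (C := Cu)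
      (Eventually.of_forall fun x => norm_le_of_strongNorm_le (hu.strong_le t ht) hCu _)).trans ?_
    simp

theorem IsBddFlow.continuousOn_noisy (hX : IsBddFlow D T C X) (hb : ContinuousOn b (Icc 0 T)) :
    ContinuousOn (fun z : ℝ × E d => X z.1 z.2 + b z.1) (Icc 0 T ×ˢ univ) :=
  hX.regular.cont.add (hb.comp continuousOn_fst fun _ h => h.1)

theorem continuousOn_comp_noisy {V : Type*} [TopologicalSpace V] {f : ℝ → E d → V}
    (hf : ContinuousOn (fun z : ℝ × E d => f z.1 z.2) (Icc 0 T ×ˢ univ)) {Y : ℝ → E d → E d}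
    (hY : ContinuousOn (fun z : ℝ × E d => Y z.1 z.2) (Icc 0 T ×ˢ univ)) :
    ContinuousOn (fun z : ℝ × E d => f z.1 (Y z.1 z.2)) (Icc 0 T ×ˢ univ) :=
  hf.comp (f := fun z : ℝ × E d => (z.1, Y z.1 z.2)) (continuousOn_fst.prodMk hY)
    fun _ h => ⟨h.1, mem_univ _⟩

theorem continuous_slice {V : Type*} [TopologicalSpace V] {f : ℝ → E d → V}
    (hf : ContinuousOn (fun z : ℝ × E d => f z.1 z.2) (Icc 0 T ×ˢ univ)) {t : ℝ}
    (ht : t ∈ Icc 0 T) : Continuous (f t) :=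
  hf.comp_continuous (f := fun x : E d => (t, x)) (by fun_prop) fun _ => ⟨ht, mem_univ _⟩

theorem continuousOn_slice {V : Type*} [TopologicalSpace V] {f : ℝ → E d → V}
    (hf : ContinuousOn (fun z : ℝ × E d => f z.1 z.2) (Icc 0 T ×ˢ univ)) (x : E d) :
    ContinuousOn (fun t => f t x) (Icc 0 T) :=
  hf.comp (f := fun t : ℝ => (t, x)) (by fun_prop) fun _ h => ⟨h, mem_univ _⟩

end Noisy

section Integrability

variable {Ω : Type*} [MeasurableSpace Ω] {P : Measure Ω} [IsProbabilityMeasure P]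
  {D : Domain} {T : ℝ}

theorem integrable_triple_of_le {V : Type*} [NormedAddCommGroup V] {f : Ω → ℝ → E d → V}
    (hf : AEStronglyMeasurable (fun z : ℝ × (Ω × E d) => f z.2.1 z.1 z.2.2) (tripleMeasure D T P))
    {k : Ω → ℝ≥0∞} (hk : ∫⁻ ω, k ω ∂P < ∞)
    (h : ∀ᵐ ω ∂P, ∀ t ∈ Icc 0 T, ∫⁻ x, ‖f ω t x‖ₑ ∂(vol d D) ≤ k ω) :
    Integrable (fun z : ℝ × (Ω × E d) => f z.2.1 z.1 z.2.2) (tripleMeasure D T P) := by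
  refine ⟨hf, ?_⟩
  rw [hasFiniteIntegral_iff_enorm]
  unfold tripleMeasure at hf ⊢
  rw [lintegral_prod _ hf.enorm]
  have h1 : ∀ᵐ t ∂timeMeasure T,
      ∫⁻ y, ‖f y.1 t y.2‖ₑ ∂(P.prod (vol d D)) ≤ ∫⁻ ω, k ω ∂P := by
    filter_upwards [hf.prodMk_left, ae_timeMeasure T] with t ht htI
    rw [lintegral_prod _ ht.enorm]
    exact lintegral_mono_ae (h.mono fun ω hω => hω t htI)
  refine (lintegral_mono_ae h1).trans_lt ?_
  rw [lintegral_const]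
  exact ENNReal.mul_lt_top hk (measure_lt_top _ _)

theorem lintegral_enorm_inner_le {f g : E d → E d} {μ : Measure (E d)}
    (hf : AEStronglyMeasurable f μ) (hg : AEStronglyMeasurable g μ) :
    ∫⁻ x, ‖⟪f x, g x⟫_ℝ‖ₑ ∂μ ≤ eLpNorm f 2 μ * eLpNorm g 2 μ := by
  have h := ENNReal.lintegral_mul_le_Lp_mul_Lq μ Real.HolderConjugate.two_two hf.enorm hg.enorm
  rw [eLpNorm_eq_lintegral_rpow_enorm_toReal (p := 2) (by norm_num) (by norm_num),
    eLpNorm_eq_lintegral_rpow_enorm_toReal (p := 2) (by norm_num) (by norm_num)]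
  refine le_trans (lintegral_mono fun x => ?_) h
  simp only [Pi.mul_apply]
  rw [← ofReal_norm, ← ofReal_norm, ← ofReal_norm, ← ENNReal.ofReal_mul (norm_nonneg _)]
  exact ENNReal.ofReal_le_ofReal (norm_inner_le_norm _ _)

end Integrability

section Measurability

variable {Ω : Type*} [MeasurableSpace Ω] {P : Measure Ω} {D : Domain} {T : ℝ}

theorem IsMomentum.aestronglyMeasurable {r : ℝ} {ξ : Ω → ℝ → E d → E d} (h : IsMomentum D r T P ξ)
    {t : ℝ} (ht : t ∈ Icc 0 T) (x : E d) : AEStronglyMeasurable (fun ω => ξ ω t x) P :=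
  (h.meas t ht x).aestronglyMeasurable

theorem aestronglyMeasurable_timeDeriv (hT : 0 < T) {ξ : Ω → ℝ → E d → E d}
    (hm : ∀ t ∈ Icc 0 T, ∀ x, AEStronglyMeasurable (fun ω => ξ ω t x) P)
    (hr : ∀ᵐ ω ∂P, IsRegular T (ξ ω) (timeDeriv T (ξ ω))) {t : ℝ} (ht : t ∈ Icc 0 T) (x : E d) :
    AEStronglyMeasurable (fun ω => timeDeriv T (ξ ω) t x) P :=
  aestronglyMeasurable_deriv hT ht (f := fun ω t => ξ ω t x) (fun τ hτ => hm τ hτ x)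
    (hr.mono fun _ h => h.deriv t ht x)

end Measurability

end Kelvin

end

/-! ### Localisation in time and in the probability space. -/

noncomputable section

namespace Kelvin

variable {d : ℕ}

section Localisation

variable {Ω : Type*} [MeasurableSpace Ω] {P : Measure Ω} [IsProbabilityMeasure P]
  {D : Domain} {T : ℝ}

/-- The time cut-offs `C_c^∞((0,T))`. -/
def IsTimeTest (T : ℝ) (θ : ℝ → ℝ) : Prop :=
  ContDiff ℝ (⊤ : ℕ∞) θ ∧ HasCompactSupport θ ∧ tsupport θ ⊆ Ioo 0 T

theorem eqOn_zero_of_forall_timeTest (hT : 0 < T) {H : ℝ → ℝ} (hH : ContinuousOn H (Icc 0 T))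
    (h : ∀ θ, IsTimeTest T θ → ∫ t, θ t * H t ∂(timeMeasure T) = 0) :
    ∀ t ∈ Icc 0 T, H t = 0 := by
  have h1 : ∀ᵐ t, t ∈ Ioo 0 T → H t = 0 := by
    refine isOpen_Ioo.ae_eq_zero_of_integral_contDiff_smul_eq_zero
      ((hH.mono Ioo_subset_Icc_self).locallyIntegrableOn measurableSet_Ioo) fun g hg hgc hgs => ?_
    rw [← h g ⟨hg, hgc, hgs⟩, timeMeasure]
    refine (setIntegral_eq_integral_of_forall_compl_eq_zero fun t ht => ?_).symm
    have : t ∉ tsupport g := fun hmem => ht (Ioo_subset_Ioc_self (hgs hmem))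
    simp [image_eq_zero_of_notMem_tsupport this]
  have h2 : H =ᵐ[volume.restrict (Icc 0 T)] fun _ => (0 : ℝ) := by
    rw [← Measure.restrict_congr_set Ioo_ae_eq_Icc]
    exact (ae_restrict_iff' measurableSet_Ioo).2 h1
  exact Measure.eqOn_Icc_of_ae_eq volume hT.ne h2 hH continuousOn_const

theorem integral_triple_eq {f : Ω → ℝ → E d → ℝ}
    (hf : Integrable (fun z : ℝ × (Ω × E d) => f z.2.1 z.1 z.2.2) (tripleMeasure D T P)) :
    ∫ z, f z.2.1 z.1 z.2.2 ∂(tripleMeasure D T P) =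
      ∫ t, ∫ ω, ∫ x, f ω t x ∂(vol d D) ∂P ∂(timeMeasure T) := by
  unfold tripleMeasure at hf ⊢
  rw [integral_prod _ hf]
  refine integral_congr_ae ?_
  filter_upwards [hf.prod_right_ae] with t ht
  rw [integral_prod _ ht]

/-- A fundamental lemma of the calculus of variations in the two variables t and ω. For a fixed
event the time cut-offs show that a continuous function of t vanishes; for fixed t the events then
show that the spatial integral vanishes almost surely. -/
theorem ae_integral_eq_zero_of_forall_test (hT : 0 < T) {g : Ω → ℝ → E d → ℝ}
    (hm : ∀ t ∈ Icc 0 T, ∀ x, AEStronglyMeasurable (fun ω => g ω t x) P)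
    (hc : ∀ᵐ ω ∂P, ContinuousOn (fun z : ℝ × E d => g ω z.1 z.2) (Icc 0 T ×ˢ univ))
    {R : Ω → ℝ} (hR : Integrable R P) {k : E d → ℝ} (hk : Integrable k (vol d D))
    (hb : ∀ᵐ ω ∂P, ∀ t ∈ Icc 0 T, ∀ x, ‖g ω t x‖ ≤ R ω * k x)
    (h0 : ∀ A : Set Ω, MeasurableSet A → ∀ θ, IsTimeTest T θ →
      ∫ z, (A.indicator 1 z.2.1 : ℝ) * (θ z.1 * g z.2.1 z.1 z.2.2) ∂(tripleMeasure D T P) = 0) :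
    ∀ᵐ ω ∂P, ∀ t ∈ Icc 0 T, ∫ x, g ω t x ∂(vol d D) = 0 := by
  set G : Ω → ℝ → ℝ := fun ω t => ∫ x, g ω t x ∂(vol d D) with hGdef
  have hGc : ∀ᵐ ω ∂P, ContinuousOn (G ω) (Icc 0 T) := by
    filter_upwards [hc, hb] with ω hω hbω
    exact continuousOn_of_dominated (bound := fun x => R ω * k x)
      (fun t ht => (continuous_slice hω ht).aestronglyMeasurable)
      (fun t ht => Eventually.of_forall fun x => hbω t ht x) (hk.const_mul _)
      (Eventually.of_forall fun x => continuousOn_slice hω x)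
  have hGb : ∀ᵐ ω ∂P, ∀ t ∈ Icc 0 T, ‖G ω t‖ ≤ R ω * ∫ x, k x ∂(vol d D) := by
    filter_upwards [hb] with ω hbω t ht
    rw [← integral_const_mul]
    exact norm_integral_le_of_norm_le (hk.const_mul _) (Eventually.of_forall fun x => hbω t ht x)
  have hGm : ∀ t ∈ Icc 0 T, AEStronglyMeasurable (fun ω => G ω t) P := by
    intro t ht
    exact (aestronglyMeasurable_slice (D := D) (hm t ht)
      (hc.mono fun ω hω => continuous_slice hω ht)).integral_prod_right'
  have hGi : ∀ t ∈ Icc 0 T, Integrable (fun ω => G ω t) P := fun t ht =>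
    (hR.mul_const _).mono' (hGm t ht) (hGb.mono fun ω h => h t ht)
  have hA : ∀ A, MeasurableSet A → ∀ t ∈ Icc 0 T, ∫ ω in A, G ω t ∂P = 0 := by
    intro A hA
    refine eqOn_zero_of_forall_timeTest hT ?_ fun θ hθ => ?_
    · exact continuousOn_of_dominated (bound := fun ω => R ω * ∫ x, k x ∂(vol d D))
        (fun t ht => (hGm t ht).restrict)
        (fun t ht => ae_restrict_of_ae (hGb.mono fun ω h => h t ht)) (hR.mul_const _).integrableOn
        (ae_restrict_of_ae hGc)
    · rw [← h0 A hA θ hθ]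
      obtain ⟨M, hM⟩ := hθ.2.1.exists_bound_of_continuous hθ.1.continuous
      have hM0 : 0 ≤ M := (norm_nonneg _).trans (hM 0)
      have hint : Integrable (fun z : ℝ × (Ω × E d) => (A.indicator 1 z.2.1 : ℝ) *
          (θ z.1 * g z.2.1 z.1 z.2.2)) (tripleMeasure D T P) := by
        refine integrable_triple_of_le
          (f := fun ω t x => (A.indicator 1 ω : ℝ) * (θ t * g ω t x)) ?_
          (k := fun ω => ENNReal.ofReal (M * (R ω * ∫ x, k x ∂(vol d D)))) ?_ ?_
        · refine AEStronglyMeasurable.mul ?_ (AEStronglyMeasurable.mul ?_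
            (aestronglyMeasurable_triple hT.le hm hc))
          · exact ((measurable_const.indicator hA).comp
              (measurable_fst.comp measurable_snd)).aestronglyMeasurable
          · exact (hθ.1.continuous.comp continuous_id).measurable.comp measurable_fst
              |>.aestronglyMeasurable
        · exact ((hR.mul_const _).const_mul M).lintegral_lt_top
        · filter_upwards [hb] with ω hbω t ht
          have hle : ∀ x, ‖(A.indicator 1 ω : ℝ) * (θ t * g ω t x)‖ₑ ≤
              ENNReal.ofReal (M * (R ω * k x)) := by
            intro x
            rw [← ofReal_norm]
            refine ENNReal.ofReal_le_ofReal ?_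
            rw [norm_mul, norm_mul]
            have h1 : ‖(A.indicator 1 ω : ℝ)‖ ≤ 1 := by
              by_cases hω : ω ∈ A <;> simp [hω]
            calc _ ≤ 1 * (M * (R ω * k x)) := by
                  gcongr
                  · exact hM t
                  · exact hbω t ht x
              _ = _ := one_mul _
          refine (lintegral_mono hle).trans_eq ?_
          rw [← integral_const_mul, ← integral_const_mul, ofReal_integral_eq_lintegral_ofReal
            ((hk.const_mul _).const_mul _)]
          exact Eventually.of_forall fun x =>
            mul_nonneg hM0 ((norm_nonneg _).trans (hbω t ht x))
      rw [integral_triple_eq (f := fun ω t x => (A.indicator 1 ω : ℝ) * (θ t * g ω t x)) hint]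
      refine integral_congr_ae (Eventually.of_forall fun t => ?_)
      simp only [integral_const_mul]
      rw [← integral_indicator hA, ← integral_const_mul]
      refine integral_congr_ae (Eventually.of_forall fun ω => ?_)
      by_cases hω : ω ∈ A <;> simp [hω, hGdef]
  have hz : ∀ t ∈ Icc 0 T, ∀ᵐ ω ∂P, G ω t = 0 := fun t ht =>
    (hGi t ht).ae_eq_zero_of_forall_setIntegral_eq_zero fun A hAm _ => hA A hAm t ht
  -- So far the null set depends on t. A countable dense set of times and continuity in t produce a
  -- common one.
  have : Nonempty (Icc (0 : ℝ) T) := ⟨⟨0, left_mem_Icc.2 hT.le⟩⟩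
  let q := TopologicalSpace.denseSeq (Icc (0 : ℝ) T)
  filter_upwards [hGc, ae_all_iff.2 fun n => hz (q n) (q n).2] with ω hω hq t ht
  have h1 : Continuous fun τ : Icc (0 : ℝ) T => G ω τ := continuousOn_iff_continuous_domRestrict.1 hω
  have h2 := (TopologicalSpace.denseRange_denseSeq (Icc (0 : ℝ) T)).equalizer h1
    (continuous_const (y := (0 : ℝ))) (funext fun n => hq n)
  exact congrFun h2 ⟨t, ht⟩

end Localisation

/-! ### Bump functions adapted to both domains, and separation of continuous functions. -/

section Bump

/-- The lattice of periods of the domain. -/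
def lattice (d : ℕ) : Domain → Set (E d)
  | .space => {0}
  | .torus => range intPoint

theorem IsOn.add_lattice {V : Type*} {D : Domain} {f : E d → V} (hf : IsOn D f) {k : E d}
    (hk : k ∈ lattice d D) (x : E d) : f (x + k) = f x := by
  cases D
  · simp only [lattice, mem_singleton_iff] at hk
    rw [hk, add_zero]
  · obtain ⟨k, rfl⟩ := hk
    exact hf x k

theorem IsOn.map {V V' : Type*} {D : Domain} {f : E d → V} (hf : IsOn D f) (g : V → V') :
    IsOn D fun x => g (f x) := by
  cases D
  · trivial
  · exact fun x k => congrArg g (hf x k)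

theorem IsOn.map₂ {V V' V'' : Type*} {D : Domain} {f : E d → V} {f' : E d → V'} (hf : IsOn D f)
    (hf' : IsOn D f') (g : V → V' → V'') : IsOn D fun x => g (f x) (f' x) := by
  cases D
  · trivial
  · exact fun x k => congrArg₂ g (hf x k) (hf' x k)

theorem IsOn.sub_lattice {V : Type*} {D : Domain} {f : E d → V} (hf : IsOn D f) {k : E d}
    (hk : k ∈ lattice d D) (x : E d) : f (x - k) = f x := by
  rw [← hf.add_lattice hk (x - k), sub_add_cancel]

/-- A smooth substitute for the squared distance to the lattice. -/
def gauge (D : Domain) (x : E d) : ℝ :=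
  match D with
  | .space => ‖x‖ ^ 2
  | .torus => ∑ i, Real.sin (Real.pi * x i) ^ 2

theorem contDiff_gauge (D : Domain) : ContDiff ℝ (⊤ : ℕ∞) (gauge D : E d → ℝ) := by
  cases D
  · exact contDiff_norm_sq ℝ
  · unfold gauge
    fun_prop

theorem isOn_gauge (D : Domain) : IsOn D (gauge D : E d → ℝ) := by
  cases D
  · trivial
  · intro x k
    refine Finset.sum_congr rfl fun i _ => ?_
    have : Real.pi * (x + intPoint k) i = Real.pi * x i + k i * Real.pi := by
      simp [intPoint]; ring
    rw [this, Real.sin_add_int_mul_pi, mul_pow, ← sq_abs]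
    simp

/-- The constant is an upper bound for π², which comes from |sin(πy)| ≤ π|y|. -/
theorem gauge_le (D : Domain) (x : E d) : gauge D x ≤ 10 * ‖x‖ ^ 2 := by
  cases D
  · simp only [gauge]; nlinarith [sq_nonneg ‖x‖]
  · simp only [gauge]
    rw [EuclideanSpace.real_norm_sq_eq, Finset.mul_sum]
    refine Finset.sum_le_sum fun i _ => ?_
    have h1 : |Real.sin (Real.pi * x i)| ≤ |Real.pi * x i| := Real.abs_sin_le_abs
    have h2 := sq_le_sq.2 h1
    have h3 := Real.pi_lt_d2
    have h4 := Real.pi_pos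
    have h5 : Real.pi ^ 2 ≤ 10 := by nlinarith
    calc _ ≤ _ := h2
      _ = Real.pi ^ 2 * x i ^ 2 := by ring
      _ ≤ _ := by gcongr

/-- Rounding the coordinates brings them to |z| ≤ 1/2, where Jordan's inequality gives sin(π|z|) ≥
2|z|, more than enough. -/
theorem exists_lattice_norm_sq_le (D : Domain) (x : E d) :
    ∃ k ∈ lattice d D, ‖x - k‖ ^ 2 ≤ gauge D x := by
  cases D
  · exact ⟨0, rfl, by simp [gauge]⟩
  · refine ⟨intPoint fun i => round (x i), ⟨_, rfl⟩, ?_⟩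
    rw [← (isOn_gauge .torus).sub_lattice ⟨fun i => round (x i), rfl⟩ x]
    simp only [gauge]
    rw [EuclideanSpace.real_norm_sq_eq]
    refine Finset.sum_le_sum fun i _ => ?_
    set z := (x - intPoint fun i => round (x i)) i with hz
    have hz2 : |z| ≤ 1 / 2 := by
      have := abs_sub_round (x i)
      simpa [hz, intPoint] using this
    have h1 : 2 / Real.pi * (Real.pi * |z|) ≤ Real.sin (Real.pi * |z|) :=
      Real.mul_le_sin (by positivity) (by nlinarith [Real.pi_pos])
    have h2 : 2 / Real.pi * (Real.pi * |z|) = 2 * |z| := by field_simp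
    rw [h2] at h1
    have h3 : Real.sin (Real.pi * |z|) ^ 2 = Real.sin (Real.pi * z) ^ 2 := by
      rcases abs_choice z with h | h <;> rw [h]
      rw [mul_neg, Real.sin_neg, neg_sq]
    rw [← h3, ← sq_abs]
    exact pow_le_pow_left₀ (abs_nonneg _) (by linarith [abs_nonneg z]) 2

/-- The profile of the bump functions. -/
def profile : ContDiffBump (0 : ℝ) := ⟨1, 2, by norm_num, by norm_num⟩

/-- A bump function on the domain that is concentrated at `q` as `n → ∞`. -/
def bumpFn (D : Domain) (n : ℕ) (q x : E d) : ℝ := profile (((n : ℝ) + 1) * gauge D (x - q))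

theorem bumpFn_nonneg (D : Domain) (n : ℕ) (q x : E d) : 0 ≤ bumpFn D n q x := profile.nonneg

theorem gauge_nonneg (D : Domain) (x : E d) : 0 ≤ gauge D x := by
  cases D <;> simp only [gauge] <;> positivity

theorem bumpFn_eq_one {D : Domain} {n : ℕ} {q x : E d} (h : ((n : ℝ) + 1) * gauge D (x - q) ≤ 1) :
    bumpFn D n q x = 1 := by
  refine profile.one_of_mem_closedBall ?_
  rw [mem_closedBall_zero_iff, Real.norm_of_nonneg (mul_nonneg (by positivity) (gauge_nonneg _ _))]
  exact h

theorem gauge_lt_of_bumpFn_ne_zero {D : Domain} {n : ℕ} {q x : E d} (h : bumpFn D n q x ≠ 0) :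
    ((n : ℝ) + 1) * gauge D (x - q) < 2 := by
  by_contra! h2
  refine h (profile.zero_of_le_dist ?_)
  rw [dist_zero_right, Real.norm_of_nonneg (mul_nonneg (by positivity) (gauge_nonneg _ _))]
  exact h2

theorem exists_lattice_of_bumpFn_ne_zero {D : Domain} {n : ℕ} {q x : E d}
    (h : bumpFn D n q x ≠ 0) : ∃ k ∈ lattice d D, ((n : ℝ) + 1) * ‖x - q - k‖ ^ 2 < 2 := by
  obtain ⟨k, hk, hle⟩ := exists_lattice_norm_sq_le D (x - q)
  refine ⟨k, hk, lt_of_le_of_lt ?_ (gauge_lt_of_bumpFn_ne_zero h)⟩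
  gcongr

theorem isTest_bumpFn (D : Domain) (n : ℕ) (q : E d) : IsTest D (bumpFn D n q) := by
  refine ⟨?_, ?_, ?_⟩
  · exact profile.contDiff.comp (contDiff_const.mul
      ((contDiff_gauge D).comp (contDiff_id.sub contDiff_const)))
  · cases D
    · trivial
    · intro x k
      simp only [bumpFn]
      rw [add_sub_right_comm]
      exact congrArg _ (congrArg _ (isOn_gauge .torus (x - q) k))
  · cases D
    · refine HasCompactSupport.of_support_subset_isCompact (isCompact_closedBall q 2) fun x hx => ?_
      obtain ⟨k, hk, hle⟩ := exists_lattice_of_bumpFn_ne_zero hx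
      simp only [lattice, mem_singleton_iff] at hk
      rw [hk, sub_zero] at hle
      rw [mem_closedBall_iff_norm]
      have hn : (0 : ℝ) ≤ n := Nat.cast_nonneg n
      nlinarith [norm_nonneg (x - q), mul_nonneg hn (sq_nonneg ‖x - q‖)]
    · trivial

end Bump

section Positivity

/-- Countably many lattice translates of the cell cover the space, so a periodic null set in the
cell is null everywhere. -/
theorem ae_of_ae_vol {D : Domain} {p : E d → Prop} (hp : IsOn D p)
    (h : ∀ᵐ x ∂(vol d D), p x) : ∀ᵐ x, p x := by
  cases D
  · simpa [vol, cell] using h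
  · rw [vol, ae_restrict_iff' (measurableSet_cell d .torus)] at h
    have h1 : ∀ k : Fin d → ℤ, ∀ᵐ x : E d, x - intPoint k ∈ cell d .torus → p (x - intPoint k) :=
      fun k => (measurePreserving_sub_right volume (intPoint k : E d)).quasiMeasurePreserving.ae h
    filter_upwards [ae_all_iff.2 h1] with x hx
    have h2 := hx (fun i => ⌊x i⌋) (fun i => by
      exact ⟨Int.fract_nonneg (x i), Int.fract_lt_one (x i)⟩)
    rwa [IsOn.sub_lattice (D := .torus) hp ⟨_, rfl⟩] at h2

theorem eq_zero_of_ae_vol {D : Domain} {V : Type*} [NormedAddCommGroup V] {f : E d → V}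
    (hf : Continuous f) (hp : IsOn D f) (h : ∀ᵐ x ∂(vol d D), f x = 0) : f = 0 := by
  have h1 : ∀ᵐ x, f x = 0 := ae_of_ae_vol (hp.map fun y => y = 0) h
  exact Measure.eq_of_ae_eq (μ := (volume : Measure (E d))) h1 hf continuous_const

/-- If Z were positive at some point, a bump centred near its image and pulled back through `Φ`
would live where Z > 0, because the inverse of `Φ` is Lipschitz. The nonnegative continuous
integrand would then vanish identically although it is positive at that point. Centres range over a
dense sequence, so the family is countable and almost sure statements can be combined. -/
theorem eq_zero_of_forall_bumpFn_integral {D : Domain} {Φ : E d → E d} (hΦc : Continuous Φ)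
    (hΦ : IsOn D fun x => Φ x - x) {L : ℝ} (hL0 : 0 ≤ L)
    (hL : ∀ x y, ‖x - y‖ ≤ L * ‖Φ x - Φ y‖) {Z : E d → ℝ}
    (hZ : Continuous Z) (hZp : IsOn D Z) {q : ℕ → E d} (hq : DenseRange q)
    (hi : ∀ n m, Integrable (fun x => bumpFn D n (q m) (Φ x) * Z x) (vol d D))
    (h0 : ∀ n m, ∫ x, bumpFn D n (q m) (Φ x) * Z x ∂(vol d D) = 0) : Z = 0 := by
  have key : ∀ Z : E d → ℝ, Continuous Z → IsOn D Z →
      (∀ n m, Integrable (fun x => bumpFn D n (q m) (Φ x) * Z x) (vol d D)) →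
      (∀ n m, ∫ x, bumpFn D n (q m) (Φ x) * Z x ∂(vol d D) = 0) → ∀ x, ¬ 0 < Z x := by
    intro Z hZ hZp hi h0 x₀ hpos
    obtain ⟨δ, hδ, hball⟩ := Metric.isOpen_iff.1 (isOpen_lt continuous_const hZ) x₀ hpos
    -- Two image points within ρ of the centre differ by at most 2ρ, and the inverse map stretches
    -- this to at most 2Lρ < δ.
    set ρ : ℝ := δ / (2 * (L + 1)) with hρ
    have hρ0 : 0 < ρ := by positivity
    obtain ⟨n, hn⟩ := exists_nat_gt (2 / ρ ^ 2)
    have hn' : 2 < ((n : ℝ) + 1) * ρ ^ 2 := by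
      rw [div_lt_iff₀ (by positivity)] at hn
      nlinarith [sq_nonneg ρ]
    -- The first bound places the centre close enough for the support; the second makes the bump
    -- equal to 1 at `Φ x₀`, the factor 10 coming from `gauge_le`.
    set σ : ℝ := min ρ (1 / (10 * ((n : ℝ) + 1))) with hσ
    have hσ0 : 0 < σ := by positivity
    obtain ⟨m, hm⟩ := hq.exists_dist_lt (Φ x₀) hσ0
    rw [dist_eq_norm] at hm
    have hnear : ∀ x, bumpFn D n (q m) (Φ x) ≠ 0 → 0 < Z x := by
      intro x hx
      obtain ⟨k, hk, hlt⟩ := exists_lattice_of_bumpFn_ne_zero hx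
      rw [← hZp.sub_lattice hk x]
      refine hball ?_
      rw [mem_ball_iff_norm]
      have h1 : ‖Φ x - q m - k‖ < ρ := by
        have h2 : ((n : ℝ) + 1) * ‖Φ x - q m - k‖ ^ 2 < ((n : ℝ) + 1) * ρ ^ 2 := hlt.trans hn'
        exact lt_of_pow_lt_pow_left₀ 2 hρ0.le (lt_of_mul_lt_mul_left h2 (by positivity))
      have h3 : Φ (x - k) = Φ x - k := by
        have := hΦ.sub_lattice hk x
        have h4 : Φ (x - k) = (Φ x - x) + (x - k) := by rw [← this]; abel
        rw [h4]; abel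
      have h5 : ‖Φ (x - k) - Φ x₀‖ < 2 * ρ := by
        have h6 : Φ (x - k) - Φ x₀ = (Φ x - q m - k) - (Φ x₀ - q m) := by rw [h3]; abel
        rw [h6]
        refine (norm_sub_le _ _).trans_lt ?_
        linarith [hm.trans_le (min_le_left _ _)]
      have h7 : L * (2 * ρ) < δ := by
        rw [hρ]
        have : L * (2 * (δ / (2 * (L + 1)))) = δ * (L / (L + 1)) := by field_simp
        rw [this]
        have : L / (L + 1) < 1 := (div_lt_one (by positivity)).2 (by linarith)
        nlinarith
      exact ((hL _ _).trans (mul_le_mul_of_nonneg_left h5.le hL0)).trans_lt h7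
    have hnn : ∀ x, 0 ≤ bumpFn D n (q m) (Φ x) * Z x := by
      intro x
      by_cases hx : bumpFn D n (q m) (Φ x) = 0
      · simp [hx]
      · exact mul_nonneg (bumpFn_nonneg _ _ _ _) (hnear x hx).le
    have hb := isTest_bumpFn D n (q m)
    have hz : (fun x => bumpFn D n (q m) (Φ x) * Z x) = 0 := by
      refine eq_zero_of_ae_vol (D := D) ((hb.1.continuous.comp hΦc).mul hZ)
        ((hb.2.1.comp_of_sub_id hΦ).map₂ hZp fun a b => a * b)
        ((integral_eq_zero_iff_of_nonneg hnn (hi n m)).1 (h0 n m))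
    have h1 := congrFun hz x₀
    simp only [Pi.zero_apply] at h1
    rw [bumpFn_eq_one, one_mul] at h1
    · exact hpos.ne' h1
    · have h2 : gauge D (Φ x₀ - q m) ≤ 10 * ‖Φ x₀ - q m‖ ^ 2 := gauge_le _ _
      have h3 : ‖Φ x₀ - q m‖ ≤ 1 / (10 * ((n : ℝ) + 1)) := hm.le.trans (min_le_right _ _)
      have hn0 : (0 : ℝ) ≤ n := Nat.cast_nonneg n
      have h4 : ‖Φ x₀ - q m‖ ^ 2 ≤ (1 / (10 * ((n : ℝ) + 1))) ^ 2 :=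
        pow_le_pow_left₀ (norm_nonneg _) h3 2
      calc ((n : ℝ) + 1) * gauge D (Φ x₀ - q m)
          ≤ ((n : ℝ) + 1) * (10 * (1 / (10 * ((n : ℝ) + 1))) ^ 2) := by gcongr; linarith
        _ = 1 / (10 * ((n : ℝ) + 1)) := by field_simp
        _ ≤ 1 := by rw [div_le_one (by positivity)]; linarith
  ext1 x
  refine le_antisymm (not_lt.1 (key Z hZ hZp hi h0 x)) ?_
  have h1 := key (-Z) hZ.neg (hZp.map fun a => -a) (fun n m => by simpa using (hi n m).neg)
    (fun n m => by simp [integral_neg, h0 n m]) x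
  simpa using h1

end Positivity

end Kelvin

end

/-! ### Continuity of the kinetic term, and the kinematic defect. -/

noncomputable section

namespace Kelvin

variable {d : ℕ}

section Quadratic

variable {D : Domain} {r T : ℝ} {S : (E d → E d) → Lp (E d) 2 (vol d D)} {u : ℝ → E d → E d}

theorem MemSob.memLp {f : E d → E d} (hf : MemSob D r f) (hr : 1 + (d : ℝ) / 2 < r) :
    MemLp f 2 (vol d D) :=
  ⟨(hf.contDiff hr).continuous.aestronglyMeasurable,
    (hf.eLpNorm_le hr).trans_lt (ENNReal.mul_lt_top
      (ENNReal.add_lt_top.2 ⟨ENNReal.one_lt_top, sobConst_lt_top D hr⟩) hf)⟩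

theorem MeanFree.sub {v w : E d → E d} (hv : MeanFree D v) (hw : MeanFree D w)
    (hvi : Integrable v (vol d D)) (hwi : Integrable w (vol d D)) : MeanFree D (v - w) := by
  cases D
  · trivial
  · simp only [MeanFree, Pi.sub_apply] at *
    rw [integral_sub hvi hwi, hv, hw, sub_zero]

theorem MeanFree.sub_of_memSob {v w : E d → E d} (hv : MeanFree D v) (hw : MeanFree D w)
    (hvs : MemSob D r v) (hws : MemSob D r w) (hr : 1 + (d : ℝ) / 2 < r) : MeanFree D (v - w) := by
  cases D
  · trivial
  · exact hv.sub hw ((hvs.memLp hr).integrable (by norm_num))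
      ((hws.memLp hr).integrable (by norm_num))

/-- The class of a square integrable field (zero for other fields). -/
def toL2 (D : Domain) (f : E d → E d) : Lp (E d) 2 (vol d D) :=
  open Classical in if h : MemLp f 2 (vol d D) then h.toLp f else 0

theorem pairL2_eq_inner (g : Lp (E d) 2 (vol d D)) {f : E d → E d} (hf : MemLp f 2 (vol d D)) :
    pairL2 D g f = ⟪g, toL2 D f⟫_ℝ := by
  rw [toL2, dif_pos hf, L2.inner_def, pairL2]
  refine integral_congr_ae ?_
  filter_upwards [hf.coeFn_toLp] with x hx
  rw [hx]

/-- Continuity makes the kinetic term integrable in time, so that it splits off the action as a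
constant when the flow or the momentum is varied. -/
theorem continuousOn_quadratic (hS : IsInertia D r S) (hu : IsVelocity D r T u)
    (hr : 1 + (d : ℝ) / 2 < r) :
    ContinuousOn (fun t => pairL2 D (S (u t)) (u t)) (Icc 0 T) := by
  have hm : ∀ t ∈ Icc 0 T, MemSob D r (u t) := fun t ht => (hu.1 t ht).1
  have hf : ∀ t ∈ Icc 0 T, MeanFree D (u t) := fun t ht => (hu.2 t ht).2.1
  obtain ⟨C, hC⟩ := hS.bounded
  have h1 : ContinuousOn (fun t => S (u t)) (Icc 0 T) := by
    intro t ht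
    refine tendsto_of_enorm_sub_le (K := C) ENNReal.coe_lt_top (hu.1 t ht).2 ?_
    filter_upwards [(hu.1 t ht).2.eventually (gt_mem_nhds ENNReal.zero_lt_top),
      self_mem_nhdsWithin] with τ hτ hτI
    have hdf := (hf τ hτI).sub_of_memSob (hf t ht) (hm τ hτI) (hm t ht) hr
    have h2 := hS.map_add (u τ - u t) (u t) hτ hdf (hm t ht) (hf t ht)
    rw [sub_add_cancel] at h2
    rw [h2, add_sub_cancel_right]
    exact hC _ hτ hdf
  have h2 : ContinuousOn (fun t => toL2 D (u t)) (Icc 0 T) := by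
    intro t ht
    refine tendsto_of_enorm_sub_le (K := 1 + sobConst d D r)
      (ENNReal.add_lt_top.2 ⟨ENNReal.one_lt_top, sobConst_lt_top D hr⟩) (hu.1 t ht).2 ?_
    filter_upwards [(hu.1 t ht).2.eventually (gt_mem_nhds ENNReal.zero_lt_top),
      self_mem_nhdsWithin] with τ hτ hτI
    have h3 : MemSob D r (u τ - u t) := hτ
    rw [toL2, toL2, dif_pos ((hm τ hτI).memLp hr), dif_pos ((hm t ht).memLp hr),
      ← MemLp.toLp_sub, Lp.enorm_toLp]
    exact h3.eLpNorm_le hr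
  refine (h1.inner h2 (𝕜 := ℝ)).congr fun t ht => ?_
  exact pairL2_eq_inner _ ((hm t ht).memLp hr)

end Quadratic

section System

variable {Ω : Type*} [MeasurableSpace Ω] {P : Measure Ω}
  {D : Domain} {T Cu C : ℝ} {u : ℝ → E d → E d} {X : Ω → ℝ → E d → E d} {b : Ω → ℝ → E d}

/-- A random flow `X` in a bounded velocity field `u`, with noise `b`. -/
structure IsFlowSystem (D : Domain) (T Cu C : ℝ) (P : Measure Ω) (u : ℝ → E d → E d)
    (X : Ω → ℝ → E d → E d) (b : Ω → ℝ → E d) : Prop where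
  pos : 0 < T
  Cu_nonneg : 0 ≤ Cu
  C_nonneg : 0 ≤ C
  vel : IsBddVelocity D T Cu u
  meas : ∀ t ∈ Icc 0 T, ∀ x, AEStronglyMeasurable (fun ω => X ω t x) P
  flow : ∀ᵐ ω ∂P, IsBddFlow D T C (X ω)
  noise_meas : ∀ t ∈ Icc 0 T, AEStronglyMeasurable (fun ω => b ω t) P
  noise_cont : ∀ᵐ ω ∂P, ContinuousOn (b ω) (Icc 0 T)

/-- The defect `Ẋ_t - u_t(X_t + b_t)`. -/
def defect (T : ℝ) (u : ℝ → E d → E d) (X : Ω → ℝ → E d → E d) (b : Ω → ℝ → E d) (ω : Ω)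
    (t : ℝ) (x : E d) : E d :=
  timeDeriv T (X ω) t x - u t (X ω t x + b ω t)

theorem IsFlowSystem.ae_continuousOn_noisy (h : IsFlowSystem D T Cu C P u X b) :
    ∀ᵐ ω ∂P, ContinuousOn (fun z : ℝ × E d => X ω z.1 z.2 + b ω z.1) (Icc 0 T ×ˢ univ) := by
  filter_upwards [h.flow, h.noise_cont] with ω h1 h2
  exact h1.continuousOn_noisy h2

theorem IsFlowSystem.ae_continuousOn_comp {V : Type*} [TopologicalSpace V]
    (h : IsFlowSystem D T Cu C P u X b) {f : ℝ → E d → V}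
    (hf : ContinuousOn (fun z : ℝ × E d => f z.1 z.2) (Icc 0 T ×ˢ univ)) :
    ∀ᵐ ω ∂P, ContinuousOn (fun z : ℝ × E d => f z.1 (X ω z.1 z.2 + b ω z.1))
      (Icc 0 T ×ˢ univ) := by
  filter_upwards [h.ae_continuousOn_noisy] with ω h2
  exact continuousOn_comp_noisy (f := f) (Y := fun t x => X ω t x + b ω t) hf h2

theorem IsFlowSystem.meas_comp {V : Type*} [NormedAddCommGroup V]
    (h : IsFlowSystem D T Cu C P u X b) {f : ℝ → E d → V}
    (hf : ContinuousOn (fun z : ℝ × E d => f z.1 z.2) (Icc 0 T ×ˢ univ)) {t : ℝ}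
    (ht : t ∈ Icc 0 T) (x : E d) :
    AEStronglyMeasurable (fun ω => f t (X ω t x + b ω t)) P :=
  (continuous_slice hf ht).comp_aestronglyMeasurable ((h.meas t ht x).add (h.noise_meas t ht))

theorem IsFlowSystem.meas_deriv (h : IsFlowSystem D T Cu C P u X b) {t : ℝ}
    (ht : t ∈ Icc 0 T) (x : E d) :
    AEStronglyMeasurable (fun ω => timeDeriv T (X ω) t x) P :=
  aestronglyMeasurable_timeDeriv h.pos h.meas (h.flow.mono fun _ h => h.regular) ht x

theorem IsFlowSystem.meas_defect (h : IsFlowSystem D T Cu C P u X b) {t : ℝ}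
    (ht : t ∈ Icc 0 T) (x : E d) :
    AEStronglyMeasurable (fun ω => defect T u X b ω t x) P :=
  (h.meas_deriv ht x).sub (h.meas_comp h.vel.cont ht x)

theorem IsFlowSystem.cont_defect (h : IsFlowSystem D T Cu C P u X b) :
    ∀ᵐ ω ∂P, ContinuousOn (fun z : ℝ × E d => defect T u X b ω z.1 z.2) (Icc 0 T ×ˢ univ) := by
  filter_upwards [h.flow, h.ae_continuousOn_comp h.vel.cont] with ω h1 h2
  exact h1.regular.cont'.sub h2

theorem IsFlowSystem.norm_defect_le (h : IsFlowSystem D T Cu C P u X b) :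
    ∀ᵐ ω ∂P, ∀ t ∈ Icc 0 T, ∀ x, ‖defect T u X b ω t x‖ ≤ C + Cu := by
  filter_upwards [h.flow] with ω h1 t ht x
  exact (norm_sub_le _ _).trans (add_le_add
    (norm_le_of_strongNorm_le (h1.deriv_strong_le t ht) h.C_nonneg _)
    (norm_le_of_strongNorm_le (h.vel.strong_le t ht) h.Cu_nonneg _))

theorem IsFlowSystem.exists_eLpNorm_defect_le (h : IsFlowSystem D T Cu C P u X b) :
    ∃ K : ℝ≥0∞, K < ∞ ∧ ∀ᵐ ω ∂P, ∀ t ∈ Icc 0 T, eLpNorm (defect T u X b ω t) 2 (vol d D) ≤ K := by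
  obtain ⟨K, hK0, hK⟩ := exists_abs_det_le d C
  refine ⟨ENNReal.ofReal C + (1 + ENNReal.ofReal K ^ (1 / 2 : ℝ)) * ENNReal.ofReal Cu, ?_, ?_⟩
  · refine ENNReal.add_lt_top.2 ⟨ENNReal.ofReal_lt_top, ENNReal.mul_lt_top
      (ENNReal.add_lt_top.2 ⟨ENNReal.one_lt_top, ?_⟩) ENNReal.ofReal_lt_top⟩
    exact ENNReal.rpow_lt_top_of_nonneg (by norm_num) ENNReal.ofReal_ne_top
  · filter_upwards [h.flow, h.ae_continuousOn_comp h.vel.cont] with ω h1 h2 t ht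
    have h3 : Continuous fun x => u t (X ω t x + b ω t) :=
      continuous_slice (f := fun t x => u t (X ω t x + b ω t)) h2 ht
    have h4 : defect T u X b ω t = timeDeriv T (X ω) t - fun x => u t (X ω t x + b ω t) := rfl
    rw [h4]
    refine (eLpNorm_sub_le (continuous_slice h1.regular.cont' ht).aestronglyMeasurable
      h3.aestronglyMeasurable (by norm_num)).trans (add_le_add ?_ ?_)
    · exact eLpNorm_le_of_strongNorm_le (h1.deriv_strong_le t ht)
    · exact h1.eLpNorm_comp_le h.vel h.Cu_nonneg hK ht

variable [IsProbabilityMeasure P]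

/-- Cauchy-Schwarz in space: the momentum has an L² norm integrable in ω, and that of the defect is
bounded by a constant. -/
theorem IsFlowSystem.integrable_inner_defect (h : IsFlowSystem D T Cu C P u X b) {r : ℝ}
    (hr : 1 + (d : ℝ) / 2 < r) {ξ : Ω → ℝ → E d → E d} (hξ : IsMomentum D r T P ξ) :
    Integrable (fun z : ℝ × (Ω × E d) => ⟪ξ z.2.1 z.1 z.2.2, defect T u X b z.2.1 z.1 z.2.2⟫_ℝ)
      (tripleMeasure D T P) := by
  obtain ⟨R, hR, hξb⟩ := hξ.exists_isBddMomentum hr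
  obtain ⟨K, hK, hYb⟩ := h.exists_eLpNorm_defect_le
  refine integrable_triple_of_le (f := fun ω t x => ⟪ξ ω t x, defect T u X b ω t x⟫_ℝ) ?_
    (k := fun ω => ENNReal.ofReal (R ω) * K) ?_ ?_
  · exact (aestronglyMeasurable_triple h.pos.le (fun t ht x => hξ.aestronglyMeasurable ht x)
      (hξb.mono fun ω hω => hω.regular.cont)).inner
      (aestronglyMeasurable_triple h.pos.le (fun t ht x => h.meas_defect ht x) h.cont_defect)
  · rw [lintegral_mul_const' _ _ hK.ne]
    exact ENNReal.mul_lt_top (hR.integrable (by norm_num)).lintegral_lt_top hK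
  · filter_upwards [hξb, hYb, h.cont_defect] with ω h1 h2 h3 t ht
    refine (lintegral_enorm_inner_le (continuous_slice h1.regular.cont ht).aestronglyMeasurable
      (continuous_slice h3 ht).aestronglyMeasurable).trans ?_
    exact mul_le_mul' (eLpNorm_le_of_strongNorm_le (h1.strong_le t ht)) (h2 t ht)

/-- One integral over dt ⊗ P ⊗ dx replaces the iterated integrals of `action`, so that the variation
needs a single dominated convergence argument. -/
theorem integral_add_triple {q : ℝ → ℝ} (hT : 0 ≤ T) (hq : ContinuousOn q (Icc 0 T))
    {f : Ω → ℝ → E d → ℝ}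
    (hf : Integrable (fun z : ℝ × (Ω × E d) => f z.2.1 z.1 z.2.2) (tripleMeasure D T P)) :
    ∫ t in (0 : ℝ)..T, (q t + ∫ ω, ∫ x, f ω t x ∂(vol d D) ∂P) =
      (∫ t in (0 : ℝ)..T, q t) + ∫ z, f z.2.1 z.1 z.2.2 ∂(tripleMeasure D T P) := by
  rw [integral_triple_eq hf]
  have h1 : IntervalIntegrable q volume 0 T := by
    refine ContinuousOn.intervalIntegrable ?_
    rwa [uIcc_of_le hT]
  have h2 : Integrable (fun t => ∫ ω, ∫ x, f ω t x ∂(vol d D) ∂P) (timeMeasure T) := by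
    unfold tripleMeasure at hf
    refine hf.integral_prod_left.congr ?_
    filter_upwards [hf.prod_right_ae] with t ht
    rw [integral_prod _ ht]
  have h3 : IntervalIntegrable (fun t => ∫ ω, ∫ x, f ω t x ∂(vol d D) ∂P) volume 0 T :=
    (intervalIntegrable_iff_integrableOn_Ioc_of_le hT).2 h2
  rw [intervalIntegral.integral_add h1 h3]
  congr 1
  rw [intervalIntegral.integral_of_le hT, timeMeasure]

end System

/-! ### Separable momenta as admissible directions. -/

section Separable

theorem sobNorm_separable_tendsto {D : Domain} {r : ℝ} {φ : E d → E d}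
    (hφ : MemSob D r φ) {l : Filter ℝ} {c : ℝ → ℝ} (hc : Tendsto c l (𝓝 0)) :
    Tendsto (fun τ => sobNorm D r (c τ • φ)) l (𝓝 0) := by
  have h1 : Tendsto (fun τ => ‖c τ‖ₑ * sobNorm D r φ) l (𝓝 0) := by
    have h2 : Tendsto (fun τ => ‖c τ‖ₑ) l (𝓝 0) := by simpa using hc.enorm
    simpa using ENNReal.Tendsto.mul_const h2 (Or.inr (ne_of_lt hφ))
  exact tendsto_of_tendsto_of_tendsto_of_le_of_le tendsto_const_nhds h1 (fun _ => zero_le)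
    fun τ => sobNorm_smul_le D r (c τ) hφ

theorem contSob_separable {D : Domain} {r T : ℝ} {φ : E d → E d}
    (hφ : MemSob D r φ) {θ : ℝ → ℝ} (hθ : Continuous θ) :
    ContSob D r T fun t x => θ t • φ x := by
  intro t ht
  refine ⟨hφ.const_smul (θ t), ?_⟩
  have h1 : ∀ τ, ((fun x => θ τ • φ x) - fun x => θ t • φ x) = (θ τ - θ t) • φ := by
    intro τ; ext1 x; simp [sub_smul]
  simp only [h1]
  refine sobNorm_separable_tendsto hφ ?_
  have := (hθ.tendsto t).sub_const (θ t)
  rw [sub_self] at this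
  exact this.mono_left nhdsWithin_le_nhds

theorem timeDeriv_separable {T : ℝ} (hT : 0 < T) {θ : ℝ → ℝ} (hθ : Differentiable ℝ θ)
    (φ : E d → E d) {t : ℝ} (ht : t ∈ Icc 0 T) :
    timeDeriv T (fun t x => θ t • φ x) t = fun x => deriv θ t • φ x := by
  ext1 x
  exact ((hθ t).hasDerivAt.smul_const (φ x)).hasDerivWithinAt.derivWithin
    (uniqueDiffOn_Icc hT t ht)

theorem c1Sob_separable {D : Domain} {r T : ℝ} (hT : 0 < T)
    {φ : E d → E d} (hφ : MemSob D r φ) {θ : ℝ → ℝ} (hθ : ContDiff ℝ 1 θ) :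
    C1Sob D r T fun t x => θ t • φ x := by
  have hd := hθ.differentiable (by norm_num)
  have hdc : Continuous (deriv θ) := hθ.continuous_deriv (by norm_num)
  refine ⟨contSob_separable hφ hθ.continuous, ?_, ?_⟩
  · have h := contSob_separable (T := T) hφ hdc
    intro t ht
    rw [timeDeriv_separable hT hd φ ht]
    refine ⟨(h t ht).1, (h t ht).2.congr' ?_⟩
    filter_upwards [self_mem_nhdsWithin] with τ hτ
    rw [timeDeriv_separable hT hd φ hτ]
  · intro t ht
    rw [timeDeriv_separable hT hd φ ht]
    have h1 : ∀ τ, ((τ - t)⁻¹ • ((fun x => θ τ • φ x) - fun x => θ t • φ x) -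
        fun x => deriv θ t • φ x) = (slope θ t τ - deriv θ t) • φ := by
      intro τ; ext1 x; simp [sub_smul, slope, smul_smul, mul_sub, smul_sub]
    simp only [h1]
    refine sobNorm_separable_tendsto hφ ?_
    have := (hasDerivAt_iff_tendsto_slope.1 (hd t).hasDerivAt).sub_const (deriv θ t)
    rw [sub_self] at this
    exact this.mono_left (nhdsWithin_mono _ fun x hx => hx.2)

variable {Ω : Type*} [MeasurableSpace Ω] {P : Measure Ω} [IsProbabilityMeasure P]

/-- Products of an event, a time profile and a Sobolev field are admissible directions, and they are
all that the localisation in ω, t and x requires. -/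
theorem isMomentum_separable {D : Domain} {r T : ℝ} (hT : 0 < T)
    {φ : E d → E d} (hφ : MemSob D r φ) {θ : ℝ → ℝ} (hθ : ContDiff ℝ 1 θ)
    {A : Set Ω} (hA : MeasurableSet A) :
    IsMomentum D r T P fun ω t x => ((A.indicator 1 ω : ℝ) * θ t) • φ x where
  meas t ht x := (((measurable_const.indicator hA).mul_const _).smul_const _).aemeasurable
  path := Eventually.of_forall fun ω => c1Sob_separable hT hφ (contDiff_const.mul hθ)
  bound := by
    have hdc : Continuous (deriv θ) := hθ.continuous_deriv (by norm_num)
    obtain ⟨M, hM⟩ := (isCompact_Icc (a := (0 : ℝ)) (b := T)).exists_bound_of_continuousOn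
      hθ.continuous.continuousOn
    obtain ⟨M', hM'⟩ := (isCompact_Icc (a := (0 : ℝ)) (b := T)).exists_bound_of_continuousOn
      hdc.continuousOn
    have h0 : (0 : ℝ) ∈ Icc 0 T := left_mem_Icc.2 hT.le
    have hM0 : 0 ≤ M := (norm_nonneg _).trans (hM 0 h0)
    have hM0' : 0 ≤ M' := (norm_nonneg _).trans (hM' 0 h0)
    refine ⟨fun _ => M * (sobNorm D r φ).toReal + M' * (sobNorm D r φ).toReal,
      memLp_const _, Eventually.of_forall fun ω t ht => ?_⟩
    have h1 : ‖(A.indicator 1 ω : ℝ)‖ ≤ 1 := by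
      by_cases hω : ω ∈ A <;> simp [hω]
    have key : ∀ c N : ℝ, ‖c‖ ≤ N → sobNorm D r (c • φ) ≤ ENNReal.ofReal (N * (sobNorm D r φ).toReal) := by
      intro c N hc
      refine (sobNorm_smul_le D r c hφ).trans ?_
      rw [ENNReal.ofReal_mul ((norm_nonneg _).trans hc), ENNReal.ofReal_toReal (ne_of_lt hφ),
        ← ofReal_norm]
      gcongr
    have h2 : timeDeriv T (fun t x => ((A.indicator 1 ω : ℝ) * θ t) • φ x) t =
        ((A.indicator 1 ω : ℝ) * deriv θ t) • φ := by
      rw [timeDeriv_separable hT (θ := fun t => (A.indicator 1 ω : ℝ) * θ t)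
        ((hθ.differentiable (by norm_num)).const_mul _) φ ht]
      ext1 x
      rw [deriv_const_mul _ (hθ.differentiable (by norm_num) t)]
      rfl
    rw [h2, ENNReal.ofReal_add (by positivity) (by positivity)]
    refine add_le_add (key _ M ?_) (key _ M' ?_)
    · rw [norm_mul]
      exact (mul_le_mul h1 (hM t ht) (norm_nonneg _) zero_le_one).trans_eq (one_mul _)
    · rw [norm_mul]
      exact (mul_le_mul h1 (hM' t ht) (norm_nonneg _) zero_le_one).trans_eq (one_mul _)

end Separable

end Kelvin

end

/-! ### The kinematic equation. -/

noncomputable section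

namespace Kelvin

variable {d : ℕ}

section KinematicEquation

theorem IsBddFlow.isOn_noisy {D : Domain} {T C : ℝ} {X : ℝ → E d → E d} (hX : IsBddFlow D T C X)
    {t : ℝ} (ht : t ∈ Icc 0 T) (c : E d) : IsOn D fun x => X t x + c - x := by
  have h := (hX.isOn t ht).map fun v => v + c
  have h1 : (fun x => X t x - x + c) = fun x => X t x + c - x := by
    ext1 x; rw [add_sub_right_comm]
  rwa [h1] at h

variable {Ω : Type*} [MeasurableSpace Ω] {P : Measure Ω}
  {D : Domain} {T Cu C : ℝ} {u : ℝ → E d → E d} {X : Ω → ℝ → E d → E d} {b : Ω → ℝ → E d}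

theorem inner_basisVec_right (v : E d) (i : Fin d) : ⟪v, basisVec i⟫_ℝ = v i := by
  simp [basisVec, EuclideanSpace.inner_single_right]

theorem inner_basisVec_left (v : E d) (i : Fin d) : ⟪basisVec i, v⟫_ℝ = v i := by
  simp [basisVec, EuclideanSpace.inner_single_left]


theorem IsFlowSystem.ae_isOn_defect (h : IsFlowSystem D T Cu C P u X b) :
    ∀ᵐ ω ∂P, ∀ t ∈ Icc 0 T, IsOn D (defect T u X b ω t) := by
  filter_upwards [h.flow] with ω h1 t ht
  exact (h1.isOn' t ht).map₂ ((h.vel.isOn t ht).comp_of_sub_id (h1.isOn_noisy ht (b ω t)))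
    fun v w => v - w

variable [IsProbabilityMeasure P]

theorem IsFlowSystem.ae_integral_inner_defect (h : IsFlowSystem D T Cu C P u X b) {r : ℝ}
    (h0 : ∀ δξ, IsMomentum D r T P δξ →
      ∫ z, ⟪δξ z.2.1 z.1 z.2.2, defect T u X b z.2.1 z.1 z.2.2⟫_ℝ ∂(tripleMeasure D T P) = 0)
    {φ : E d → E d} (hφ : MemSob D r φ) (hφi : Integrable φ (vol d D)) (hφc : Continuous φ) :
    ∀ᵐ ω ∂P, ∀ t ∈ Icc 0 T, ∫ x, ⟪φ x, defect T u X b ω t x⟫_ℝ ∂(vol d D) = 0 := by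
  refine ae_integral_eq_zero_of_forall_test h.pos (g := fun ω t x => ⟪φ x, defect T u X b ω t x⟫_ℝ)
    (fun t ht x => aestronglyMeasurable_const.inner (h.meas_defect ht x)) ?_
    (R := fun _ => C + Cu) (integrable_const _) (k := fun x => ‖φ x‖) hφi.norm ?_ ?_
  · filter_upwards [h.cont_defect] with ω hω
    exact (hφc.comp continuous_snd).continuousOn.inner hω
  · filter_upwards [h.norm_defect_le] with ω hω t ht x
    refine (norm_inner_le_norm _ _).trans ?_
    rw [mul_comm]
    gcongr
    exact hω t ht x
  · intro A hA θ hθ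
    rw [← h0 _ (isMomentum_separable h.pos hφ (hθ.1.of_le (mod_cast le_top)) hA)]
    refine integral_congr_ae (Eventually.of_forall fun z => ?_)
    simp only [real_inner_smul_left, mul_assoc]

/-- The spatial test fields must be known to lie in `H^r`. These are smooth bumps on the whole space
and trigonometric monomials on the torus, where finitely many coefficients make membership evident.
Both families are countable. -/
theorem IsFlowSystem.ae_defect_eq_zero (h : IsFlowSystem D T Cu C P u X b) {r : ℝ}
    (hr : 1 + (d : ℝ) / 2 < r)
    (h0 : ∀ δξ, IsMomentum D r T P δξ →
      ∫ z, ⟪δξ z.2.1 z.1 z.2.2, defect T u X b z.2.1 z.1 z.2.2⟫_ℝ ∂(tripleMeasure D T P) = 0) :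
    ∀ᵐ ω ∂P, ∀ t ∈ Icc 0 T, ∀ x, defect T u X b ω t x = 0 := by
  cases D
  · let q := TopologicalSpace.denseSeq (E d)
    have htest : ∀ n m i, ContDiff ℝ (⊤ : ℕ∞) (fun x : E d => bumpFn .space n (q m) x • basisVec i) ∧
        HasCompactSupport fun x : E d => bumpFn .space n (q m) x • (basisVec i : E d) := fun n m i =>
      ⟨(isTest_bumpFn .space n (q m)).1.smul contDiff_const,
        (isTest_bumpFn .space n (q m)).2.2.smul_right⟩
    have h1 : ∀ n m i, ∀ᵐ ω ∂P, ∀ t ∈ Icc 0 T,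
        ∫ x, ⟪bumpFn .space n (q m) x • basisVec i, defect T u X b ω t x⟫_ℝ ∂(vol d .space) = 0 :=
      fun n m i => h.ae_integral_inner_defect h0
        (memSob_space_of_contDiff (htest n m i).1 (htest n m i).2 r)
        ((htest n m i).1.continuous.integrable_of_hasCompactSupport (htest n m i).2).restrict
        (htest n m i).1.continuous
    filter_upwards [ae_all_iff.2 fun n => ae_all_iff.2 fun m => ae_all_iff.2 fun i => h1 n m i,
      h.cont_defect] with ω hω hc t ht x
    have hct : Continuous (defect T u X b ω t) := continuous_slice hc ht
    ext i
    have hci : Continuous fun x => defect T u X b ω t x i := by fun_prop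
    have := eq_zero_of_forall_bumpFn_integral (D := .space) (Φ := id) continuous_id trivial
      zero_le_one (fun x y => by simp) (Z := fun x => defect T u X b ω t x i)
      hci trivial (TopologicalSpace.denseRange_denseSeq (E d))
      (fun n m => (((isTest_bumpFn .space n (q m)).1.continuous.mul
        hci).integrable_of_hasCompactSupport (isTest_bumpFn .space n (q m)).2.2.mul_right).restrict)
      (fun n m => by
        rw [← hω n m i t ht]
        simp only [real_inner_smul_left, inner_basisVec_left]
        rfl)
    exact congrFun this x
  · have h1 : ∀ (n : Fin d → ℤ) (c : ℂ) (i : Fin d), ∀ᵐ ω ∂P, ∀ t ∈ Icc 0 T,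
        ∫ x, ⟪(c * Complex.exp (2 * Real.pi * Complex.I * (⟪(intPoint n : E d), x⟫_ℝ : ℝ))).re •
          basisVec i, defect T u X b ω t x⟫_ℝ ∂(vol d .torus) = 0 := by
      intro n c i
      have hm := memSob_trig n c i r
      exact h.ae_integral_inner_defect h0 hm ((hm.memLp hr).integrable (by norm_num))
        (hm.contDiff hr).continuous
    -- The amplitudes c = 1 and c = -i of the monomials produce the cosine and the sine.
    have hcos : ∀ a : ℝ, (1 * Complex.exp (2 * Real.pi * Complex.I * (a : ℝ))).re =
        Real.cos (2 * Real.pi * a) := by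
      intro a
      rw [one_mul, show (2 * Real.pi * Complex.I * (a : ℝ) : ℂ) =
        ((2 * Real.pi * a : ℝ) : ℂ) * Complex.I by push_cast; ring, Complex.exp_ofReal_mul_I_re]
    have hsin : ∀ a : ℝ, (-Complex.I * Complex.exp (2 * Real.pi * Complex.I * (a : ℝ))).re =
        Real.sin (2 * Real.pi * a) := by
      intro a
      rw [show (2 * Real.pi * Complex.I * (a : ℝ) : ℂ) =
        ((2 * Real.pi * a : ℝ) : ℂ) * Complex.I by push_cast; ring, Complex.mul_re,
        Complex.exp_ofReal_mul_I_im]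
      simp
    filter_upwards [ae_all_iff.2 fun n => ae_all_iff.2 fun i => h1 n 1 i,
      ae_all_iff.2 fun n => ae_all_iff.2 fun i => h1 n (-Complex.I) i,
      h.cont_defect, h.ae_isOn_defect] with ω hω1 hω2 hc hp t ht x
    have hct : Continuous (defect T u X b ω t) := continuous_slice hc ht
    ext i
    have hci : Continuous fun x => defect T u X b ω t x i := by fun_prop
    have := eq_zero_of_trig_integral_eq_zero hci ((hp t ht).map fun v => v i)
      (fun n => by
        rw [← hω1 n i t ht]
        simp only [real_inner_smul_left, inner_basisVec_left, hcos])
      (fun n => by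
        rw [← hω2 n i t ht]
        simp only [real_inner_smul_left, inner_basisVec_left, hsin])
    exact congrFun this x

end KinematicEquation

end Kelvin

end

/-! ### Test fields and admissible perturbations of the flow. -/

noncomputable section

namespace Kelvin

variable {d : ℕ}

section TestFields

variable {V : Type*} [NormedAddCommGroup V]

/-- Every point is a lattice translate of a point of a fixed ball on the torus. -/
theorem exists_lattice_norm_le (x : E d) :
    ∃ k : Fin d → ℤ, ‖x - intPoint k‖ ≤ Real.sqrt d := by
  refine ⟨fun i => ⌊x i⌋, ?_⟩
  rw [EuclideanSpace.norm_eq]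
  refine Real.sqrt_le_sqrt ?_
  calc ∑ i, ‖(x - intPoint fun i => ⌊x i⌋) i‖ ^ 2 ≤ ∑ _i : Fin d, (1 : ℝ) := by
        refine Finset.sum_le_sum fun i _ => ?_
        have h1 : (x - intPoint fun i => ⌊x i⌋) i = Int.fract (x i) := rfl
        rw [h1, Real.norm_of_nonneg (Int.fract_nonneg _)]
        exact pow_le_one₀ (Int.fract_nonneg _) (Int.fract_lt_one _).le
    _ = d := by simp

theorem exists_bound_of_continuous {D : Domain} {f : E d → V} (hf : Continuous f) (hp : IsOn D f)
    (hs : HasCompactSupp D f) : ∃ M, 0 ≤ M ∧ ∀ x, ‖f x‖ ≤ M := by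
  suffices h : ∃ M, ∀ x, ‖f x‖ ≤ M by
    obtain ⟨M, hM⟩ := h
    exact ⟨M, (norm_nonneg _).trans (hM 0), hM⟩
  cases D
  · exact HasCompactSupport.exists_bound_of_continuous hs hf
  · obtain ⟨M, hM⟩ := (isCompact_closedBall (0 : E d) (Real.sqrt d)).exists_bound_of_continuousOn
      hf.continuousOn
    refine ⟨M, fun x => ?_⟩
    obtain ⟨k, hk⟩ := exists_lattice_norm_le x
    rw [← IsOn.sub_lattice (D := .torus) hp ⟨k, rfl⟩]
    exact hM _ (by simpa using hk)

variable [NormedSpace ℝ V]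

theorem IsTest.fderiv {D : Domain} {φ : E d → V} (hφ : IsTest D φ) :
    IsTest D fun x => fderiv ℝ φ x := by
  refine ⟨hφ.1.fderiv_right (m := (⊤ : ℕ∞)) (by simp), hφ.2.1.fderiv, ?_⟩
  cases D
  · exact HasCompactSupport.fderiv (𝕜 := ℝ) hφ.2.2
  · trivial

theorem IsTest.exists_bound {D : Domain} {φ : E d → V} (hφ : IsTest D φ) :
    ∃ M, 0 ≤ M ∧ (∀ x, ‖φ x‖ ≤ M) ∧ ∀ x, ‖_root_.fderiv ℝ φ x‖ ≤ M := by
  obtain ⟨M, hM0, hM⟩ := exists_bound_of_continuous hφ.1.continuous hφ.2.1 hφ.2.2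
  obtain ⟨M', hM0', hM'⟩ :=
    exists_bound_of_continuous hφ.fderiv.1.continuous hφ.fderiv.2.1 hφ.fderiv.2.2
  exact ⟨max M M', hM0.trans (le_max_left _ _), fun x => (hM x).trans (le_max_left _ _),
    fun x => (hM' x).trans (le_max_right _ _)⟩

/-- A test field composed with maps close to the identity vanishes off a set of finite measure. -/
theorem IsTest.exists_finite_support {D : Domain} {φ : E d → V} (hφ : IsTest D φ) (C : ℝ) :
    ∃ B : Set (E d), MeasurableSet B ∧ vol d D B < ∞ ∧
      ∀ x y, ‖y - x‖ ≤ C → x ∉ B → φ y = 0 ∧ _root_.fderiv ℝ φ y = 0 := by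
  cases D
  · have hs : HasCompactSupport φ := hφ.2.2
    obtain ⟨r, hr⟩ := hs.isCompact.isBounded.subset_closedBall (0 : E d)
    refine ⟨Metric.closedBall 0 (r + C), Metric.isClosed_closedBall.measurableSet, ?_, ?_⟩
    · simpa [vol, cell] using measure_closedBall_lt_top
    · intro x y hxy hx
      have hy : y ∉ tsupport φ := by
        intro hy
        have h1 := hr hy
        rw [mem_closedBall_zero_iff] at h1 hx
        apply hx
        have h2 : x = y - (y - x) := by abel
        rw [h2]
        exact (norm_sub_le _ _).trans (add_le_add h1 hxy)
      exact ⟨image_eq_zero_of_notMem_tsupport hy,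
        image_eq_zero_of_notMem_tsupport fun h => hy (tsupport_fderiv_subset ℝ h)⟩
  · exact ⟨univ, MeasurableSet.univ, measure_lt_top _ _, fun x y _ hx => absurd (mem_univ _) hx⟩

variable {Ω : Type*} [MeasurableSpace Ω]

theorem IsTimeTest.exists_Icc {T : ℝ} (hT : 0 < T) {θ : ℝ → ℝ} (hθ : IsTimeTest T θ) :
    ∃ a b, 0 < a ∧ b < T ∧ ∀ t ∉ Icc a b, θ t = 0 := by
  rcases (tsupport θ).eq_empty_or_nonempty with h | h
  · exact ⟨T / 2, T / 2, by linarith, by linarith, fun t _ =>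
      image_eq_zero_of_notMem_tsupport (by simp [h])⟩
  · have hK : IsCompact (tsupport θ) := hθ.2.1
    refine ⟨sInf (tsupport θ), sSup (tsupport θ), (hθ.2.2 (hK.sInf_mem h)).1,
      (hθ.2.2 (hK.sSup_mem h)).2, fun t ht => image_eq_zero_of_notMem_tsupport fun hmem => ht ?_⟩
    exact ⟨csInf_le hK.bddBelow hmem, le_csSup hK.bddAbove hmem⟩

/-- Every derivative is continuous, so a compact set decides the bound: the support on the whole
space, a period ball times the time support on the torus. -/
theorem exists_bound_iteratedFDeriv_separable {D : Domain} {T : ℝ} {θ : ℝ → ℝ}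
    (hθ : IsTimeTest T θ) {φ : E d → V} (hφ : IsTest D φ) (n : ℕ) :
    ∃ C : ℝ, ∀ z, ‖iteratedFDeriv ℝ n (fun z : ℝ × E d => θ z.1 • φ z.2) z‖ ≤ C := by
  set f : ℝ × E d → V := fun z => θ z.1 • φ z.2 with hf
  have hfs : ContDiff ℝ (⊤ : ℕ∞) f := (hθ.1.comp contDiff_fst).smul (hφ.1.comp contDiff_snd)
  have hc : Continuous (iteratedFDeriv ℝ n f) :=
    hfs.continuous_iteratedFDeriv (mod_cast le_top)
  cases D
  · have hs : HasCompactSupport φ := hφ.2.2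
    have hcs : HasCompactSupport f := by
      refine HasCompactSupport.of_support_subset_isCompact (hθ.2.1.isCompact.prod hs.isCompact) ?_
      intro z hz
      simp only [hf, Function.mem_support, smul_ne_zero_iff] at hz
      exact ⟨subset_tsupport _ hz.1, subset_tsupport _ hz.2⟩
    exact (hcs.iteratedFDeriv n).exists_bound_of_continuous hc
  · have hper : ∀ (k : Fin d → ℤ) z,
        iteratedFDeriv ℝ n f (z + (0, intPoint k)) = iteratedFDeriv ℝ n f z := by
      intro k z
      rw [← iteratedFDeriv_comp_add_right]
      congr 1
      ext1 y
      simp only [hf, Prod.fst_add, Prod.snd_add, add_zero]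
      rw [hφ.2.1]
    obtain ⟨M, hM⟩ := (hθ.2.1.isCompact.prod
      (isCompact_closedBall (0 : E d) (Real.sqrt d))).exists_bound_of_continuousOn hc.continuousOn
    refine ⟨max M 0, fun z => ?_⟩
    by_cases hz : z.1 ∈ tsupport θ
    · obtain ⟨k, hk⟩ := exists_lattice_norm_le z.2
      have h1 := hper k (z.1, z.2 - intPoint k)
      have h2 : ((z.1, z.2 - intPoint k) : ℝ × E d) + (0, intPoint k) = z := by ext <;> simp
      rw [h2] at h1
      rw [h1]
      exact (hM (z.1, z.2 - intPoint k) ⟨hz, mem_closedBall_zero_iff.2 hk⟩).trans (le_max_left _ _)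
    · have h1 : iteratedFDeriv ℝ n f z = 0 := by
        have h2 : z ∉ tsupport f := by
          intro hmem
          apply hz
          have h3 : tsupport f ⊆ Prod.fst ⁻¹' tsupport θ := by
            refine closure_minimal ?_ ((isClosed_tsupport θ).preimage continuous_fst)
            intro y hy
            simp only [hf, Function.mem_support, smul_ne_zero_iff] at hy
            exact subset_tsupport _ hy.1
          exact h3 hmem
        by_contra h3
        exact h2 (support_iteratedFDeriv_subset n h3)
      rw [h1, norm_zero]
      exact le_max_right _ _

theorem isRandomTest_separable {D : Domain} {T : ℝ} (hT : 0 < T) {θ : ℝ → ℝ}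
    (hθ : IsTimeTest T θ) {φ : E d → E d} (hφ : IsTest D φ) {A : Set Ω} (hA : MeasurableSet A) :
    IsRandomTest D T fun ω t x => (A.indicator 1 ω : ℝ) • θ t • φ x where
  meas t x := (measurable_const.indicator hA).smul_const _
  smooth ω := by
    have h1 : ContDiff ℝ (⊤ : ℕ∞) fun z : ℝ × E d => θ z.1 := hθ.1.comp contDiff_fst
    have h2 : ContDiff ℝ (⊤ : ℕ∞) fun z : ℝ × E d => φ z.2 := hφ.1.comp contDiff_snd
    have h3 : ContDiff ℝ (⊤ : ℕ∞) fun z : ℝ × E d => θ z.1 • φ z.2 := h1.smul h2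
    exact h3.const_smul (A.indicator 1 ω : ℝ)
  bound n := by
    obtain ⟨C, hC⟩ := exists_bound_iteratedFDeriv_separable hθ hφ n
    refine ⟨max C 0, fun ω z => ?_⟩
    by_cases hω : ω ∈ A
    · simp only [Set.indicator_of_mem hω, Pi.one_apply, one_smul]
      exact (hC z).trans (le_max_left _ _)
    · simp only [Set.indicator_of_notMem hω, zero_smul]
      have : iteratedFDeriv ℝ n (fun _ : ℝ × E d => (0 : E d)) = 0 := iteratedFDeriv_fun_zero
      rw [this, Pi.zero_apply, norm_zero]
      exact le_max_right _ _
  isOn ω t := hφ.2.1.map fun v => (A.indicator 1 ω : ℝ) • θ t • v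
  suppTime := by
    obtain ⟨a, b, ha, hb, h⟩ := hθ.exists_Icc hT
    exact ⟨a, b, ha, hb, fun ω t ht => by ext1 x; simp [h t ht]⟩
  suppSpace hD := by
    subst hD
    have hs : HasCompactSupport φ := hφ.2.2
    obtain ⟨r, hr⟩ := hs.isCompact.isBounded.subset_closedBall (0 : E d)
    refine ⟨r, fun ω t x hx => ?_⟩
    have : φ x = 0 := image_eq_zero_of_notMem_tsupport fun h => by
      have := hr h
      rw [mem_closedBall_zero_iff] at this
      linarith
    simp [this]

end TestFields

section Dominated

variable {Ω : Type*} [MeasurableSpace Ω] {P : Measure Ω} [IsProbabilityMeasure P]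
  {D : Domain} {T : ℝ}

theorem integrable_triple_of_norm_le {V : Type*} [NormedAddCommGroup V] {f : Ω → ℝ → E d → V}
    (hf : AEStronglyMeasurable (fun z : ℝ × (Ω × E d) => f z.2.1 z.1 z.2.2) (tripleMeasure D T P))
    {R : Ω → ℝ} (hR : Integrable R P) {k : E d → ℝ} (hk : Integrable k (vol d D))
    (h : ∀ᵐ ω ∂P, ∀ t ∈ Icc 0 T, ∀ x, ‖f ω t x‖ ≤ R ω * k x) :
    Integrable (fun z : ℝ × (Ω × E d) => f z.2.1 z.1 z.2.2) (tripleMeasure D T P) := by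
  refine integrable_triple_of_le hf (k := fun ω => ENNReal.ofReal (R ω * ∫ x, k x ∂(vol d D))) ?_ ?_
  · exact (hR.mul_const _).lintegral_lt_top
  · filter_upwards [h] with ω hω t ht
    have hle : ∀ x, ‖f ω t x‖ₑ ≤ ENNReal.ofReal (R ω * k x) := fun x => by
      rw [← ofReal_norm]
      exact ENNReal.ofReal_le_ofReal (hω t ht x)
    refine (lintegral_mono hle).trans_eq ?_
    rw [← integral_const_mul, ofReal_integral_eq_lintegral_ofReal (hk.const_mul _)]
    exact Eventually.of_forall fun x => (norm_nonneg _).trans (hω t ht x)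

end Dominated

end Kelvin

end

/-! ### First variation with respect to the flow. -/

noncomputable section

namespace Kelvin

variable {d : ℕ}

section DynamicEquation

variable {Ω : Type*} [MeasurableSpace Ω] {P : Measure Ω}
  {D : Domain} {T Cu C : ℝ} {u : ℝ → E d → E d} {X : Ω → ℝ → E d → E d} {b : Ω → ℝ → E d}

theorem aestronglyMeasurable_clm_apply {L : Ω → E d →L[ℝ] E d} {v : Ω → E d}
    (hL : AEStronglyMeasurable L P) (hv : AEStronglyMeasurable v P) :
    AEStronglyMeasurable (fun ω => L ω (v ω)) P := by
  have hc : Continuous fun p : (E d →L[ℝ] E d) × E d => p.1 p.2 :=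
    isBoundedBilinearMap_apply.continuous
  exact hc.comp_aestronglyMeasurable (hL.prodMk hv)

/-- The time derivative of `θ(t) φ(X_t(x))`. -/
def testRate (T : ℝ) (X : ℝ → E d → E d) (θ : ℝ → ℝ) (φ : E d → E d) (t : ℝ) (x : E d) : E d :=
  deriv θ t • φ (X t x) + θ t • fderiv ℝ φ (X t x) (timeDeriv T X t x)

theorem hasDerivWithinAt_test {X : ℝ → E d → E d} (hX : IsRegular T X (timeDeriv T X))
    {θ : ℝ → ℝ} (hθ : IsTimeTest T θ) {φ : E d → E d} (hφ : IsTest D φ) {t : ℝ}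
    (ht : t ∈ Icc 0 T) (x : E d) :
    HasDerivWithinAt (fun τ => θ τ • φ (X τ x)) (testRate T X θ φ t x) (Icc 0 T) t := by
  have h1 : HasDerivAt θ (deriv θ t) t := (hθ.1.differentiable (by simp) t).hasDerivAt
  have h2 : HasDerivWithinAt (fun τ => φ (X τ x)) (fderiv ℝ φ (X t x) (timeDeriv T X t x))
      (Icc 0 T) t :=
    ((hφ.1.differentiable (by simp) (X t x)).hasFDerivAt).comp_hasDerivWithinAt t
      (hX.deriv t ht x)
  have h3 := h1.hasDerivWithinAt (s := Icc 0 T) |>.smul h2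
  rw [testRate, add_comm]
  exact h3

theorem timeDeriv_perturbed (hT : 0 < T) {X : ℝ → E d → E d}
    (hX : IsRegular T X (timeDeriv T X)) {θ : ℝ → ℝ} (hθ : IsTimeTest T θ) {φ : E d → E d}
    (hφ : IsTest D φ) (ε c : ℝ) {t : ℝ} (ht : t ∈ Icc 0 T) (x : E d) :
    timeDeriv T (fun t x => X t x + ε • c • θ t • φ (X t x)) t x =
      timeDeriv T X t x + ε • c • testRate T X θ φ t x :=
  ((hX.deriv t ht x).add (((hasDerivWithinAt_test hX hθ hφ ht x).const_smul c).const_smul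
    ε)).derivWithin (uniqueDiffOn_Icc hT t ht)

/-- The defect of the momentum equation `ξ̇_t + (∇u_t)^*(X_t + b_t) ξ_t`. -/
def momentumDefect (T : ℝ) (u : ℝ → E d → E d) (X ξ : Ω → ℝ → E d → E d) (b : Ω → ℝ → E d)
    (ω : Ω) (t : ℝ) (x : E d) : E d :=
  timeDeriv T (ξ ω) t x +
    ContinuousLinearMap.adjoint (fderiv ℝ (u t) (X ω t x + b ω t)) (ξ ω t x)

theorem IsTimeTest.exists_bound {θ : ℝ → ℝ} (hθ : IsTimeTest T θ) :
    ∃ M, 0 ≤ M ∧ (∀ t, |θ t| ≤ M) ∧ ∀ t, |deriv θ t| ≤ M := by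
  obtain ⟨M, hM⟩ := hθ.2.1.exists_bound_of_continuous hθ.1.continuous
  obtain ⟨M', hM'⟩ := (HasCompactSupport.deriv hθ.2.1).exists_bound_of_continuous
    (hθ.1.continuous_deriv (by simp))
  exact ⟨max M M', (norm_nonneg _).trans ((hM 0).trans (le_max_left _ _)),
    fun t => (hM t).trans (le_max_left _ _), fun t => (hM' t).trans (le_max_right _ _)⟩

theorem IsFlowSystem.ae_continuousOn_X (h : IsFlowSystem D T Cu C P u X b) {V : Type*}
    [TopologicalSpace V] {φ : E d → V} (hφ : Continuous φ) :
    ∀ᵐ ω ∂P, ContinuousOn (fun z : ℝ × E d => φ (X ω z.1 z.2)) (Icc 0 T ×ˢ univ) := by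
  filter_upwards [h.flow] with ω hω
  exact hφ.comp_continuousOn hω.regular.cont

theorem IsFlowSystem.meas_testRate (h : IsFlowSystem D T Cu C P u X b) {θ : ℝ → ℝ}
    {φ : E d → E d} (hφ : IsTest D φ) {t : ℝ} (ht : t ∈ Icc 0 T)
    (x : E d) : AEStronglyMeasurable (fun ω => testRate T (X ω) θ φ t x) P := by
  have h1 : AEStronglyMeasurable (fun ω => φ (X ω t x)) P :=
    hφ.1.continuous.comp_aestronglyMeasurable (h.meas t ht x)
  have h2 : AEStronglyMeasurable (fun ω => fderiv ℝ φ (X ω t x)) P :=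
    hφ.fderiv.1.continuous.comp_aestronglyMeasurable (h.meas t ht x)
  have h3 := aestronglyMeasurable_clm_apply h2 (h.meas_deriv ht x)
  exact (h1.const_smul (deriv θ t)).add (h3.const_smul (θ t))

theorem IsFlowSystem.cont_testRate (h : IsFlowSystem D T Cu C P u X b) {θ : ℝ → ℝ}
    (hθ : IsTimeTest T θ) {φ : E d → E d} (hφ : IsTest D φ) :
    ∀ᵐ ω ∂P, ContinuousOn (fun z : ℝ × E d => testRate T (X ω) θ φ z.1 z.2)
      (Icc 0 T ×ˢ univ) := by
  filter_upwards [h.flow, h.ae_continuousOn_X hφ.1.continuous,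
    h.ae_continuousOn_X hφ.fderiv.1.continuous] with ω h1 h2 h3
  have hd : Continuous (deriv θ) := hθ.1.continuous_deriv (by simp)
  exact ((hd.comp continuous_fst).continuousOn.smul h2).add
    ((hθ.1.continuous.comp continuous_fst).continuousOn.smul (h3.clm_apply h1.regular.cont'))

/-- The displacement is bounded by C, so φ(X_t(x)) vanishes for x off a set of finite measure that
depends neither on ω nor on t. A multiple of its indicator is a deterministic integrable majorant.
-/
theorem IsFlowSystem.exists_testRate_le (h : IsFlowSystem D T Cu C P u X b) {θ : ℝ → ℝ}
    (hθ : IsTimeTest T θ) {φ : E d → E d} (hφ : IsTest D φ) :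
    ∃ k : E d → ℝ, Integrable k (vol d D) ∧ ∀ᵐ ω ∂P, ∀ t ∈ Icc 0 T, ∀ x,
      ‖testRate T (X ω) θ φ t x‖ ≤ k x ∧ ‖θ t • φ (X ω t x)‖ ≤ k x ∧ ‖φ (X ω t x)‖ ≤ k x := by
  obtain ⟨N, hN0, hN, hN'⟩ := hθ.exists_bound
  obtain ⟨M, hM0, hM, hM'⟩ := hφ.exists_bound
  obtain ⟨B, hBm, hB, hsupp⟩ := hφ.exists_finite_support C
  have hC := h.C_nonneg
  set K : ℝ := N * M + N * (M * C) + M with hK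
  have hK0 : 0 ≤ K := by positivity
  refine ⟨B.indicator fun _ => K, (integrable_indicator_iff hBm).2 (integrableOn_const hB.ne), ?_⟩
  filter_upwards [h.flow] with ω hω t ht x
  by_cases hx : x ∈ B
  · rw [Set.indicator_of_mem hx]
    have h1 : ‖timeDeriv T (X ω) t x‖ ≤ C :=
      norm_le_of_strongNorm_le (hω.deriv_strong_le t ht) hC x
    have h2 : ‖deriv θ t • φ (X ω t x)‖ ≤ N * M := by
      rw [norm_smul]; exact mul_le_mul (hN' t) (hM _) (norm_nonneg _) hN0
    have h3 : ‖θ t • fderiv ℝ φ (X ω t x) (timeDeriv T (X ω) t x)‖ ≤ N * (M * C) := by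
      rw [norm_smul]
      refine mul_le_mul (hN t) ?_ (norm_nonneg _) hN0
      exact (ContinuousLinearMap.le_opNorm _ _).trans
        (mul_le_mul (hM' _) h1 (norm_nonneg _) hM0)
    have h4 : ‖θ t • φ (X ω t x)‖ ≤ N * M := by
      rw [norm_smul]; exact mul_le_mul (hN t) (hM _) (norm_nonneg _) hN0
    have p1 : 0 ≤ N * M := by positivity
    have p2 : 0 ≤ N * (M * C) := by positivity
    refine ⟨(norm_add_le _ _).trans ?_, ?_, ?_⟩
    · linarith
    · linarith
    · linarith [hM (X ω t x)]
  · rw [Set.indicator_of_notMem hx]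
    obtain ⟨h1, h2⟩ := hsupp x (X ω t x) (hω.disp_le t ht x) hx
    simp [testRate, h1, h2]

theorem norm_sub_le_of_velocity (hu : IsBddVelocity D T Cu u) (hCu : 0 ≤ Cu) {t : ℝ}
    (ht : t ∈ Icc 0 T) (x y : E d) : ‖u t x - u t y‖ ≤ Cu * ‖x - y‖ :=
  convex_univ.norm_image_sub_le_of_norm_fderiv_le
    (fun x _ => (hu.contDiff t ht).differentiable (by norm_num) x)
    (fun x _ => norm_fderiv_le_of_strongNorm_le (hu.strong_le t ht) hCu x)
    (mem_univ y) (mem_univ x)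

variable [IsProbabilityMeasure P]

/-- The first variation of the coupling term in the direction `δX = 1_A θ φ`. -/
theorem IsFlowSystem.hasDerivAt_coupling (h : IsFlowSystem D T Cu C P u X b) {r : ℝ}
    (hr : 1 + (d : ℝ) / 2 < r) {ξ : Ω → ℝ → E d → E d} (hξ : IsMomentum D r T P ξ)
    {θ : ℝ → ℝ} (hθ : IsTimeTest T θ) {φ : E d → E d} (hφ : IsTest D φ) {A : Set Ω}
    (hA : MeasurableSet A) :
    let c : Ω → ℝ := A.indicator 1
    let F : ℝ → Ω → ℝ → E d → ℝ := fun ε ω t x => ⟪ξ ω t x,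
      ε • c ω • testRate T (X ω) θ φ t x - (u t (X ω t x + b ω t + ε • c ω • θ t • φ (X ω t x)) -
        u t (X ω t x + b ω t))⟫_ℝ
    let F' : Ω → ℝ → E d → ℝ := fun ω t x => ⟪ξ ω t x, c ω • testRate T (X ω) θ φ t x -
      fderiv ℝ (u t) (X ω t x + b ω t) (c ω • θ t • φ (X ω t x))⟫_ℝ
    (∀ ε, Integrable (fun z : ℝ × (Ω × E d) => F ε z.2.1 z.1 z.2.2) (tripleMeasure D T P)) ∧
    Integrable (fun z : ℝ × (Ω × E d) => F' z.2.1 z.1 z.2.2) (tripleMeasure D T P) ∧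
    HasDerivAt (fun ε => ∫ z, F ε z.2.1 z.1 z.2.2 ∂(tripleMeasure D T P))
      (∫ z, F' z.2.1 z.1 z.2.2 ∂(tripleMeasure D T P)) 0 := by
  -- F ε is the coupling integrand of the perturbed flow minus its value at ε = 0. Working with the
  -- increment keeps the majorant integrable in space.
  intro c F F'
  obtain ⟨R, hR, hξb⟩ := hξ.exists_isBddMomentum hr
  obtain ⟨k, hk, hkb⟩ := h.exists_testRate_le hθ hφ
  have hCu := h.Cu_nonneg
  have hRi : Integrable R P := hR.integrable (by norm_num)
  have hc1 : ∀ ω, ‖c ω‖ ≤ 1 := fun ω => by by_cases hω : ω ∈ A <;> simp [c, hω]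
  have hcm : AEStronglyMeasurable c P := (measurable_const.indicator hA).aestronglyMeasurable
  have hφm : ∀ t ∈ Icc 0 T, ∀ x, AEStronglyMeasurable (fun ω => c ω • θ t • φ (X ω t x)) P :=
    fun t ht x => by
      have h1 : AEStronglyMeasurable (fun ω => φ (X ω t x)) P :=
        hφ.1.continuous.comp_aestronglyMeasurable (h.meas t ht x)
      exact hcm.smul (h1.const_smul (θ t))
  have hmF : ∀ ε, AEStronglyMeasurable (fun z : ℝ × (Ω × E d) => F ε z.2.1 z.1 z.2.2)
      (tripleMeasure D T P) := by
    intro ε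
    refine aestronglyMeasurable_triple h.pos.le (f := F ε) (fun t ht x => ?_) ?_
    · refine (hξ.aestronglyMeasurable ht x).inner
        (((hcm.smul (h.meas_testRate hφ ht x)).const_smul ε).sub
          (AEStronglyMeasurable.sub ?_ (h.meas_comp h.vel.cont ht x)))
      refine (continuous_slice h.vel.cont ht).comp_aestronglyMeasurable
        (((h.meas t ht x).add (h.noise_meas t ht)).add ((hφm t ht x).const_smul ε))
    · filter_upwards [hξb, h.cont_testRate hθ hφ, h.ae_continuousOn_comp h.vel.cont,
        h.ae_continuousOn_noisy, h.ae_continuousOn_X hφ.1.continuous] with ω h1 h2 h3 h4 h5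
      refine h1.regular.cont.inner (((h2.const_smul (c ω)).const_smul ε).sub
        (ContinuousOn.sub ?_ h3))
      have h6 : ContinuousOn (fun z : ℝ × E d => X ω z.1 z.2 + b ω z.1 +
          ε • c ω • θ z.1 • φ (X ω z.1 z.2)) (Icc 0 T ×ˢ univ) :=
        h4.add ((((hθ.1.continuous.comp continuous_fst).continuousOn.smul h5).const_smul
          (c ω)).const_smul ε)
      exact continuousOn_comp_noisy (f := u)
        (Y := fun t x => X ω t x + b ω t + ε • c ω • θ t • φ (X ω t x)) h.vel.cont h6
  have hmF' : AEStronglyMeasurable (fun z : ℝ × (Ω × E d) => F' z.2.1 z.1 z.2.2)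
      (tripleMeasure D T P) := by
    refine aestronglyMeasurable_triple h.pos.le (f := F') (fun t ht x => ?_) ?_
    · refine (hξ.aestronglyMeasurable ht x).inner ((hcm.smul (h.meas_testRate hφ ht x)).sub ?_)
      exact aestronglyMeasurable_clm_apply
        (h.meas_comp (f := fun t x => fderiv ℝ (u t) x) h.vel.cont_fderiv ht x) (hφm t ht x)
    · filter_upwards [hξb, h.cont_testRate hθ hφ,
        h.ae_continuousOn_comp (f := fun t x => fderiv ℝ (u t) x) h.vel.cont_fderiv,
        h.ae_continuousOn_X hφ.1.continuous] with ω h1 h2 h3 h5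
      exact h1.regular.cont.inner ((h2.const_smul (c ω)).sub (h3.clm_apply
        (((hθ.1.continuous.comp continuous_fst).continuousOn.smul h5).const_smul (c ω))))
  -- The velocity is Lipschitz in space with constant Cu, so F is Lipschitz in ε with an integrable
  -- constant, as differentiation under the integral demands.
  have hlip : ∀ᵐ ω ∂P, ∀ t ∈ Icc 0 T, ∀ x, ∀ ε ε' : ℝ,
      ‖F ε ω t x - F ε' ω t x‖ ≤ R ω * ((1 + Cu) * k x) * ‖ε - ε'‖ := by
    filter_upwards [hξb, hkb] with ω h1 h2 t ht x ε ε'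
    obtain ⟨k1, k2, -⟩ := h2 t ht x
    have hk0 : 0 ≤ k x := (norm_nonneg _).trans k1
    have e1 : F ε ω t x - F ε' ω t x = ⟪ξ ω t x, (ε - ε') • c ω • testRate T (X ω) θ φ t x -
        (u t (X ω t x + b ω t + ε • c ω • θ t • φ (X ω t x)) -
          u t (X ω t x + b ω t + ε' • c ω • θ t • φ (X ω t x)))⟫_ℝ := by
      simp only [F]
      rw [← inner_sub_right]
      congr 1
      rw [sub_smul]
      abel
    rw [e1]
    refine (norm_inner_le_norm _ _).trans ?_
    have e2 : ‖(ε - ε') • c ω • testRate T (X ω) θ φ t x‖ ≤ ‖ε - ε'‖ * (1 * k x) := by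
      rw [norm_smul, norm_smul]
      gcongr
      exact hc1 ω
    have e3 : ‖u t (X ω t x + b ω t + ε • c ω • θ t • φ (X ω t x)) -
          u t (X ω t x + b ω t + ε' • c ω • θ t • φ (X ω t x))‖ ≤
        Cu * (‖ε - ε'‖ * (1 * k x)) := by
      refine (norm_sub_le_of_velocity h.vel hCu ht _ _).trans ?_
      rw [add_sub_add_left_eq_sub, ← sub_smul, norm_smul, norm_smul]
      gcongr
      exact hc1 ω
    calc _ ≤ R ω * (‖ε - ε'‖ * (1 * k x) + Cu * (‖ε - ε'‖ * (1 * k x))) := by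
          refine mul_le_mul (norm_le_of_strongNorm_le (h1.strong_le t ht) h1.nonneg x) ?_
            (norm_nonneg _) h1.nonneg
          exact (norm_sub_le _ _).trans (add_le_add e2 e3)
      _ = _ := by ring
  -- Since F vanishes at ε = 0, the Lipschitz bound also yields integrability for every ε.
  have hF0 : ∀ ω t x, F 0 ω t x = 0 := by
    intro ω t x
    simp [F]
  have hkC : Integrable (fun x => (1 + Cu) * k x) (vol d D) := hk.const_mul _
  have hFi : ∀ ε, Integrable (fun z : ℝ × (Ω × E d) => F ε z.2.1 z.1 z.2.2)
      (tripleMeasure D T P) := by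
    intro ε
    refine integrable_triple_of_norm_le (f := F ε) (hmF ε) hRi (hkC.mul_const ‖ε‖) ?_
    filter_upwards [hlip] with ω hω t ht x
    have := hω t ht x ε 0
    rwa [hF0, sub_zero, sub_zero, mul_assoc] at this
  refine ⟨hFi, ?_⟩
  have hbi : Integrable (fun z : ℝ × (Ω × E d) => R z.2.1 * ((1 + Cu) * k z.2.2))
      (tripleMeasure D T P) := (hRi.mul_prod hkC).comp_snd (timeMeasure T)
  refine hasDerivAt_integral_of_dominated_loc_of_lip (s := univ)
    (bound := fun z : ℝ × (Ω × E d) => R z.2.1 * ((1 + Cu) * k z.2.2)) univ_mem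
    (Eventually.of_forall hmF) (hFi 0) hmF' ?_ hbi ?_
  · refine ae_triple_of_ae (p := fun ω t x => LipschitzOnWith
      (Real.nnabs (R ω * ((1 + Cu) * k x))) (fun ε => F ε ω t x) univ) ?_
    filter_upwards [hlip] with ω hω t ht x
    refine LipschitzOnWith.of_dist_le_mul fun ε _ ε' _ => ?_
    rw [dist_eq_norm, dist_eq_norm, Real.coe_nnabs]
    exact (hω t ht x ε ε').trans (mul_le_mul_of_nonneg_right (le_abs_self _) (norm_nonneg _))
  · have := h.pos
    refine ae_triple_of_ae (p := fun ω t x => HasDerivAt (fun ε => F ε ω t x) (F' ω t x) 0) ?_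
    filter_upwards [hξb] with ω _ t ht x
    have h1 : HasDerivAt (fun ε : ℝ => ε • c ω • testRate T (X ω) θ φ t x)
        (c ω • testRate T (X ω) θ φ t x) 0 := by
      simpa using (hasDerivAt_id (0 : ℝ)).smul_const (c ω • testRate T (X ω) θ φ t x)
    have h2 : HasDerivAt (fun ε : ℝ => X ω t x + b ω t + ε • c ω • θ t • φ (X ω t x))
        (c ω • θ t • φ (X ω t x)) 0 := by
      simpa using ((hasDerivAt_id (0 : ℝ)).smul_const (c ω • θ t • φ (X ω t x))).const_add
        (X ω t x + b ω t)
    have h3 : HasDerivAt (fun ε : ℝ => u t (X ω t x + b ω t + ε • c ω • θ t • φ (X ω t x)))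
        (fderiv ℝ (u t) (X ω t x + b ω t) (c ω • θ t • φ (X ω t x))) 0 := by
      have h4 := ((h.vel.contDiff t ht).differentiable (by norm_num)
        (X ω t x + b ω t)).hasFDerivAt
      refine HasFDerivAt.comp_hasDerivAt (0 : ℝ) ?_ h2
      simpa using h4
    have h5 := (h1.sub (h3.sub_const (u t (X ω t x + b ω t))))
    simpa [F, F'] using (hasDerivAt_const (0 : ℝ) (ξ ω t x)).inner ℝ h5

end DynamicEquation

end Kelvin

end

/-! ### The momentum equation. -/

noncomputable section

namespace Kelvin

variable {d : ℕ}

section MomentumEquation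

variable {Ω : Type*} [MeasurableSpace Ω] {P : Measure Ω}
  {D : Domain} {T Cu C : ℝ} {u : ℝ → E d → E d} {X : Ω → ℝ → E d → E d} {b : Ω → ℝ → E d}

theorem IsBddFlow.norm_sub_le {X : ℝ → E d → E d} (hX : IsBddFlow D T C X) {t : ℝ}
    (ht : t ∈ Icc 0 T) (x y : E d) : ‖x - y‖ ≤ C * ‖X t x - X t y‖ := by
  have h := convex_univ.norm_image_sub_le_of_norm_fderiv_le (𝕜 := ℝ)
    (fun x _ => (hX.contDiff_inv t ht).differentiable (by norm_num) x)
    (fun x _ => hX.inv_fderiv_le t ht x) (mem_univ (X t y)) (mem_univ (X t x))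
  rwa [hX.invFun_left ht, hX.invFun_left ht] at h

theorem isTimeTest_zero (T : ℝ) : IsTimeTest T fun _ => 0 :=
  ⟨contDiff_const, HasCompactSupport.zero, by
    have : tsupport (fun _ : ℝ => (0 : ℝ)) = ∅ := tsupport_eq_empty_iff.2 rfl
    simp [this]⟩

theorem IsTimeTest.eq_zero_left {θ : ℝ → ℝ} (hθ : IsTimeTest T θ) : θ 0 = 0 :=
  image_eq_zero_of_notMem_tsupport fun h => lt_irrefl _ (hθ.2.2 h).1

theorem IsTimeTest.eq_zero_right {θ : ℝ → ℝ} (hθ : IsTimeTest T θ) : θ T = 0 :=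
  image_eq_zero_of_notMem_tsupport fun h => lt_irrefl _ (hθ.2.2 h).2

theorem IsFlowSystem.meas_momentumDefect (h : IsFlowSystem D T Cu C P u X b) {r : ℝ}
    (hr : 1 + (d : ℝ) / 2 < r) {ξ : Ω → ℝ → E d → E d} (hξ : IsMomentum D r T P ξ)
    {t : ℝ} (ht : t ∈ Icc 0 T) (x : E d) :
    AEStronglyMeasurable (fun ω => momentumDefect T u X ξ b ω t x) P := by
  obtain ⟨R, -, hξb⟩ := hξ.exists_isBddMomentum hr
  refine (aestronglyMeasurable_timeDeriv h.pos (fun t ht x => hξ.aestronglyMeasurable ht x)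
    (hξb.mono fun _ h => h.regular) ht x).add (aestronglyMeasurable_clm_apply ?_
      (hξ.aestronglyMeasurable ht x))
  exact (ContinuousLinearMap.adjoint (𝕜 := ℝ) (E := E d) (F := E d)).continuous.comp_aestronglyMeasurable
    (h.meas_comp (f := fun t x => fderiv ℝ (u t) x) h.vel.cont_fderiv ht x)

theorem IsFlowSystem.cont_momentumDefect (h : IsFlowSystem D T Cu C P u X b) {R : Ω → ℝ}
    {ξ : Ω → ℝ → E d → E d} (hξb : ∀ᵐ ω ∂P, IsBddMomentum D T (R ω) (ξ ω)) :
    ∀ᵐ ω ∂P, ContinuousOn (fun z : ℝ × E d => momentumDefect T u X ξ b ω z.1 z.2)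
      (Icc 0 T ×ˢ univ) := by
  filter_upwards [hξb, h.ae_continuousOn_comp (f := fun t x => fderiv ℝ (u t) x)
    h.vel.cont_fderiv] with ω h1 h2
  exact h1.regular.cont'.add (((ContinuousLinearMap.adjoint (𝕜 := ℝ) (E := E d)
    (F := E d)).continuous.comp_continuousOn h2).clm_apply h1.regular.cont)

theorem IsFlowSystem.norm_momentumDefect_le (h : IsFlowSystem D T Cu C P u X b) {R : Ω → ℝ}
    {ξ : Ω → ℝ → E d → E d} (hξb : ∀ᵐ ω ∂P, IsBddMomentum D T (R ω) (ξ ω)) :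
    ∀ᵐ ω ∂P, ∀ t ∈ Icc 0 T, ∀ x, ‖momentumDefect T u X ξ b ω t x‖ ≤ R ω * (1 + Cu) := by
  filter_upwards [hξb] with ω h1 t ht x
  have e1 := norm_le_of_strongNorm_le (h1.strong_le' t ht) h1.nonneg x
  have e2 := norm_le_of_strongNorm_le (h1.strong_le t ht) h1.nonneg x
  have e3 := norm_fderiv_le_of_strongNorm_le (h.vel.strong_le t ht) h.Cu_nonneg
    (X ω t x + b ω t)
  have e4 : ‖ContinuousLinearMap.adjoint (fderiv ℝ (u t) (X ω t x + b ω t)) (ξ ω t x)‖ ≤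
      Cu * R ω := by
    refine (ContinuousLinearMap.le_opNorm _ _).trans ?_
    rw [LinearIsometryEquiv.norm_map]
    exact mul_le_mul e3 e2 (norm_nonneg _) h.Cu_nonneg
  calc _ ≤ R ω + Cu * R ω := (norm_add_le _ _).trans (add_le_add e1 e4)
    _ = _ := by ring

theorem IsFlowSystem.ae_isOn_momentumDefect (h : IsFlowSystem D T Cu C P u X b) {R : Ω → ℝ}
    {ξ : Ω → ℝ → E d → E d} (hξb : ∀ᵐ ω ∂P, IsBddMomentum D T (R ω) (ξ ω)) :
    ∀ᵐ ω ∂P, ∀ t ∈ Icc 0 T, IsOn D (momentumDefect T u X ξ b ω t) := by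
  filter_upwards [h.flow, hξb] with ω h1 h2 t ht
  exact (h2.isOn' t ht).map₂ ((((h.vel.isOn t ht).fderiv.comp_of_sub_id
    (h1.isOn_noisy ht (b ω t))).map₂ (h2.isOn t ht) fun L v => ContinuousLinearMap.adjoint L v))
    fun v w => v + w

theorem IsTest.smul_const {V : Type*} [NormedAddCommGroup V] [NormedSpace ℝ V] {ψ : E d → ℝ}
    (hψ : IsTest D ψ) (v : V) : IsTest D fun x => ψ x • v := by
  refine ⟨hψ.1.smul contDiff_const, hψ.2.1.map fun c => c • v, ?_⟩
  cases D
  · have h1 : HasCompactSupport ψ := hψ.2.2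
    exact h1.smul_right (f' := fun _ => v)
  · trivial

variable [IsProbabilityMeasure P]

/-- Integration by parts in time for fixed (ω, x): the total derivative of ⟨ξ_t, θ φ(X_t)⟩
integrates to zero because θ vanishes at both ends. Subtracting the first variation moves the time
derivative onto the momentum and the velocity gradient, transposed, onto the momentum as well. -/
theorem IsFlowSystem.integral_triple_momentumDefect (h : IsFlowSystem D T Cu C P u X b) {r : ℝ}
    (hr : 1 + (d : ℝ) / 2 < r) {ξ : Ω → ℝ → E d → E d} (hξ : IsMomentum D r T P ξ)
    {θ : ℝ → ℝ} (hθ : IsTimeTest T θ) {φ : E d → E d} (hφ : IsTest D φ) {A : Set Ω}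
    (hA : MeasurableSet A)
    (h0 : ∫ z, ⟪ξ z.2.1 z.1 z.2.2, (A.indicator 1 z.2.1 : ℝ) • testRate T (X z.2.1) θ φ z.1 z.2.2 -
      fderiv ℝ (u z.1) (X z.2.1 z.1 z.2.2 + b z.2.1 z.1)
        ((A.indicator 1 z.2.1 : ℝ) • θ z.1 • φ (X z.2.1 z.1 z.2.2))⟫_ℝ ∂(tripleMeasure D T P) = 0) :
    ∫ z, (A.indicator 1 z.2.1 : ℝ) * (θ z.1 *
      ⟪momentumDefect T u X ξ b z.2.1 z.1 z.2.2, φ (X z.2.1 z.1 z.2.2)⟫_ℝ)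
      ∂(tripleMeasure D T P) = 0 := by
  obtain ⟨R, hR, hξb⟩ := hξ.exists_isBddMomentum hr
  obtain ⟨k, hk, hkb⟩ := h.exists_testRate_le hθ hφ
  have hRi : Integrable R P := hR.integrable (by norm_num)
  have hCu := h.Cu_nonneg
  set c : Ω → ℝ := A.indicator 1 with hcdef
  have hc1 : ∀ ω, ‖c ω‖ ≤ 1 := fun ω => by by_cases hω : ω ∈ A <;> simp [c, hω]
  have hcm : AEStronglyMeasurable c P := (measurable_const.indicator hA).aestronglyMeasurable
  have hφm : ∀ t ∈ Icc 0 T, ∀ x, AEStronglyMeasurable (fun ω => φ (X ω t x)) P :=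
    fun t ht x => hφ.1.continuous.comp_aestronglyMeasurable (h.meas t ht x)
  let p' : Ω → ℝ → E d → ℝ := fun ω t x => ⟪timeDeriv T (ξ ω) t x, θ t • φ (X ω t x)⟫_ℝ +
    ⟪ξ ω t x, testRate T (X ω) θ φ t x⟫_ℝ
  let g : Ω → ℝ → E d → ℝ := fun ω t x =>
    c ω * (θ t * ⟪momentumDefect T u X ξ b ω t x, φ (X ω t x)⟫_ℝ)
  have hp'c : ∀ᵐ ω ∂P, ContinuousOn (fun z : ℝ × E d => p' ω z.1 z.2) (Icc 0 T ×ˢ univ) := by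
    filter_upwards [hξb, h.cont_testRate hθ hφ, h.ae_continuousOn_X hφ.1.continuous]
      with ω h1 h2 h3
    exact (h1.regular.cont'.inner ((hθ.1.continuous.comp continuous_fst).continuousOn.smul h3)).add
      (h1.regular.cont.inner h2)
  have hp'i : Integrable (fun z : ℝ × (Ω × E d) => c z.2.1 * p' z.2.1 z.1 z.2.2)
      (tripleMeasure D T P) := by
    have hm : ∀ t ∈ Icc 0 T, ∀ x, AEStronglyMeasurable (fun ω => c ω * p' ω t x) P := by
      intro t ht x
      have h1 := (aestronglyMeasurable_timeDeriv h.pos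
        (fun t ht x => hξ.aestronglyMeasurable ht x) (hξb.mono fun _ h => h.regular) ht x).inner
        (𝕜 := ℝ) ((hφm t ht x).const_smul (θ t))
      have h2 := (hξ.aestronglyMeasurable ht x).inner (𝕜 := ℝ)
        (h.meas_testRate (θ := θ) hφ ht x)
      exact hcm.mul (h1.add h2)
    refine integrable_triple_of_norm_le (f := fun ω t x => c ω * p' ω t x)
      (aestronglyMeasurable_triple (f := fun ω t x => c ω * p' ω t x) h.pos.le hm ?_)
      hRi (hk.const_mul 2) ?_
    · filter_upwards [hp'c] with ω hω
      exact continuousOn_const.mul hω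
    · filter_upwards [hξb, hkb] with ω h1 h2 t ht x
      obtain ⟨k1, k2, -⟩ := h2 t ht x
      have e1 := norm_le_of_strongNorm_le (h1.strong_le' t ht) h1.nonneg x
      have e2 := norm_le_of_strongNorm_le (h1.strong_le t ht) h1.nonneg x
      rw [norm_mul]
      calc _ ≤ 1 * (R ω * k x + R ω * k x) := by
            refine mul_le_mul (hc1 ω) ((norm_add_le _ _).trans (add_le_add ?_ ?_)) (norm_nonneg _)
              zero_le_one
            · exact (norm_inner_le_norm _ _).trans (mul_le_mul e1 k2 (norm_nonneg _) h1.nonneg)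
            · exact (norm_inner_le_norm _ _).trans (mul_le_mul e2 k1 (norm_nonneg _) h1.nonneg)
        _ = _ := by ring
  have hgi : Integrable (fun z : ℝ × (Ω × E d) => g z.2.1 z.1 z.2.2) (tripleMeasure D T P) := by
    refine integrable_triple_of_norm_le (f := g)
      (aestronglyMeasurable_triple (f := g) h.pos.le (fun t ht x => hcm.mul
        (((h.meas_momentumDefect hr hξ ht x).inner (hφm t ht x)).const_mul _)) ?_)
      hRi (hk.const_mul (1 + Cu)) ?_
    · filter_upwards [h.cont_momentumDefect hξb, h.ae_continuousOn_X hφ.1.continuous] with ω h1 h3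
      exact continuousOn_const.mul
        ((hθ.1.continuous.comp continuous_fst).continuousOn.mul (h1.inner h3))
    · filter_upwards [hkb, h.norm_momentumDefect_le hξb, hξb] with ω h2 h3 h4 t ht x
      obtain ⟨-, k2, -⟩ := h2 t ht x
      have e1 : θ t * ⟪momentumDefect T u X ξ b ω t x, φ (X ω t x)⟫_ℝ =
          ⟪momentumDefect T u X ξ b ω t x, θ t • φ (X ω t x)⟫_ℝ := by rw [real_inner_smul_right]
      simp only [g]
      rw [e1, norm_mul]
      calc _ ≤ 1 * ((R ω * (1 + Cu)) * k x) := by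
            refine mul_le_mul (hc1 ω) ((norm_inner_le_norm _ _).trans
              (mul_le_mul (h3 t ht x) k2 (norm_nonneg _) ?_)) (norm_nonneg _) zero_le_one
            exact mul_nonneg h4.nonneg (by linarith)
        _ = _ := by ring
  -- Fubini puts the time integral inside, where the fundamental theorem of calculus applies along
  -- almost every path.
  have hzero : ∫ z, c z.2.1 * p' z.2.1 z.1 z.2.2 ∂(tripleMeasure D T P) = 0 := by
    unfold tripleMeasure at hp'i ⊢
    rw [integral_prod_symm _ hp'i]
    refine integral_eq_zero_of_ae ?_
    have hae : ∀ᵐ y ∂(P.prod (vol d D)), IsBddMomentum D T (R y.1) (ξ y.1) ∧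
        IsBddFlow D T C (X y.1) ∧
        ContinuousOn (fun z : ℝ × E d => p' y.1 z.1 z.2) (Icc 0 T ×ˢ univ) :=
      Measure.quasiMeasurePreserving_fst.ae (hξb.and (h.flow.and hp'c))
    filter_upwards [hae] with y ⟨h1, h2, h3⟩
    simp only [integral_const_mul, Pi.zero_apply]
    have hd : ∀ t ∈ Icc 0 T, HasDerivWithinAt
        (fun t => ⟪ξ y.1 t y.2, θ t • φ (X y.1 t y.2)⟫_ℝ) (p' y.1 t y.2) (Icc 0 T) t := by
      intro t ht
      have := (h1.regular.deriv t ht y.2).inner ℝ (hasDerivWithinAt_test h2.regular hθ hφ ht y.2)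
      rwa [add_comm] at this
    have h4 := intervalIntegral.integral_eq_sub_of_hasDerivAt_of_le h.pos.le
      (fun t ht => (hd t ht).continuousWithinAt)
      (fun t ht => (hd t (Ioo_subset_Icc_self ht)).hasDerivAt (Icc_mem_nhds ht.1 ht.2))
      (ContinuousOn.intervalIntegrable (by
        rw [uIcc_of_le h.pos.le]
        exact continuousOn_slice (f := p' y.1) h3 y.2))
    rw [intervalIntegral.integral_of_le h.pos.le] at h4
    rw [timeMeasure, h4, hθ.eq_zero_left, hθ.eq_zero_right]
    simp
  have hsub := integral_sub hp'i hgi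
  rw [hzero, zero_sub] at hsub
  have hg0 : ∫ z, (c z.2.1 * p' z.2.1 z.1 z.2.2 - g z.2.1 z.1 z.2.2) ∂(tripleMeasure D T P) = 0 := by
    rw [← h0]
    refine integral_congr_ae (Eventually.of_forall fun z => ?_)
    simp only [p', g, momentumDefect, inner_add_left, inner_sub_right, inner_smul_right,
      ContinuousLinearMap.adjoint_inner_left, map_smul]
    ring
  rw [hg0] at hsub
  exact neg_eq_zero.1 hsub.symm

theorem IsFlowSystem.ae_integral_momentumDefect (h : IsFlowSystem D T Cu C P u X b) {r : ℝ}
    (hr : 1 + (d : ℝ) / 2 < r) {ξ : Ω → ℝ → E d → E d} (hξ : IsMomentum D r T P ξ)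
    {φ : E d → E d} (hφ : IsTest D φ)
    (h0 : ∀ A : Set Ω, MeasurableSet A → ∀ θ, IsTimeTest T θ → ∫ z, ⟪ξ z.2.1 z.1 z.2.2,
      (A.indicator 1 z.2.1 : ℝ) • testRate T (X z.2.1) θ φ z.1 z.2.2 -
      fderiv ℝ (u z.1) (X z.2.1 z.1 z.2.2 + b z.2.1 z.1)
        ((A.indicator 1 z.2.1 : ℝ) • θ z.1 • φ (X z.2.1 z.1 z.2.2))⟫_ℝ ∂(tripleMeasure D T P) = 0) :
    ∀ᵐ ω ∂P, ∀ t ∈ Icc 0 T,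
      Integrable (fun x => ⟪momentumDefect T u X ξ b ω t x, φ (X ω t x)⟫_ℝ) (vol d D) ∧
      ∫ x, ⟪momentumDefect T u X ξ b ω t x, φ (X ω t x)⟫_ℝ ∂(vol d D) = 0 := by
  obtain ⟨R, hR, hξb⟩ := hξ.exists_isBddMomentum hr
  -- Only the bound on φ(X_t) is wanted, which holds for any time cut-off; the zero one will do.
  obtain ⟨k, hk, hkb⟩ := h.exists_testRate_le (isTimeTest_zero T) hφ
  have hRi : Integrable R P := hR.integrable (by norm_num)
  have hCu := h.Cu_nonneg
  have hc : ∀ᵐ ω ∂P, ContinuousOn (fun z : ℝ × E d =>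
      ⟪momentumDefect T u X ξ b ω z.1 z.2, φ (X ω z.1 z.2)⟫_ℝ) (Icc 0 T ×ˢ univ) := by
    filter_upwards [h.cont_momentumDefect hξb, h.ae_continuousOn_X hφ.1.continuous] with ω h1 h3
    exact h1.inner h3
  have hb : ∀ᵐ ω ∂P, ∀ t ∈ Icc 0 T, ∀ x,
      ‖⟪momentumDefect T u X ξ b ω t x, φ (X ω t x)⟫_ℝ‖ ≤ (R ω * (1 + Cu)) * k x := by
    filter_upwards [hkb, h.norm_momentumDefect_le hξb, hξb] with ω h2 h3 h4 t ht x
    obtain ⟨-, -, k2⟩ := h2 t ht x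
    exact (norm_inner_le_norm _ _).trans (mul_le_mul (h3 t ht x) k2 (norm_nonneg _)
      (mul_nonneg h4.nonneg (by linarith)))
  have hz := ae_integral_eq_zero_of_forall_test h.pos
    (g := fun ω t x => ⟪momentumDefect T u X ξ b ω t x, φ (X ω t x)⟫_ℝ)
    (fun t ht x => (h.meas_momentumDefect hr hξ ht x).inner
      (hφ.1.continuous.comp_aestronglyMeasurable (h.meas t ht x))) hc (hRi.mul_const (1 + Cu)) hk hb
    (fun A hA θ hθ => h.integral_triple_momentumDefect hr hξ hθ hφ hA (h0 A hA θ hθ))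
  filter_upwards [hz, hc, hb] with ω h1 h2 h3 t ht
  refine ⟨(hk.const_mul (R ω * (1 + Cu))).mono' ?_ (Eventually.of_forall fun x => h3 t ht x),
    h1 t ht⟩
  exact (continuous_slice (f := fun t x => ⟪momentumDefect T u X ξ b ω t x, φ (X ω t x)⟫_ℝ) h2
    ht).aestronglyMeasurable

/-- Test fields appear composed with X_t, so the separation argument is applied with `Φ` equal to
X_t, whose inverse is Lipschitz with constant C. -/
theorem IsFlowSystem.ae_momentumDefect_eq_zero (h : IsFlowSystem D T Cu C P u X b) {r : ℝ}
    (hr : 1 + (d : ℝ) / 2 < r) {ξ : Ω → ℝ → E d → E d} (hξ : IsMomentum D r T P ξ)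
    (h0 : ∀ φ : E d → E d, IsTest D φ → ∀ A : Set Ω, MeasurableSet A → ∀ θ, IsTimeTest T θ →
      ∫ z, ⟪ξ z.2.1 z.1 z.2.2,
      (A.indicator 1 z.2.1 : ℝ) • testRate T (X z.2.1) θ φ z.1 z.2.2 -
      fderiv ℝ (u z.1) (X z.2.1 z.1 z.2.2 + b z.2.1 z.1)
        ((A.indicator 1 z.2.1 : ℝ) • θ z.1 • φ (X z.2.1 z.1 z.2.2))⟫_ℝ ∂(tripleMeasure D T P) = 0) :
    ∀ᵐ ω ∂P, ∀ t ∈ Icc 0 T, ∀ x, momentumDefect T u X ξ b ω t x = 0 := by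
  obtain ⟨R, -, hξb⟩ := hξ.exists_isBddMomentum hr
  let q := TopologicalSpace.denseSeq (E d)
  have htest : ∀ n m i, IsTest D fun x : E d => bumpFn D n (q m) x • (basisVec i : E d) :=
    fun n m i => (isTest_bumpFn D n (q m)).smul_const _
  have h1 := fun n m i => h.ae_integral_momentumDefect hr hξ (htest n m i) (h0 _ (htest n m i))
  filter_upwards [ae_all_iff.2 fun n => ae_all_iff.2 fun m => ae_all_iff.2 fun i => h1 n m i,
    h.cont_momentumDefect hξb, h.ae_isOn_momentumDefect hξb, h.flow] with ω hω hc hp hX t ht x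
  have hct : Continuous (momentumDefect T u X ξ b ω t) := continuous_slice hc ht
  ext i
  have hci : Continuous fun x => momentumDefect T u X ξ b ω t x i := by fun_prop
  have e1 : ∀ n m, (fun x => bumpFn D n (q m) (X ω t x) * momentumDefect T u X ξ b ω t x i) =
      fun x => ⟪momentumDefect T u X ξ b ω t x, bumpFn D n (q m) (X ω t x) • basisVec i⟫_ℝ := by
    intro n m
    ext1 x
    rw [real_inner_smul_right, inner_basisVec_right]
  have := eq_zero_of_forall_bumpFn_integral (hX.regular.contDiff t ht).continuous (hX.isOn t ht)
    h.C_nonneg (hX.norm_sub_le ht) hci ((hp t ht).map fun v => v i)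
    (TopologicalSpace.denseRange_denseSeq (E d))
    (fun n m => by rw [e1]; exact (hω n m i t ht).1) (fun n m => by
      rw [e1]; exact (hω n m i t ht).2)
  exact congrFun this x

end MomentumEquation

end Kelvin

end

/-! ### Critical points and the conservation law. -/

noncomputable section

namespace Kelvin

variable {d : ℕ}

section Critical

variable {Ω : Type*} [MeasurableSpace Ω] {P : Measure Ω} {D : Domain} {s T ν : ℝ}
  {W : ℝ≥0 → Ω → E d} {S : (E d → E d) → Lp (E d) 2 (vol d D)} {u : ℝ → E d → E d}
  {X ξ : Ω → ℝ → E d → E d}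

/-- The noise `√(2ν) W_t`. -/
def noise (ν : ℝ) (W : ℝ≥0 → Ω → E d) (ω : Ω) (t : ℝ) : E d :=
  Real.sqrt (2 * ν) • W t.toNNReal ω

theorem IsBrownianMotion.aestronglyMeasurable_noise (hW : IsBrownianMotion W P) (ν t : ℝ) :
    AEStronglyMeasurable (fun ω => noise ν W ω t) P := by
  have h1 : AEMeasurable (fun ω => W t.toNNReal ω) P := by
    have h2 : AEMeasurable (fun ω => WithLp.ofLp (W t.toNNReal ω)) P :=
      aemeasurable_pi_iff.2 fun i => (hW.coord i).aemeasurable _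
    exact (WithLp.measurable_toLp 2 _).comp_aemeasurable h2
  exact h1.aestronglyMeasurable.const_smul (Real.sqrt (2 * ν))

theorem IsBrownianMotion.ae_continuous_noise (hW : IsBrownianMotion W P) (ν : ℝ) :
    ∀ᵐ ω ∂P, Continuous (noise ν W ω) := by
  filter_upwards [ae_all_iff.2 fun i => (hW.coord i).cont] with ω hω
  have h1 : Continuous fun t => W t ω :=
    (PiLp.continuous_toLp 2 _).comp (continuous_pi fun i => hω i)
  exact (h1.comp continuous_real_toNNReal).const_smul (Real.sqrt (2 * ν))

theorem IsCritical.exists_isFlowSystem (hc : IsCritical D s T ν P W S u X ξ)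
    (hW : IsBrownianMotion W P) (hs : 1 + (d : ℝ) / 2 < s) (hT : 0 < T) :
    ∃ Cu C, IsFlowSystem D T Cu C P u X (noise ν W) := by
  have hs' : 1 + (d : ℝ) / 2 < s + 1 := by linarith
  obtain ⟨Cu, hCu, hu⟩ := hc.velocity.1.exists_isBddVelocity hs'
  obtain ⟨C, hC, hX⟩ := hc.configuration.exists_isBddFlow hs'
  exact ⟨Cu, C, hT, hCu, hC, hu,
    fun t ht x => (hc.configuration.meas t ht x).aestronglyMeasurable, hX,
    fun t _ => hW.aestronglyMeasurable_noise ν t,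
    (hW.ae_continuous_noise ν).mono fun _ h => h.continuousOn⟩

variable [IsProbabilityMeasure P]

theorem action_eq (hS : IsInertia D (s + 1) S) (hu : IsVelocity D (s + 1) T u)
    (hs : 1 + (d : ℝ) / 2 < s) (hT : 0 < T)
    (hf : Integrable (fun z : ℝ × (Ω × E d) => ⟪ξ z.2.1 z.1 z.2.2,
      timeDeriv T (X z.2.1) z.1 z.2.2 - u z.1 (noisyFlow ν W X z.2.1 z.1 z.2.2)⟫_ℝ)
      (tripleMeasure D T P)) :
    action D T ν P W S u X ξ = (∫ t in (0 : ℝ)..T, (1 / 2) * pairL2 D (S (u t)) (u t)) +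
      ∫ z, ⟪ξ z.2.1 z.1 z.2.2,
        timeDeriv T (X z.2.1) z.1 z.2.2 - u z.1 (noisyFlow ν W X z.2.1 z.1 z.2.2)⟫_ℝ
        ∂(tripleMeasure D T P) :=
  integral_add_triple hT.le
    (continuousOn_const.mul (continuousOn_quadratic hS hu (by linarith)))
    (f := fun ω t x => ⟪ξ ω t x, timeDeriv T (X ω) t x - u t (noisyFlow ν W X ω t x)⟫_ℝ) hf

/-- The action is affine in ε along a momentum direction, so its derivative at zero is the slope. -/
theorem IsCritical.integral_inner_defect (hc : IsCritical D s T ν P W S u X ξ)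
    (hW : IsBrownianMotion W P) (hS : IsInertia D (s + 1) S) (hs : 1 + (d : ℝ) / 2 < s)
    (hT : 0 < T) (δξ : Ω → ℝ → E d → E d) (hδ : IsMomentum D s T P δξ) :
    ∫ z, ⟪δξ z.2.1 z.1 z.2.2, defect T u X (noise ν W) z.2.1 z.1 z.2.2⟫_ℝ
      ∂(tripleMeasure D T P) = 0 := by
  obtain ⟨Cu, C, h⟩ := hc.exists_isFlowSystem hW hs hT
  have h1 := h.integrable_inner_defect hs hc.momentum
  have h2 := h.integrable_inner_defect hs hδ
  have h3 : ∀ ε : ℝ, action D T ν P W S u X (ξ + ε • δξ) =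
      ((∫ t in (0 : ℝ)..T, (1 / 2) * pairL2 D (S (u t)) (u t)) +
        ∫ z, ⟪ξ z.2.1 z.1 z.2.2, defect T u X (noise ν W) z.2.1 z.1 z.2.2⟫_ℝ
          ∂(tripleMeasure D T P)) +
      ε * ∫ z, ⟪δξ z.2.1 z.1 z.2.2, defect T u X (noise ν W) z.2.1 z.1 z.2.2⟫_ℝ
        ∂(tripleMeasure D T P) := by
    intro ε
    have e1 : ∀ z : ℝ × (Ω × E d), ⟪(ξ + ε • δξ) z.2.1 z.1 z.2.2,
        timeDeriv T (X z.2.1) z.1 z.2.2 - u z.1 (noisyFlow ν W X z.2.1 z.1 z.2.2)⟫_ℝ =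
        ⟪ξ z.2.1 z.1 z.2.2, defect T u X (noise ν W) z.2.1 z.1 z.2.2⟫_ℝ +
        ε * ⟪δξ z.2.1 z.1 z.2.2, defect T u X (noise ν W) z.2.1 z.1 z.2.2⟫_ℝ := by
      intro z
      rw [← real_inner_smul_left, ← inner_add_left]
      rfl
    rw [action_eq hS hc.velocity hs hT]
    · rw [integral_congr_ae (Eventually.of_forall e1), integral_add h1 (h2.const_mul ε),
        integral_const_mul, add_assoc]
    · exact (h1.add (h2.const_mul ε)).congr (Eventually.of_forall fun z => (e1 z).symm)
  have h4 := hc.var_momentum δξ hδ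
  simp only [h3] at h4
  have h5 := ((hasDerivAt_id (0 : ℝ)).mul_const (∫ z, ⟪δξ z.2.1 z.1 z.2.2,
    defect T u X (noise ν W) z.2.1 z.1 z.2.2⟫_ℝ ∂(tripleMeasure D T P))).const_add
    ((∫ t in (0 : ℝ)..T, (1 / 2) * pairL2 D (S (u t)) (u t)) +
        ∫ z, ⟪ξ z.2.1 z.1 z.2.2, defect T u X (noise ν W) z.2.1 z.1 z.2.2⟫_ℝ
          ∂(tripleMeasure D T P))
  simpa using (h4.unique h5).symm

theorem IsCritical.ae_defect_eq_zero (hc : IsCritical D s T ν P W S u X ξ)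
    (hW : IsBrownianMotion W P) (hS : IsInertia D (s + 1) S) (hs : 1 + (d : ℝ) / 2 < s)
    (hT : 0 < T) : ∀ᵐ ω ∂P, ∀ t ∈ Icc 0 T, ∀ x, defect T u X (noise ν W) ω t x = 0 := by
  obtain ⟨Cu, C, h⟩ := hc.exists_isFlowSystem hW hs hT
  exact h.ae_defect_eq_zero hs fun δξ hδ => hc.integral_inner_defect hW hS hs hT δξ hδ

theorem IsCritical.ae_momentumDefect_eq_zero (hc : IsCritical D s T ν P W S u X ξ)
    (hW : IsBrownianMotion W P) (hS : IsInertia D (s + 1) S) (hs : 1 + (d : ℝ) / 2 < s)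
    (hT : 0 < T) :
    ∀ᵐ ω ∂P, ∀ t ∈ Icc 0 T, ∀ x, momentumDefect T u X ξ (noise ν W) ω t x = 0 := by
  obtain ⟨Cu, C, h⟩ := hc.exists_isFlowSystem hW hs hT
  refine h.ae_momentumDefect_eq_zero hs hc.momentum fun φ hφ A hA θ hθ => ?_
  obtain ⟨hF, -, hder⟩ := h.hasDerivAt_coupling hs hc.momentum hθ hφ hA
  have hvar := hc.var_configuration _ (isRandomTest_separable hT hθ hφ hA)
  set F : ℝ → Ω → ℝ → E d → ℝ := fun ε ω t x => ⟪ξ ω t x,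
      ε • (A.indicator 1 ω : ℝ) • testRate T (X ω) θ φ t x -
        (u t (X ω t x + noise ν W ω t + ε • (A.indicator 1 ω : ℝ) • θ t • φ (X ω t x)) -
        u t (X ω t x + noise ν W ω t))⟫_ℝ with hFdef
  let Xε : ℝ → Ω → ℝ → E d → E d := fun ε ω t x =>
    X ω t x + ε • (A.indicator 1 ω : ℝ) • θ t • φ (X ω t x)
  let G : ℝ → Ω → ℝ → E d → ℝ := fun ε ω t x =>
    ⟪ξ ω t x, timeDeriv T (Xε ε ω) t x - u t (noisyFlow ν W (Xε ε) ω t x)⟫_ℝ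
  -- By the kinematic equation the unperturbed coupling integrand vanishes, so the increment is the
  -- full integrand.
  have e1 : ∀ ε : ℝ, (fun z : ℝ × (Ω × E d) => F ε z.2.1 z.1 z.2.2) =ᵐ[tripleMeasure D T P]
      fun z => G ε z.2.1 z.1 z.2.2 := by
    intro ε
    refine ae_triple_of_ae (p := fun ω t x => F ε ω t x = G ε ω t x) ?_
    filter_upwards [h.flow, hc.ae_defect_eq_zero hW hS hs hT] with ω h1 h2 t ht x
    have h3 : timeDeriv T (X ω) t x = u t (X ω t x + noise ν W ω t) := sub_eq_zero.1 (h2 t ht x)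
    have h4 : timeDeriv T (Xε ε ω) t x = _ := timeDeriv_perturbed hT h1.regular hθ hφ ε _ ht x
    have h5 : noisyFlow ν W (Xε ε) ω t x =
        X ω t x + noise ν W ω t + ε • (A.indicator 1 ω : ℝ) • θ t • φ (X ω t x) :=
      add_right_comm _ _ _
    simp only [hFdef, G]
    rw [h4, h5, h3]
    congr 1
    abel
  have e2 : ∀ ε : ℝ, action D T ν P W S u (Xε ε) ξ =
      (∫ t in (0 : ℝ)..T, (1 / 2) * pairL2 D (S (u t)) (u t)) +
        ∫ z, F ε z.2.1 z.1 z.2.2 ∂(tripleMeasure D T P) := by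
    intro ε
    have hG : Integrable (fun z : ℝ × (Ω × E d) => G ε z.2.1 z.1 z.2.2) (tripleMeasure D T P) :=
      (hF ε).congr (e1 ε)
    rw [integral_congr_ae (e1 ε)]
    exact action_eq hS hc.velocity hs hT hG
  have hvar' : HasDerivAt (fun ε => action D T ν P W S u (Xε ε) ξ) 0 0 := hvar
  rw [funext e2] at hvar'
  have hder' := hder.const_add (∫ t in (0 : ℝ)..T, (1 / 2) * pairL2 D (S (u t)) (u t))
  exact hder'.unique hvar'

/-- The noise is constant in space and disappears from ∇X, so ∂_t ∇X = ∇u(X^ν) ∇X holds pathwise in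
the classical sense. Together with the momentum equation the derivative is ⟨-(∇u)^* ξ, ∇X e⟩ + ⟨ξ,
∇u ∇X e⟩ = 0, and at time zero ∇X is the identity. -/
theorem IsCritical.ae_conservation (hc : IsCritical D s T ν P W S u X ξ)
    (hW : IsBrownianMotion W P) (hS : IsInertia D (s + 1) S) (hs : 1 + (d : ℝ) / 2 < s)
    (hT : 0 < T) (hX0 : ∀ᵐ ω ∂P, X ω 0 = id) {ξ₀ : E d → E d} (hξ₀ : ∀ᵐ ω ∂P, ξ ω 0 = ξ₀) :
    ∀ᵐ ω ∂P, ∀ t ∈ Icc 0 T, ∀ x e, ⟪ξ ω t x, fderiv ℝ (X ω t) x e⟫_ℝ = ⟪ξ₀ x, e⟫_ℝ := by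
  obtain ⟨Cu, C, h⟩ := hc.exists_isFlowSystem hW hs hT
  obtain ⟨R, -, hξb⟩ := hc.momentum.exists_isBddMomentum hs
  filter_upwards [h.flow, hξb, hc.ae_defect_eq_zero hW hS hs hT,
    hc.ae_momentumDefect_eq_zero hW hS hs hT, hX0, hξ₀] with ω h1 h2 h3 h4 h5 h6 t ht x e
  have hd : ∀ τ ∈ Icc 0 T, HasDerivWithinAt
      (fun τ => ⟪ξ ω τ x, fderiv ℝ (X ω τ) x e⟫_ℝ) 0 (Icc 0 T) τ := by
    intro τ hτ
    have k1 := h2.regular.deriv τ hτ x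
    have k2 := (h1.regular.deriv_fderiv τ hτ x).clm_apply (hasDerivWithinAt_const τ (Icc 0 T) e)
    have k3 := k1.inner ℝ k2
    have k4 : timeDeriv T (X ω) τ = fun y => u τ (X ω τ y + noise ν W ω τ) :=
      funext fun y => sub_eq_zero.1 (h3 τ hτ y)
    -- The kinematic equation is an identity between functions of x, so it may be differentiated in
    -- space by the chain rule.
    have k5 : fderiv ℝ (timeDeriv T (X ω) τ) x =
        (fderiv ℝ (u τ) (X ω τ x + noise ν W ω τ)).comp (fderiv ℝ (X ω τ) x) := by
      rw [k4]
      have m1 := (h1.regular.contDiff τ hτ).differentiable (by norm_num) x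
      have m2 := (h.vel.contDiff τ hτ).differentiable (by norm_num) (X ω τ x + noise ν W ω τ)
      have m3 := (m2.hasFDerivAt.comp x (m1.hasFDerivAt.add_const (noise ν W ω τ))).fderiv
      exact m3
    have k6 : timeDeriv T (ξ ω) τ x = -ContinuousLinearMap.adjoint
        (fderiv ℝ (u τ) (X ω τ x + noise ν W ω τ)) (ξ ω τ x) :=
      eq_neg_of_add_eq_zero_left (h4 τ hτ x)
    have k7 : ⟪ξ ω τ x, (fderiv ℝ (timeDeriv T (X ω) τ) x) e + (fderiv ℝ (X ω τ) x) 0⟫_ℝ +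
        ⟪timeDeriv T (ξ ω) τ x, (fderiv ℝ (X ω τ) x) e⟫_ℝ = 0 := by
      rw [k5, k6]
      simp [inner_neg_left, ContinuousLinearMap.adjoint_inner_left]
    rwa [k7] at k3
  have hconst := constant_of_has_deriv_right_zero
    (f := fun τ => ⟪ξ ω τ x, fderiv ℝ (X ω τ) x e⟫_ℝ) (a := 0) (b := T)
    (fun τ hτ => (hd τ hτ).continuousWithinAt)
    (fun τ hτ => (hd τ ⟨hτ.1, hτ.2.le⟩).mono_of_mem_nhdsWithin (Icc_mem_nhdsGE_of_mem hτ)) t ht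
  rw [hconst, h5, h6]
  simp

end Critical

end Kelvin

end

/-! ### Divergence-free measures tested against C¹ potentials. -/

noncomputable section

open scoped Convolution

namespace Kelvin

variable {d : ℕ}

section DivFree

/-- Mollification of a scalar function. -/
def mollify (φ : ContDiffBump (0 : E d)) (p : E d → ℝ) (x : E d) : ℝ :=
  ∫ y, φ.normed volume y * p (x - y)

theorem mollify_eq_convolution (φ : ContDiffBump (0 : E d)) (p : E d → ℝ) :
    mollify φ p = (φ.normed volume ⋆[ContinuousLinearMap.lsmul ℝ ℝ, volume] p) := rfl

theorem isTest_mollify {D : Domain} (φ : ContDiffBump (0 : E d)) {p : E d → ℝ}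
    (hp : Continuous p) (hpo : IsOn D p) (hps : HasCompactSupp D p) :
    IsTest D (mollify φ p) := by
  refine ⟨?_, ?_, ?_⟩
  · rw [mollify_eq_convolution]
    exact φ.hasCompactSupport_normed.contDiff_convolution_left _ φ.contDiff_normed
      hp.locallyIntegrable
  · cases D
    · trivial
    · intro x k
      refine integral_congr_ae (Eventually.of_forall fun y => ?_)
      simp only
      rw [add_sub_right_comm, hpo]
  · cases D
    · have h : HasCompactSupport p := hps
      rw [mollify_eq_convolution]
      exact φ.hasCompactSupport_normed.convolution _ h
    · trivial

theorem hasFDerivAt_mollify (φ : ContDiffBump (0 : E d)) {p : E d → ℝ} (hp : ContDiff ℝ 1 p)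
    {L : ℝ} (hL : ∀ x, ‖fderiv ℝ p x‖ ≤ L) (x : E d) :
    HasFDerivAt (mollify φ p) (∫ y, φ.normed volume y • fderiv ℝ p (x - y)) x := by
  have hφc : Continuous (φ.normed volume) := φ.continuous_normed
  have hφs : HasCompactSupport (φ.normed volume) := φ.hasCompactSupport_normed
  have hpc : Continuous (fderiv ℝ p) := hp.continuous_fderiv (by norm_num)
  refine hasFDerivAt_integral_of_dominated_of_fderiv_le (s := univ)
    (F := fun x y => φ.normed volume y * p (x - y))
    (F' := fun x y => φ.normed volume y • fderiv ℝ p (x - y))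
    (bound := fun y => φ.normed volume y * L) univ_mem
    (Eventually.of_forall fun x => ?_) ?_ ?_ ?_ ?_ ?_
  · exact (hφc.mul (hp.continuous.comp (by fun_prop))).aestronglyMeasurable
  · exact (hφc.mul (hp.continuous.comp (by fun_prop))).integrable_of_hasCompactSupport
      hφs.mul_right
  · exact (hφc.smul (hpc.comp (by fun_prop))).aestronglyMeasurable
  · refine Eventually.of_forall fun y x _ => ?_
    rw [norm_smul, Real.norm_of_nonneg (φ.nonneg_normed y)]
    exact mul_le_mul_of_nonneg_left (hL _) (φ.nonneg_normed y)
  · exact (hφc.mul continuous_const).integrable_of_hasCompactSupport hφs.mul_right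
  · refine Eventually.of_forall fun y x _ => ?_
    have h1 := ((hp.differentiable (by norm_num) (x - y)).hasFDerivAt.comp x
      ((hasFDerivAt_id x).sub_const y)).const_mul (φ.normed volume y)
    simpa using h1

theorem norm_fderiv_mollify_le (φ : ContDiffBump (0 : E d)) {p : E d → ℝ} (hp : ContDiff ℝ 1 p)
    {L : ℝ} (hL : ∀ x, ‖fderiv ℝ p x‖ ≤ L) (x : E d) : ‖fderiv ℝ (mollify φ p) x‖ ≤ L := by
  rw [(hasFDerivAt_mollify φ hp hL x).fderiv]
  have h1 : ∫ y, φ.normed volume y * L = L := by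
    rw [integral_mul_const, φ.integral_normed, one_mul]
  calc _ ≤ ∫ y, φ.normed volume y * L := by
        refine norm_integral_le_of_norm_le
          ((φ.continuous_normed.mul continuous_const).integrable_of_hasCompactSupport
            φ.hasCompactSupport_normed.mul_right) (Eventually.of_forall fun y => ?_)
        rw [norm_smul, Real.norm_of_nonneg (φ.nonneg_normed y)]
        exact mul_le_mul_of_nonneg_left (hL _) (φ.nonneg_normed y)
    _ = L := h1

/-- A sequence of bump functions with shrinking supports. -/
def shrinkingBump (d : ℕ) (n : ℕ) : ContDiffBump (0 : E d) :=
  ⟨1 / (2 * ((n : ℝ) + 1)), 1 / ((n : ℝ) + 1), by positivity, by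
    apply one_div_lt_one_div_of_lt <;> nlinarith [(Nat.cast_nonneg n : (0 : ℝ) ≤ n)]⟩

theorem tendsto_fderiv_mollify {p : E d → ℝ} (hp : ContDiff ℝ 1 p)
    {L : ℝ} (hL : ∀ x, ‖fderiv ℝ p x‖ ≤ L) (x : E d) :
    Tendsto (fun n => fderiv ℝ (mollify (shrinkingBump d n) p) x) atTop (𝓝 (fderiv ℝ p x)) := by
  have h := ContDiffBump.convolution_tendsto_right_of_continuous (μ := (volume : Measure (E d)))
    (φ := shrinkingBump d) (l := atTop) tendsto_one_div_add_atTop_nhds_zero_nat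
    (hp.continuous_fderiv (by norm_num)) x
  refine h.congr fun n => ?_
  rw [(hasFDerivAt_mollify _ hp hL x).fderiv]
  rfl

/-- The gradient part of the definition of a divergence-free measure, for a measure with density. -/
def AnnihilatesGradients (D : Domain) (m : Measure (E d)) (h : E d → E d) : Prop :=
  ∀ φ : E d → ℝ, IsTest D φ → ∫ x, fderiv ℝ φ x (h x) ∂m = 0

theorem tendsto_integral_fderiv {m : Measure (E d)} {h : E d → E d} (hh : Integrable h m)
    {p : ℕ → E d → ℝ} {q : E d → ℝ} {L : ℝ}
    (hL : ∀ n x, ‖fderiv ℝ (p n) x‖ ≤ L)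
    (hlim : ∀ x, Tendsto (fun n => fderiv ℝ (p n) x) atTop (𝓝 (fderiv ℝ q x))) :
    Tendsto (fun n => ∫ x, fderiv ℝ (p n) x (h x) ∂m) atTop (𝓝 (∫ x, fderiv ℝ q x (h x) ∂m)) := by
  refine tendsto_integral_of_dominated_convergence (fun x => L * ‖h x‖) (fun n => ?_)
    (hh.norm.const_mul _) (fun n => Eventually.of_forall fun x => ?_)
    (Eventually.of_forall fun x => ?_)
  · exact (ContinuousLinearMap.id ℝ (E d →L[ℝ] ℝ)).aestronglyMeasurable_comp₂
      (measurable_fderiv ℝ (p n)).stronglyMeasurable.aestronglyMeasurable hh.1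
  · exact (ContinuousLinearMap.le_opNorm _ _).trans
      (mul_le_mul_of_nonneg_right (hL n x) (norm_nonneg _))
  · exact ((ContinuousLinearMap.apply ℝ ℝ (h x)).continuous.tendsto _).comp (hlim x)

/-- Mollification keeps the gradient bound and gives pointwise convergence of gradients, so
dominated convergence passes from smooth to C¹ test functions. -/
theorem AnnihilatesGradients.of_compactSupp {D : Domain} {m : Measure (E d)} {h : E d → E d}
    (hh : Integrable h m) (ha : AnnihilatesGradients D m h) {p : E d → ℝ} (hp : ContDiff ℝ 1 p)
    (hpo : IsOn D p) (hps : HasCompactSupp D p) {L : ℝ} (hL : ∀ x, ‖fderiv ℝ p x‖ ≤ L) :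
    ∫ x, fderiv ℝ p x (h x) ∂m = 0 := by
  refine tendsto_nhds_unique (tendsto_integral_fderiv hh
    (fun n x => norm_fderiv_mollify_le (shrinkingBump d n) hp hL x)
    (fun x => tendsto_fderiv_mollify hp hL x)) ?_
  simp only [ha _ (isTest_mollify _ hp.continuous hpo hps)]
  exact tendsto_const_nhds

/-- Smooth cut-off functions on expanding balls. -/
def cutoff (d : ℕ) : ContDiffBump (0 : E d) := ⟨1, 2, by norm_num, by norm_num⟩

/-- On the whole space the potential need not have compact support, as happens for the potentials
met in the Leray step. It grows at most linearly, and a cut-off at radius 1/r has gradient of order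
r, so the gradients of the truncated potentials stay bounded and converge pointwise. -/
theorem AnnihilatesGradients.integral_eq_zero {D : Domain} {m : Measure (E d)} {h : E d → E d}
    (hh : Integrable h m) (ha : AnnihilatesGradients D m h) {p : E d → ℝ} (hp : ContDiff ℝ 1 p)
    (hpo : IsOn D p) {L : ℝ} (hL : ∀ x, ‖fderiv ℝ p x‖ ≤ L) :
    ∫ x, fderiv ℝ p x (h x) ∂m = 0 := by
  cases D
  · have hL0 : 0 ≤ L := (norm_nonneg _).trans (hL 0)
    let χ := cutoff d
    obtain ⟨M, hM⟩ := (HasCompactSupport.fderiv (𝕜 := ℝ)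
      χ.hasCompactSupport).exists_bound_of_continuous
      ((χ.contDiff (n := 1)).continuous_fderiv (by norm_num))
    have hM0 : 0 ≤ M := (norm_nonneg _).trans (hM 0)
    let r : ℕ → ℝ := fun n => ((n : ℝ) + 1)⁻¹
    have hr : ∀ n, 0 < r n := fun n => by positivity
    -- Subtracting the value at the origin leaves the gradient alone and gives the bound L‖x‖.
    let q : E d → ℝ := fun x => p x - p 0
    have hq : ContDiff ℝ 1 q := hp.sub contDiff_const
    have hqd : ∀ x, fderiv ℝ q x = fderiv ℝ p x := fun x => fderiv_sub_const _
    have hqn : ∀ x, ‖q x‖ ≤ L * ‖x‖ := by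
      intro x
      have := convex_univ.norm_image_sub_le_of_norm_fderiv_le (𝕜 := ℝ)
        (fun x _ => hp.differentiable (by norm_num) x) (fun x _ => hL x) (mem_univ 0) (mem_univ x)
      simpa using this
    let χr : ℕ → E d → ℝ := fun n x => χ (r n • x)
    have hχr : ∀ n, ContDiff ℝ 1 (χr n) := fun n =>
      χ.contDiff.comp (contDiff_const_smul (r n))
    have hχrd : ∀ n x, fderiv ℝ (χr n) x = r n • fderiv ℝ χ (r n • x) := by
      intro n x
      have h1 := ((χ.contDiff (n := 1)).differentiable (by norm_num) (r n • x)).hasFDerivAt.comp x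
        ((hasFDerivAt_id x).const_smul (r n))
      refine h1.fderiv.trans ?_
      ext v
      simp
    have hpn : ∀ n, ContDiff ℝ 1 fun x => χr n x * q x := fun n => (hχr n).mul hq
    have hpd : ∀ n x, fderiv ℝ (fun x => χr n x * q x) x =
        χr n x • fderiv ℝ p x + q x • (r n • fderiv ℝ χ (r n • x)) := by
      intro n x
      rw [fderiv_fun_mul ((hχr n).differentiable (by norm_num) x)
        (hq.differentiable (by norm_num) x), hqd, hχrd]
    have hzero : ∀ n x, 2 < ‖r n • x‖ → fderiv ℝ χ (r n • x) = 0 := by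
      intro n x hx
      refine image_eq_zero_of_notMem_tsupport fun hmem => ?_
      have h1 := tsupport_fderiv_subset ℝ hmem
      rw [χ.tsupport_eq] at h1
      have : ‖r n • x‖ ≤ 2 := mem_closedBall_zero_iff.1 h1
      linarith
    have hbound : ∀ n x, ‖fderiv ℝ (fun x => χr n x * q x) x‖ ≤ L + 2 * L * M := by
      intro n x
      rw [hpd]
      refine (norm_add_le _ _).trans (add_le_add ?_ ?_)
      · rw [norm_smul, Real.norm_of_nonneg χ.nonneg]
        exact (mul_le_mul χ.le_one (hL x) (norm_nonneg _) zero_le_one).trans_eq (one_mul _)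
      · by_cases hx : 2 < ‖r n • x‖
        · rw [hzero n x hx, smul_zero, smul_zero, norm_zero]; positivity
        · rw [norm_smul, norm_smul]
          -- On the support of the cut-off gradient ‖r x‖ ≤ 2, so linear growth is compensated by
          -- the factor r.
          have h1 : ‖q x‖ * ‖r n‖ ≤ 2 * L := by
            calc ‖q x‖ * ‖r n‖ ≤ (L * ‖x‖) * ‖r n‖ :=
                  mul_le_mul_of_nonneg_right (hqn x) (norm_nonneg _)
              _ = L * ‖r n • x‖ := by rw [norm_smul]; ring
              _ ≤ L * 2 := mul_le_mul_of_nonneg_left (not_lt.1 hx) hL0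
              _ = _ := by ring
          rw [← mul_assoc]
          exact mul_le_mul h1 (hM _) (norm_nonneg _) (by positivity)
    refine tendsto_nhds_unique (tendsto_integral_fderiv hh (q := p) hbound fun x => ?_) ?_
    · refine tendsto_const_nhds.congr' ?_
      have hlim : Tendsto (fun n => ‖r n • x‖) atTop (𝓝 0) := by
        have h1 : Tendsto r atTop (𝓝 0) := by
          simpa [r, one_div] using tendsto_one_div_add_atTop_nhds_zero_nat (𝕜 := ℝ)
        simpa using (h1.smul_const x).norm
      filter_upwards [hlim.eventually (gt_mem_nhds zero_lt_one)] with n hn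
      rw [hpd]
      have h1 : χr n x = 1 := χ.one_of_mem_closedBall (mem_closedBall_zero_iff.2 hn.le)
      have h2 : fderiv ℝ χ (r n • x) = 0 := by
        have h3 : (χ : E d → ℝ) =ᶠ[𝓝 (r n • x)] fun _ => 1 :=
          χ.eventuallyEq_one_of_mem_ball (mem_ball_zero_iff.2 hn)
        rw [h3.fderiv_eq]
        simp
      rw [h1, h2]; simp
    · have h1 : ∀ n, ∫ x, fderiv ℝ (fun x => χr n x * q x) x (h x) ∂m = 0 := by
        intro n
        refine ha.of_compactSupp hh (hpn n) trivial ?_ (hbound n)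
        have h2 : HasCompactSupport (χr n) := χ.hasCompactSupport.comp_smul (hr n).ne'
        exact h2.mul_right
      simp only [h1]
      exact tendsto_const_nhds
  · exact ha.of_compactSupp hh hp hpo trivial hL

theorem inner_gradient (φ : E d → ℝ) (x v : E d) : ⟪gradient φ x, v⟫_ℝ = fderiv ℝ φ x v := by
  rw [gradient, InnerProductSpace.toDual_symm_apply]

theorem IsTest.exists_bound_gradient {D : Domain} {φ : E d → ℝ} (hφ : IsTest D φ) :
    StronglyMeasurable (gradient φ) ∧ ∃ C, ∀ x, ‖gradient φ x‖ ≤ C := by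
  obtain ⟨M, -, -, hM⟩ := hφ.exists_bound
  refine ⟨?_, M, fun x => ?_⟩
  · have h1 : Continuous (gradient φ) :=
      (InnerProductSpace.toDual ℝ (E d)).symm.continuous.comp hφ.fderiv.1.continuous
    exact h1.stronglyMeasurable
  · rw [gradient, LinearIsometryEquiv.norm_map]
    exact hM x

theorem fold_eq_sub (D : Domain) (x : E d) : ∃ k ∈ lattice d D, fold D x = x - k := by
  cases D
  · exact ⟨0, rfl, by simp [fold]⟩
  · refine ⟨intPoint fun i => ⌊x i⌋, ⟨_, rfl⟩, ?_⟩
    ext i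
    rfl

theorem IsOn.fold {V : Type*} {D : Domain} {f : E d → V} (hf : IsOn D f) (x : E d) :
    f (fold D x) = f x := by
  obtain ⟨k, hk, h⟩ := fold_eq_sub D x
  rw [h, hf.sub_lattice hk]

theorem fold_mem_cell (D : Domain) (x : E d) : fold D x ∈ cell d D := by
  cases D
  · trivial
  · exact fun i => ⟨Int.fract_nonneg _, Int.fract_lt_one _⟩

/-- Criterion for the image of a measure with density to be divergence-free. -/
theorem isDivFreeMeasure_map {α : Type*} [MeasurableSpace α] {M : Measure α} {D : Domain}
    {g : α → E d} (hg : Integrable g M) {F : α → E d} (hF : Measurable F)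
    (h : ∀ φ : E d → ℝ, IsTest D φ → ∫ z, fderiv ℝ φ (F z) (g z) ∂M = 0) :
    IsDivFreeMeasure D ((M.withDensityᵥ g).map fun z => fold D (F z)) := by
  have hfF : Measurable fun z => fold D (F z) := (measurable_fold D).comp hF
  refine ⟨fun B hB => ?_, fun φ hφ => ?_⟩
  · by_cases hBm : MeasurableSet B
    · rw [VectorMeasure.map_apply _ hfF hBm]
      have : (fun z => fold D (F z)) ⁻¹' B = ∅ := by
        ext z
        simp only [mem_preimage, mem_empty_iff_false, iff_false]
        exact fun hz => (disjoint_left.1 hB) hz (fold_mem_cell D _)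
      rw [this, VectorMeasure.empty]
    · exact VectorMeasure.not_measurable _ hBm
  · obtain ⟨h1, C, h2⟩ := hφ.exists_bound_gradient
    rw [pairMeasure_map_withDensityᵥ hg hfF h1 h2, ← h φ hφ]
    refine integral_congr_ae (Eventually.of_forall fun z => ?_)
    simp only [inner_gradient]
    rw [hφ.2.1.fderiv.fold]

theorem IsDivFreeMeasure.annihilatesGradients {D : Domain} {m : Measure (E d)} {h : E d → E d}
    (hh : Integrable h m) (hμ : IsDivFreeMeasure D (m.withDensityᵥ h)) :
    AnnihilatesGradients D m h := by
  intro φ hφ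
  obtain ⟨h1, C, h2⟩ := hφ.exists_bound_gradient
  rw [← hμ.2 φ hφ, pairMeasure_withDensityᵥ hh h1 h2]
  simp only [inner_gradient]

/-- By the chain rule the integrand is the derivative of φ ∘ Φ along h. This potential is only C¹,
with bounded gradient, which is why the class of admissible potentials was enlarged. -/
theorem AnnihilatesGradients.comp {D : Domain} {m : Measure (E d)} {h : E d → E d}
    (hh : Integrable h m) (ha : AnnihilatesGradients D m h) {Φ : E d → E d}
    (hΦ : ContDiff ℝ 1 Φ) {C : ℝ} (hC : ∀ x, ‖fderiv ℝ Φ x‖ ≤ C)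
    (hΦo : IsOn D fun x => Φ x - x) {φ : E d → ℝ} (hφ : IsTest D φ) :
    ∫ x, fderiv ℝ φ (Φ x) (fderiv ℝ Φ x (h x)) ∂m = 0 := by
  obtain ⟨M, hM0, -, hM⟩ := hφ.exists_bound
  have h1 : ∀ x, fderiv ℝ (fun y => φ (Φ y)) x = (fderiv ℝ φ (Φ x)).comp (fderiv ℝ Φ x) := fun x =>
    ((hφ.1.differentiable (by simp) (Φ x)).hasFDerivAt.comp x
      (hΦ.differentiable (by norm_num) x).hasFDerivAt).fderiv
  have h2 := ha.integral_eq_zero hh (p := fun y => φ (Φ y)) ((hφ.1.of_le (mod_cast le_top)).comp hΦ)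
    (hφ.2.1.comp_of_sub_id hΦo) (L := M * C) (fun x => by
      rw [h1]
      exact (ContinuousLinearMap.opNorm_comp_le _ _).trans
        (mul_le_mul (hM _) (hC x) (norm_nonneg _) hM0))
  simpa [h1] using h2

theorem isDivFreeMeasure_pushMeasure {D : Domain} {m : Measure (E d)} {h : E d → E d}
    (hh : Integrable h m) (ha : AnnihilatesGradients D m h) {Φ : E d → E d}
    (hΦ : ContDiff ℝ 1 Φ) {C : ℝ} (hC : ∀ x, ‖fderiv ℝ Φ x‖ ≤ C)
    (hΦo : IsOn D fun x => Φ x - x) : IsDivFreeMeasure D (pushMeasure D Φ (m.withDensityᵥ h)) := by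
  rw [pushMeasure_withDensityᵥ hh D hC]
  exact isDivFreeMeasure_map (integrable_fderiv_apply hh hC) hΦ.continuous.measurable
    fun φ hφ => ha.comp hh hΦ hC hΦo hφ

theorem pairMeasure_pushMeasure {D : Domain} {m : Measure (E d)} {h : E d → E d}
    (hh : Integrable h m) {Φ : E d → E d} (hΦ : Continuous Φ) {C : ℝ}
    (hC : ∀ x, ‖fderiv ℝ Φ x‖ ≤ C) {ψ : E d → E d} (hψ : StronglyMeasurable ψ) {K : ℝ}
    (hK : ∀ x, ‖ψ x‖ ≤ K) (hψo : IsOn D ψ) :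
    pairMeasure ψ (pushMeasure D Φ (m.withDensityᵥ h)) =
      ∫ x, ⟪ψ (Φ x), fderiv ℝ Φ x (h x)⟫_ℝ ∂m := by
  have hF : Measurable fun x => fold D (Φ x) := (measurable_fold D).comp hΦ.measurable
  rw [pushMeasure_withDensityᵥ hh D hC, pairMeasure_map_withDensityᵥ (integrable_fderiv_apply hh hC)
    hF hψ hK]
  refine integral_congr_ae (Eventually.of_forall fun x => ?_)
  simp only [hψo.fold]

end DivFree

end Kelvin

end

/-! ### The pathwise Kelvin theorem. -/

noncomputable section

namespace Kelvin

variable {d : ℕ}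

section Pathwise

/-- A bi-Lipschitz `C¹` diffeomorphism `Φ` of the domain with inverse `A`. -/
structure IsBddDiffeo (D : Domain) (C : ℝ) (Φ A : E d → E d) : Prop where
  contDiff : ContDiff ℝ 1 Φ
  contDiff_inv : ContDiff ℝ 1 A
  leftInverse : Function.LeftInverse A Φ
  rightInverse : Function.RightInverse A Φ
  fderiv_le : ∀ x, ‖fderiv ℝ Φ x‖ ≤ C
  inv_fderiv_le : ∀ x, ‖fderiv ℝ A x‖ ≤ C
  isOn : IsOn D fun x => Φ x - x
  isOn_inv : IsOn D fun x => A x - x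

theorem IsBddDiffeo.fderiv_apply_inv {D : Domain} {C : ℝ} {Φ A : E d → E d}
    (h : IsBddDiffeo D C Φ A) (y w : E d) : fderiv ℝ Φ (A y) (fderiv ℝ A y w) = w := by
  have h1 := (h.contDiff.differentiable (by norm_num) (A y)).hasFDerivAt.comp y
    (h.contDiff_inv.differentiable (by norm_num) y).hasFDerivAt
  have h2 : Φ ∘ A = id := h.rightInverse.comp_eq_id
  rw [h2] at h1
  have h3 := h1.unique (hasFDerivAt_id y)
  exact congrArg (fun L : E d →L[ℝ] E d => L w) h3

theorem IsBddFlow.isBddDiffeo {D : Domain} {T C : ℝ} {X : ℝ → E d → E d} (hX : IsBddFlow D T C X)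
    {t : ℝ} (ht : t ∈ Icc 0 T) (c : E d) :
    IsBddDiffeo D C (fun x => X t x + c) (Function.invFun fun x => X t x + c) := by
  have hb := bijective_add_const (hX.bij t ht) c
  have h1 := Function.leftInverse_invFun hb.1
  have h2 := Function.rightInverse_invFun hb.2
  have hi := invFun_add_const (hX.bij t ht) c
  have ho : IsOn D fun x => X t x + c - x := hX.isOn_noisy ht c
  refine ⟨(hX.regular.contDiff t ht).add contDiff_const, ?_, h1, h2, fun x => ?_, fun x => ?_, ho,
    ho.sub_id_inverse h2 h1⟩
  · rw [hi]
    exact (hX.contDiff_inv t ht).comp (contDiff_id.sub contDiff_const)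
  · rw [fderiv_add_const]
    exact hX.fderiv_le t ht x
  · rw [hi, fderiv_comp_sub]
    exact hX.inv_fderiv_le t ht _

variable {Ω : Type*} [MeasurableSpace Ω] {P : Measure Ω} {D : Domain} {T Cu C : ℝ}
  {u : ℝ → E d → E d} {X ξ : Ω → ℝ → E d → E d} {s ν : ℝ} {W : ℝ≥0 → Ω → E d}
  {S : (E d → E d) → Lp (E d) 2 (vol d D)}

theorem ae_isBddDiffeo (hX : ∀ᵐ ω ∂P, IsBddFlow D T C (X ω)) (ν : ℝ) (W : ℝ≥0 → Ω → E d) :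
    ∀ᵐ ω ∂P, ∀ t ∈ Icc 0 T, IsBddDiffeo D C (noisyFlow ν W X ω t) (backToLabel ν W X ω t) :=
  hX.mono fun _ h _ ht => h.isBddDiffeo ht _

/-- A bounded continuous field on the domain. -/
structure IsBddField (D : Domain) (K : ℝ) (f : E d → E d) : Prop where
  continuous : Continuous f
  isOn : IsOn D f
  norm_le : ∀ x, ‖f x‖ ≤ K

theorem IsBddMomentum.isBddField {R : ℝ} {ξ : ℝ → E d → E d} (h : IsBddMomentum D T R ξ) {t : ℝ}
    (ht : t ∈ Icc 0 T) : IsBddField D R (ξ t) :=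
  ⟨(h.regular.contDiff t ht).continuous, h.isOn t ht,
    fun x => norm_le_of_strongNorm_le (h.strong_le t ht) h.nonneg x⟩

theorem IsBddField.comp {K : ℝ} {f : E d → E d} (h : IsBddField D K f) {A : E d → E d}
    (hA : Continuous A) (ho : IsOn D fun x => A x - x) : IsBddField D K fun x => f (A x) :=
  ⟨h.continuous.comp hA, h.isOn.comp_of_sub_id ho, fun _ => h.norm_le _⟩

theorem IsMomentum.exists_isBddField_initial [NeZero P] (h : IsMomentum D s T P ξ)
    (hs : 1 + (d : ℝ) / 2 < s) (hT : 0 < T) {ξ₀ : E d → E d} (hξ₀ : ∀ᵐ ω ∂P, ξ ω 0 = ξ₀) :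
    ∃ K, 0 ≤ K ∧ IsBddField D K ξ₀ := by
  obtain ⟨R, -, hR⟩ := h.exists_isBddMomentum hs
  obtain ⟨ω, h1, h2⟩ := (hR.and hξ₀).exists
  exact ⟨R ω, h1.nonneg, h2 ▸ h1.isBddField (left_mem_Icc.2 hT.le)⟩

/-- The transported momentum in terms of the initial momentum and the back-to-label map. -/
theorem IsCritical.ae_transport [IsProbabilityMeasure P] (hc : IsCritical D s T ν P W S u X ξ)
    (hW : IsBrownianMotion W P) (hS : IsInertia D (s + 1) S) (hs : 1 + (d : ℝ) / 2 < s)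
    (hT : 0 < T) (hX0 : ∀ᵐ ω ∂P, X ω 0 = id) {ξ₀ : E d → E d} (hξ₀ : ∀ᵐ ω ∂P, ξ ω 0 = ξ₀) :
    ∀ᵐ ω ∂P, ∀ t ∈ Icc 0 T, ∀ y w, ⟪ξ ω t (backToLabel ν W X ω t y), w⟫_ℝ =
      ⟪ξ₀ (backToLabel ν W X ω t y), fderiv ℝ (backToLabel ν W X ω t) y w⟫_ℝ := by
  obtain ⟨Cu, C, h⟩ := hc.exists_isFlowSystem hW hs hT
  filter_upwards [hc.ae_conservation hW hS hs hT hX0 hξ₀, ae_isBddDiffeo h.flow ν W]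
    with ω h1 h2 t ht y w
  have h3 := (h2 t ht).fderiv_apply_inv y w
  -- The Brownian shift does not depend on x, so the noisy flow has the gradient of X. Inserting e =
  -- ∇A w then inverts the conservation law.
  have h4 : ∀ x, fderiv ℝ (noisyFlow ν W X ω t) x = fderiv ℝ (X ω t) x := fun x =>
    fderiv_add_const (𝕜 := ℝ) (f := X ω t) (Real.sqrt (2 * ν) • W t.toNNReal ω)
  rw [h4] at h3
  have h5 := h1 t ht (backToLabel ν W X ω t y) (fderiv ℝ (backToLabel ν W X ω t) y w)
  rw [h3] at h5
  exact h5

/-- The pathwise Kelvin theorem. -/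
theorem IsCritical.ae_kelvin [IsProbabilityMeasure P] (hc : IsCritical D s T ν P W S u X ξ)
    (hW : IsBrownianMotion W P) (hS : IsInertia D (s + 1) S) (hs : 1 + (d : ℝ) / 2 < s)
    (hT : 0 < T) (hX0 : ∀ᵐ ω ∂P, X ω 0 = id) {ξ₀ : E d → E d} (hξ₀ : ∀ᵐ ω ∂P, ξ ω 0 = ξ₀)
    {v : VectorMeasure (E d) (E d)} (hv : IsDivFreeMeasure D v) :
    ∀ᵐ ω ∂P, ∀ t ∈ Icc 0 T,
      IsDivFreeMeasure D (pushMeasure D (noisyFlow ν W X ω t) v) ∧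
      pairMeasure (fun x => ξ ω t (backToLabel ν W X ω t x))
        (pushMeasure D (noisyFlow ν W X ω t) v) = pairMeasure ξ₀ v := by
  obtain ⟨Cu, C, h⟩ := hc.exists_isFlowSystem hW hs hT
  obtain ⟨R, -, hR⟩ := hc.momentum.exists_isBddMomentum hs
  obtain ⟨K, -, hK⟩ := hc.momentum.exists_isBddField_initial hs hT hξ₀
  obtain ⟨m, -, g, hg, rfl⟩ := exists_withDensityᵥ_eq v
  have ha := hv.annihilatesGradients hg
  filter_upwards [hc.ae_conservation hW hS hs hT hX0 hξ₀, ae_isBddDiffeo h.flow ν W, hR]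
    with ω h1 h2 h3 t ht
  have hd := h2 t ht
  refine ⟨isDivFreeMeasure_pushMeasure hg ha hd.contDiff hd.fderiv_le hd.isOn, ?_⟩
  have hb := (h3.isBddField ht).comp hd.contDiff_inv.continuous hd.isOn_inv
  rw [pairMeasure_pushMeasure hg hd.contDiff.continuous hd.fderiv_le
    hb.continuous.stronglyMeasurable hb.norm_le hb.isOn,
    pairMeasure_withDensityᵥ hg hK.continuous.stronglyMeasurable hK.norm_le]
  refine integral_congr_ae (Eventually.of_forall fun x => ?_)
  have h4 : fderiv ℝ (noisyFlow ν W X ω t) x = fderiv ℝ (X ω t) x :=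
    fderiv_add_const (𝕜 := ℝ) (f := X ω t) (Real.sqrt (2 * ν) • W t.toNNReal ω)
  simp only
  rw [hd.leftInverse x, h4]
  exact h1 t ht x (g x)

end Pathwise

end Kelvin

end

/-! ### Expectation of the push-forward and of the transported momentum. -/

noncomputable section

namespace Kelvin

variable {d : ℕ}

section Expectation

variable {Ω : Type*} [MeasurableSpace Ω] {P : Measure Ω} {D : Domain} {C : ℝ}
  {Φ A : Ω → E d → E d} {m : Measure (E d)} {h : E d → E d}

/-- The integrand of the averaged push-forward. -/
def pushDensity (A : Ω → E d → E d) (h : E d → E d) (z : Ω × E d) : E d :=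
  fderiv ℝ (A z.1) z.2 (h z.2)

theorem integrable_pushDensity [IsProbabilityMeasure P] [IsFiniteMeasure m]
    (hm : ∀ x, AEStronglyMeasurable (fun ω => A ω x) P)
    (hA : ∀ᵐ ω ∂P, IsBddDiffeo D C (Φ ω) (A ω)) (hh : Integrable h m) :
    Integrable (pushDensity A h) (P.prod m) := by
  have h1 : AEStronglyMeasurable (fun z : Ω × E d => fderiv ℝ (A z.1) z.2) (P.prod m) :=
    aestronglyMeasurable_uncurry_of_continuous m (f := fun ω x => fderiv ℝ (A ω) x)
      (fun x => aestronglyMeasurable_fderiv hm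
        (hA.mono fun ω h => h.contDiff_inv.differentiable (by norm_num) x))
      (hA.mono fun ω h => h.contDiff_inv.continuous_fderiv (by norm_num))
  have h2 : Integrable (fun z : Ω × E d => C * ‖h z.2‖) (P.prod m) :=
    (hh.norm.const_mul C).comp_snd P
  refine h2.mono' ?_ ?_
  · exact (ContinuousLinearMap.id ℝ (E d →L[ℝ] E d)).aestronglyMeasurable_comp₂ h1
      hh.1.comp_snd
  · filter_upwards [Measure.quasiMeasurePreserving_fst.ae hA] with z hz
    exact (ContinuousLinearMap.le_opNorm _ _).trans
      (mul_le_mul_of_nonneg_right (hz.inv_fderiv_le _) (norm_nonneg _))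

/-- The image of a vector measure requires a truly measurable map, while the random map is only
almost everywhere measurable on the product. A version that agrees on almost every slice does not
change the integrals. -/
theorem exists_measurable_version [IsProbabilityMeasure P] [IsFiniteMeasure m]
    (hm : ∀ x, AEStronglyMeasurable (fun ω => A ω x) P)
    (hA : ∀ᵐ ω ∂P, Continuous (A ω)) :
    ∃ F : Ω × E d → E d, Measurable F ∧ ∀ᵐ ω ∂P, ∀ᵐ x ∂m, F (ω, x) = A ω x := by
  have h1 := aestronglyMeasurable_uncurry_of_continuous m hm hA
  refine ⟨h1.mk _, h1.stronglyMeasurable_mk.measurable, ?_⟩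
  exact (Measure.ae_ae_of_ae_prod h1.ae_eq_mk).mono fun ω h => h.mono fun x hx => hx.symm

theorem integral_version [IsProbabilityMeasure P] [IsFiniteMeasure m]
    {G : Ω × E d → E d} (hG : Integrable G (P.prod m))
    {F : Ω × E d → E d} (hF : Measurable F) (hFA : ∀ᵐ ω ∂P, ∀ᵐ x ∂m, F (ω, x) = A ω x)
    {L : E d → E d →L[ℝ] ℝ} (hL : Continuous L) {K : ℝ} (hK : ∀ x, ‖L x‖ ≤ K) :
    ∫ z, L (F z) (G z) ∂(P.prod m) = ∫ ω, ∫ x, L (A ω x) (G (ω, x)) ∂m ∂P := by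
  have hi : Integrable (fun z => L (F z) (G z)) (P.prod m) := by
    refine (hG.norm.const_mul K).mono' ?_ (Eventually.of_forall fun z => ?_)
    · exact (ContinuousLinearMap.id ℝ (E d →L[ℝ] ℝ)).aestronglyMeasurable_comp₂
        (hL.stronglyMeasurable.comp_measurable hF).aestronglyMeasurable hG.1
    · exact (ContinuousLinearMap.le_opNorm _ _).trans
        (mul_le_mul_of_nonneg_right (hK _) (norm_nonneg _))
  rw [integral_prod _ hi]
  refine integral_congr_ae (hFA.mono fun ω hω => ?_)
  refine integral_congr_ae (hω.mono fun x hx => ?_)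
  simp only [hx]

/-- Averaging over ω is built into the measure: the expectation is the image of a single vector
measure on Ω × D, and Fubini's theorem recovers the expectation on each Borel set. Countable
additivity then comes for free. -/
theorem isExpectation_pushMeasure [IsProbabilityMeasure P] [IsFiniteMeasure m]
    (hm : ∀ x, AEStronglyMeasurable (fun ω => A ω x) P)
    (hA : ∀ᵐ ω ∂P, IsBddDiffeo D C (Φ ω) (A ω)) (hh : Integrable h m)
    {F : Ω × E d → E d} (hF : Measurable F) (hFA : ∀ᵐ ω ∂P, ∀ᵐ x ∂m, F (ω, x) = A ω x) :
    IsExpectation P (fun ω => pushMeasure D (A ω) (m.withDensityᵥ h))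
      (((P.prod m).withDensityᵥ (pushDensity A h)).map fun z => fold D (F z)) := by
  intro B hB
  have hG := integrable_pushDensity hm hA hh
  have hfF : Measurable fun z => fold D (F z) := (measurable_fold D).comp hF
  have hS : MeasurableSet ((fun z => fold D (F z)) ⁻¹' B) := hfF hB
  have hi : Integrable (((fun z => fold D (F z)) ⁻¹' B).indicator (pushDensity A h)) (P.prod m) :=
    hG.indicator hS
  have hpush : ∀ᵐ ω ∂P, pushMeasure D (A ω) (m.withDensityᵥ h) B =
      ∫ x, ((fun z => fold D (F z)) ⁻¹' B).indicator (pushDensity A h) (ω, x) ∂m := by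
    filter_upwards [hA, hFA] with ω h1 h2
    have hfA : Measurable fun x => fold D (A ω x) :=
      (measurable_fold D).comp h1.contDiff_inv.continuous.measurable
    rw [pushMeasure_withDensityᵥ hh D h1.inv_fderiv_le, VectorMeasure.map_apply _ hfA hB,
      withDensityᵥ_apply (integrable_fderiv_apply hh h1.inv_fderiv_le) (hfA hB),
      ← integral_indicator (hfA hB)]
    refine integral_congr_ae (h2.mono fun x hx => ?_)
    have hmem : (ω, x) ∈ (fun z => fold D (F z)) ⁻¹' B ↔
        x ∈ (fun x => fold D (A ω x)) ⁻¹' B := by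
      change fold D (F (ω, x)) ∈ B ↔ _
      rw [hx]
      rfl
    beta_reduce
    by_cases hxB : x ∈ (fun x => fold D (A ω x)) ⁻¹' B
    · rw [indicator_of_mem hxB, indicator_of_mem (hmem.2 hxB), pushDensity]
    · rw [indicator_of_notMem hxB, indicator_of_notMem (mt hmem.1 hxB)]
  refine ⟨hi.integral_prod_left.congr (hpush.mono fun ω h => h.symm), ?_⟩
  rw [VectorMeasure.map_apply _ hfF hB, withDensityᵥ_apply hG hS, ← integral_indicator hS,
    integral_prod _ hi]
  exact integral_congr_ae hpush

/-- The averaged push-forward of a divergence-free measure. -/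
theorem exists_isExpectation_pushMeasure [IsProbabilityMeasure P] [IsFiniteMeasure m]
    (hm : ∀ x, AEStronglyMeasurable (fun ω => A ω x) P)
    (hA : ∀ᵐ ω ∂P, IsBddDiffeo D C (Φ ω) (A ω)) (hh : Integrable h m)
    (ha : AnnihilatesGradients D m h) :
    ∃ N : VectorMeasure (E d) (E d),
      IsExpectation P (fun ω => pushMeasure D (A ω) (m.withDensityᵥ h)) N ∧
      IsDivFreeMeasure D N ∧ ∀ K ψ, IsBddField D K ψ →
        pairMeasure ψ N = ∫ ω, ∫ x, ⟪ψ (A ω x), fderiv ℝ (A ω) x (h x)⟫_ℝ ∂m ∂P := by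
  obtain ⟨F, hF, hFA⟩ := exists_measurable_version (m := m) hm
    (hA.mono fun ω h => h.contDiff_inv.continuous)
  have hG := integrable_pushDensity hm hA hh
  refine ⟨_, isExpectation_pushMeasure hm hA hh hF hFA, ?_, fun K ψ hψ => ?_⟩
  · refine isDivFreeMeasure_map hG hF fun φ hφ => ?_
    obtain ⟨M, -, -, hM⟩ := hφ.exists_bound
    rw [integral_version hG hF hFA (hφ.1.continuous_fderiv (by simp)) hM]
    refine integral_eq_zero_of_ae (hA.mono fun ω h => ?_)
    exact ha.comp hh h.contDiff_inv h.inv_fderiv_le h.isOn_inv hφ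
  · have hfF : Measurable fun z => fold D (F z) := (measurable_fold D).comp hF
    rw [pairMeasure_map_withDensityᵥ hG hfF hψ.continuous.stronglyMeasurable hψ.norm_le]
    have hc : Continuous fun x => innerSL ℝ (ψ x) := (innerSL ℝ).continuous.comp hψ.continuous
    have h1 := integral_version hG hF hFA hc (K := K) fun x => by
      rw [innerSL_apply_norm]; exact hψ.norm_le x
    simp only [innerSL_apply_apply] at h1
    refine Eq.trans (integral_congr_ae (Eventually.of_forall fun z => ?_)) h1
    simp only [hψ.isOn.fold]

variable {Z : Ω → E d → E d} {ψ : E d → E d} {K : ℝ}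

theorem eq_adjoint_apply {f : E d → E d} {x v : E d} {y : E d}
    (hf : ∀ w, ⟪v, w⟫_ℝ = ⟪y, fderiv ℝ f x w⟫_ℝ) :
    v = ContinuousLinearMap.adjoint (fderiv ℝ f x) y :=
  ext_inner_right ℝ fun w => by rw [hf, ContinuousLinearMap.adjoint_inner_left]

/-- Measurability is read off from the formula (∇A)^* ψ(A), in which only A is random. -/
theorem aestronglyMeasurable_transported
    (hm : ∀ x, AEStronglyMeasurable (fun ω => A ω x) P)
    (hA : ∀ᵐ ω ∂P, IsBddDiffeo D C (Φ ω) (A ω)) (hψ : IsBddField D K ψ)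
    (hZ : ∀ᵐ ω ∂P, ∀ y w, ⟪Z ω y, w⟫_ℝ = ⟪ψ (A ω y), fderiv ℝ (A ω) y w⟫_ℝ) (y : E d) :
    AEStronglyMeasurable (fun ω => Z ω y) P := by
  have h1 : AEStronglyMeasurable
      (fun ω => ContinuousLinearMap.adjoint (fderiv ℝ (A ω) y)) P :=
    (ContinuousLinearMap.adjoint (𝕜 := ℝ) (E := E d) (F := E d)).continuous.comp_aestronglyMeasurable
      (aestronglyMeasurable_fderiv hm
        (hA.mono fun ω h => h.contDiff_inv.differentiable (by norm_num) y))
  have h2 : AEStronglyMeasurable (fun ω => ψ (A ω y)) P :=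
    hψ.continuous.comp_aestronglyMeasurable (hm y)
  have h3 := (ContinuousLinearMap.id ℝ (E d →L[ℝ] E d)).aestronglyMeasurable_comp₂ h1 h2
  exact h3.congr (hZ.mono fun ω h => (eq_adjoint_apply (h y)).symm)

/-- The same formula bounds the transported momentum by a constant independent of ω, whereas the
momentum bound itself is random. -/
theorem ae_norm_transported_le
    (hA : ∀ᵐ ω ∂P, IsBddDiffeo D C (Φ ω) (A ω)) (hψ : IsBddField D K ψ)
    (hZ : ∀ᵐ ω ∂P, ∀ y w, ⟪Z ω y, w⟫_ℝ = ⟪ψ (A ω y), fderiv ℝ (A ω) y w⟫_ℝ) :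
    ∀ᵐ ω ∂P, ∀ y, ‖Z ω y‖ ≤ C * K := by
  filter_upwards [hA, hZ] with ω h1 h2 y
  rw [eq_adjoint_apply (h2 y)]
  refine (ContinuousLinearMap.le_opNorm _ _).trans ?_
  rw [LinearIsometryEquiv.norm_map]
  exact mul_le_mul (h1.inv_fderiv_le y) (hψ.norm_le _) (norm_nonneg _)
    ((norm_nonneg _).trans (h1.inv_fderiv_le y))

theorem isBddField_expectation [IsProbabilityMeasure P]
    (hm : ∀ x, AEStronglyMeasurable (fun ω => A ω x) P)
    (hA : ∀ᵐ ω ∂P, IsBddDiffeo D C (Φ ω) (A ω)) (hψ : IsBddField D K ψ)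
    (hZ : ∀ᵐ ω ∂P, ∀ y w, ⟪Z ω y, w⟫_ℝ = ⟪ψ (A ω y), fderiv ℝ (A ω) y w⟫_ℝ)
    (hZc : ∀ᵐ ω ∂P, Continuous (Z ω) ∧ IsOn D (Z ω)) :
    IsBddField D (C * K) fun y => ∫ ω, Z ω y ∂P := by
  have hb := ae_norm_transported_le hA hψ hZ
  refine ⟨?_, ?_, fun x => ?_⟩
  · refine continuous_of_dominated (bound := fun _ => C * K)
      (fun x => aestronglyMeasurable_transported hm hA hψ hZ x)
      (fun x => hb.mono fun ω h => h x) (integrable_const _) (hZc.mono fun ω h => h.1)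
  · cases D
    · trivial
    · intro x k
      exact integral_congr_ae (hZc.mono fun ω h => h.2 x k)
  · refine (norm_integral_le_of_norm_le_const (hb.mono fun ω h => h x)).trans_eq ?_
    simp

theorem integral_inner_expectation [IsProbabilityMeasure P] [IsFiniteMeasure m]
    (hm : ∀ x, AEStronglyMeasurable (fun ω => A ω x) P)
    (hA : ∀ᵐ ω ∂P, IsBddDiffeo D C (Φ ω) (A ω)) (hψ : IsBddField D K ψ)
    (hZ : ∀ᵐ ω ∂P, ∀ y w, ⟪Z ω y, w⟫_ℝ = ⟪ψ (A ω y), fderiv ℝ (A ω) y w⟫_ℝ)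
    (hZc : ∀ᵐ ω ∂P, Continuous (Z ω)) (hh : Integrable h m) :
    ∫ x, ⟪∫ ω, Z ω x ∂P, h x⟫_ℝ ∂m =
      ∫ ω, ∫ x, ⟪ψ (A ω x), fderiv ℝ (A ω) x (h x)⟫_ℝ ∂m ∂P := by
  have hb := ae_norm_transported_le hA hψ hZ
  have hmZ := aestronglyMeasurable_transported hm hA hψ hZ
  have h1 : ∀ x, ⟪∫ ω, Z ω x ∂P, h x⟫_ℝ = ∫ ω, ⟪Z ω x, h x⟫_ℝ ∂P := by
    intro x
    have hi : Integrable (fun ω => Z ω x) P :=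
      Integrable.of_bound (hmZ x) (C * K) (hb.mono fun ω h => h x)
    rw [real_inner_comm, ← integral_inner hi]
    simp only [real_inner_comm]
  simp only [h1]
  have hj : AEStronglyMeasurable (fun z : Ω × E d => Z z.1 z.2) (P.prod m) :=
    aestronglyMeasurable_uncurry_of_continuous m hmZ hZc
  have hi : Integrable (fun z : Ω × E d => ⟪Z z.1 z.2, h z.2⟫_ℝ) (P.prod m) := by
    refine ((hh.norm.const_mul (C * K)).comp_snd P).mono' (hj.inner hh.1.comp_snd) ?_
    filter_upwards [Measure.quasiMeasurePreserving_fst.ae hb] with z hz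
    exact (norm_inner_le_norm _ _).trans (mul_le_mul_of_nonneg_right (hz _) (norm_nonneg _))
  rw [integral_integral_swap (f := fun x ω => ⟪Z ω x, h x⟫_ℝ) hi.swap]
  exact integral_congr_ae (hZ.mono fun ω hω => by simp only [hω])

end Expectation

end Kelvin

end

/-! ### Mollification on the domain and symmetry of the derivative. -/

noncomputable section

namespace Kelvin

variable {d : ℕ}

section Translation

variable {V : Type*} [NormedAddCommGroup V] [NormedSpace ℝ V] {D : Domain}

/-- On the torus the integrals over the cell and over its translate both equal the integral of the
descended function over the quotient. -/
theorem integral_vol_add {f : E d → V} (hf : IsOn D f) (a : E d) :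
    ∫ x, f (x + a) ∂(vol d D) = ∫ x, f x ∂(vol d D) := by
  cases D
  · simp only [vol, cell, Measure.restrict_univ]
    exact integral_add_right_eq_self f a
  · obtain ⟨g, hg⟩ := IsOn.exists_descend hf
    rw [setIntegral_vol_torus, setIntegral_vol_torus]
    have h1 := UnitAddTorus.integral_preimage g (fun _ => (0 : ℝ))
    have h2 := UnitAddTorus.integral_preimage g (fun i => a i)
    simp only [hg] at h1 h2
    rw [← h1, h2]
    have h3 := (measurePreserving_add_right volume (WithLp.ofLp a)).setIntegral_preimage_emb
      (measurableEmbedding_addRight (WithLp.ofLp a)) (fun x : Fin d → ℝ => f (WithLp.toLp 2 x))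
      {x : Fin d → ℝ | ∀ i, x i ∈ Ioc (a i) (a i + 1)}
    rw [← h3]
    have h4 : (fun x => x + WithLp.ofLp a) ⁻¹' {x : Fin d → ℝ | ∀ i, x i ∈ Ioc (a i) (a i + 1)} =
        {x : Fin d → ℝ | ∀ i, x i ∈ Ioc (0 : ℝ) (0 + 1)} := by
      ext x
      simp only [mem_preimage, mem_ofPred_eq, Pi.add_apply, mem_Ioc]
      refine forall_congr' fun i => ?_
      constructor <;> rintro ⟨h, h'⟩ <;> constructor <;> linarith
    rw [h4]
    rfl

theorem IsOn.comp_add {V : Type*} {D : Domain} {f : E d → V} (hf : IsOn D f) (a : E d) : IsOn D fun x => f (x + a) := by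
  cases D
  · trivial
  · intro x k
    simp only
    rw [add_right_comm, hf]

theorem IsOn.comp_sub {V : Type*} {D : Domain} {f : E d → V} (hf : IsOn D f) (a : E d) : IsOn D fun x => f (x - a) := by
  simpa only [sub_eq_add_neg] using hf.comp_add (-a)

theorem IsTest.comp_sub {φ : E d → V} (hφ : IsTest D φ) (a : E d) : IsTest D fun x => φ (x - a) := by
  refine ⟨hφ.1.comp (contDiff_id.sub contDiff_const), hφ.2.1.comp_sub a, ?_⟩
  cases D
  · have h : HasCompactSupport φ := hφ.2.2
    exact h.comp_homeomorph (Homeomorph.subRight a)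
  · trivial

theorem IsTest.clm_comp {V' : Type*} [NormedAddCommGroup V'] [NormedSpace ℝ V'] {φ : E d → V}
    (hφ : IsTest D φ) (L : V →L[ℝ] V') : IsTest D fun x => L (φ x) := by
  refine ⟨L.contDiff.comp hφ.1, hφ.2.1.map L, ?_⟩
  cases D
  · have h : HasCompactSupport φ := hφ.2.2
    exact h.comp_left (map_zero L)
  · trivial

end Translation

section Mollification

variable {D : Domain} {κ : E d → ℝ} {g : E d → E d} {K : ℝ}

/-- Mollification of a field on the domain. -/
def fieldMollify (D : Domain) (κ : E d → ℝ) (g : E d → E d) (x : E d) : E d :=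
  ∫ z, κ z • g (z + x) ∂(vol d D)

theorem IsTest.integrable {V : Type*} [NormedAddCommGroup V] [NormedSpace ℝ V] {φ : E d → V}
    (hφ : IsTest D φ) : Integrable φ (vol d D) := by
  obtain ⟨M, -, hM, -⟩ := hφ.exists_bound
  obtain ⟨B, hB, hBf, h⟩ := hφ.exists_finite_support 0
  have hi : Integrable (B.indicator fun _ => M) (vol d D) :=
    (integrable_indicator_iff hB).2 (integrableOn_const hBf.ne)
  refine hi.mono' hφ.1.continuous.aestronglyMeasurable (Eventually.of_forall fun x => ?_)
  by_cases hx : x ∈ B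
  · rw [indicator_of_mem hx]; exact hM x
  · rw [indicator_of_notMem hx, (h x x (by simp) hx).1, norm_zero]

theorem IsTest.integrable_smul (hκ : IsTest D κ) (hg : IsBddField D K g) (x : E d) :
    Integrable (fun z => κ z • g (z + x)) (vol d D) :=
  hκ.integrable.smul_bdd K
    (hg.continuous.comp (continuous_add_const x)).aestronglyMeasurable
    (Eventually.of_forall fun _ => hg.norm_le _)

/-- A translation moves the dependence on x to the smooth kernel, where it can be differentiated. -/
theorem fieldMollify_eq (hκ : IsTest D κ) (hg : IsBddField D K g) (x : E d) :
    fieldMollify D κ g x = ∫ z, κ (z - x) • g z ∂(vol d D) := by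
  have h := integral_vol_add (f := fun z => κ (z - x) • g z)
    ((hκ.2.1.comp_sub x).map₂ hg.isOn fun a b => a • b) x
  simp only [add_sub_cancel_right] at h
  exact h

theorem isBddField_fieldMollify (hκ : IsTest D κ) (h0 : ∀ z, 0 ≤ κ z) (hg : IsBddField D K g) :
    IsBddField D ((∫ z, κ z ∂(vol d D)) * K) (fieldMollify D κ g) := by
  refine ⟨?_, ?_, fun x => ?_⟩
  · refine continuous_of_dominated (bound := fun z => κ z * K)
      (fun x => (hκ.integrable_smul hg x).1) (fun x => Eventually.of_forall fun z => ?_)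
      (hκ.integrable.mul_const K) (Eventually.of_forall fun z => ?_)
    · rw [norm_smul, Real.norm_of_nonneg (h0 z)]
      exact mul_le_mul_of_nonneg_left (hg.norm_le _) (h0 z)
    · exact (hg.continuous.comp (continuous_const_add z)).const_smul (κ z)
  · cases D
    · trivial
    · intro x k
      refine integral_congr_ae (Eventually.of_forall fun z => ?_)
      simp only
      rw [← add_assoc, hg.isOn]
  · rw [← integral_mul_const]
    refine norm_integral_le_of_norm_le (hκ.integrable.mul_const K) (Eventually.of_forall fun z => ?_)
    rw [norm_smul, Real.norm_of_nonneg (h0 z)]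
    exact mul_le_mul_of_nonneg_left (hg.norm_le _) (h0 z)

theorem hasFDerivAt_fieldMollify (hκ : IsTest D κ) (hg : IsBddField D K g) (x : E d) :
    HasFDerivAt (fieldMollify D κ g)
      (∫ z, (-fderiv ℝ κ (z - x)).smulRight (g z) ∂(vol d D)) x := by
  obtain ⟨M, hM0, -, hM⟩ := hκ.exists_bound
  -- All y in the unit ball about x have norm at most ‖x‖ + 1, so one set of finite measure contains
  -- the relevant z for all of them.
  obtain ⟨B, hB, hBf, h⟩ := hκ.exists_finite_support (‖x‖ + 1)
  have hK0 : 0 ≤ K := (norm_nonneg _).trans (hg.norm_le 0)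
  have hi : Integrable (B.indicator fun _ => M * K) (vol d D) :=
    (integrable_indicator_iff hB).2 (integrableOn_const hBf.ne)
  have heq : fieldMollify D κ g = fun x => ∫ z, κ (z - x) • g z ∂(vol d D) :=
    funext (fieldMollify_eq hκ hg)
  have hκc : Continuous (fderiv ℝ κ) := hκ.fderiv.1.continuous
  have hcont : Continuous fun z => (-fderiv ℝ κ (z - x)).smulRight (g z) :=
    (ContinuousLinearMap.smulRightL ℝ (E d) (E d)).continuous₂.comp
      ((hκc.comp (continuous_sub_right x)).neg.prodMk hg.continuous)
  rw [heq]
  refine hasFDerivAt_integral_of_dominated_of_fderiv_le (s := Metric.ball x 1)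
    (F := fun x z => κ (z - x) • g z)
    (F' := fun x z => (-fderiv ℝ κ (z - x)).smulRight (g z))
    (bound := B.indicator fun _ => M * K) (Metric.ball_mem_nhds x one_pos)
    (Eventually.of_forall fun x => ?_) ?_ hcont.aestronglyMeasurable
    (Eventually.of_forall fun z y hy => ?_) hi (Eventually.of_forall fun z y _ => ?_)
  · exact ((hκ.1.continuous.comp (continuous_sub_right x)).smul hg.continuous).aestronglyMeasurable
  · exact (hκ.comp_sub x).integrable.smul_bdd K hg.continuous.aestronglyMeasurable
      (Eventually.of_forall fun _ => hg.norm_le _)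
  · rw [ContinuousLinearMap.norm_smulRight_apply, norm_neg]
    by_cases hz : z ∈ B
    · rw [indicator_of_mem hz]
      exact mul_le_mul (hM _) (hg.norm_le _) (norm_nonneg _) hM0
    · have h1 : ‖z - y - z‖ ≤ ‖x‖ + 1 := by
        rw [sub_sub_cancel_left, norm_neg]
        have h2 : ‖y - x‖ < 1 := mem_ball_iff_norm.1 hy
        have h3 := norm_le_norm_add_norm_sub' y x
        linarith
      rw [indicator_of_notMem hz, (h z (z - y) h1 hz).2, norm_zero, zero_mul]
  · have h1 : HasFDerivAt (fun y => κ (z - y)) (-fderiv ℝ κ (z - y)) y := by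
      have h2 := (hκ.1.differentiable (by simp) (z - y)).hasFDerivAt.comp y
        ((hasFDerivAt_id y).const_sub z)
      exact h2.congr_fderiv (by ext v; simp)
    exact h1.smul_const (g z)

/-- The divergence-free field `(∂_a κ) b - (∂_b κ) a`. -/
def curlField (κ : E d → ℝ) (a b : E d) (z : E d) : E d :=
  fderiv ℝ κ z a • b - fderiv ℝ κ z b • a

theorem isTest_curlField (hκ : IsTest D κ) (a b : E d) : IsTest D (curlField κ a b) := by
  have h := hκ.fderiv.clm_comp
    ((ContinuousLinearMap.apply ℝ ℝ a).smulRight b - (ContinuousLinearMap.apply ℝ ℝ b).smulRight a)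
  exact h

/-- The two terms are the mixed second derivatives of κ along a and b, which cancel by symmetry. -/
theorem divergence_curlField (hκ : ContDiff ℝ (⊤ : ℕ∞) κ) (a b x : E d) :
    divergence (curlField κ a b) x = 0 := by
  have h1 : HasFDerivAt (fderiv ℝ κ) (fderiv ℝ (fderiv ℝ κ) x) x :=
    ((hκ.fderiv_right (m := (⊤ : ℕ∞)) (by simp)).differentiable (by simp) x).hasFDerivAt
  have h2 : ∀ e, fderiv ℝ (curlField κ a b) x e =
      fderiv ℝ (fderiv ℝ κ) x e a • b - fderiv ℝ (fderiv ℝ κ) x e b • a := by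
    intro e
    have h3 := ((ContinuousLinearMap.apply ℝ ℝ a).smulRight b -
      (ContinuousLinearMap.apply ℝ ℝ b).smulRight a).hasFDerivAt.comp x h1
    have h4 : HasFDerivAt (curlField κ a b) _ x := h3
    rw [h4.fderiv]
    rfl
  have h5 : ∀ (T : E d →L[ℝ] ℝ) (c : E d), ∑ i, T (basisVec i) * c i = T c := by
    intro T c
    conv_rhs => rw [← (EuclideanSpace.basisFun (Fin d) ℝ).sum_repr c]
    simp [basisVec, mul_comm]
  have h6 : ∀ e c, fderiv ℝ (fderiv ℝ κ) x e c = fderiv ℝ (fderiv ℝ κ) x c e :=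
    fun e c => (hκ.contDiffAt.isSymmSndFDerivAt (by
      rw [minSmoothness_of_isRCLikeNormedField]
      exact WithTop.coe_le_coe.2 (le_top : (2 : ℕ∞) ≤ ⊤))).eq e c
  simp only [divergence, h2, PiLp.sub_apply, PiLp.smul_apply, smul_eq_mul, Finset.sum_sub_distrib]
  have h7 := h5 (fderiv ℝ (fderiv ℝ κ) x a) b
  have h8 := h5 (fderiv ℝ (fderiv ℝ κ) x b) a
  rw [sub_eq_zero]
  refine Eq.trans ?_ (h7.trans ((h6 a b).trans h8.symm) |>.trans ?_)
  · exact Finset.sum_congr rfl fun i _ => by rw [h6]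
  · exact Finset.sum_congr rfl fun i _ => by rw [h6]

/-- `g` is orthogonal to all divergence-free test fields. -/
def OrthogonalToDivFree (D : Domain) (g : E d → E d) : Prop :=
  ∀ ψ : E d → E d, IsTest D ψ → (∀ x, divergence ψ x = 0) → ∫ z, ⟪g z, ψ z⟫_ℝ ∂(vol d D) = 0

/-- Up to sign, the antisymmetric part of the derivative in the plane of a and b is the pairing of g
with the curl field of the translated kernel. That field is a divergence-free test field, so the
pairing vanishes, in any dimension. -/
theorem fderiv_fieldMollify_symm (hκ : IsTest D κ) (hg : IsBddField D K g)
    (ho : OrthogonalToDivFree D g) (x a b : E d) :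
    ⟪fderiv ℝ (fieldMollify D κ g) x a, b⟫_ℝ = ⟪fderiv ℝ (fieldMollify D κ g) x b, a⟫_ℝ := by
  let κx : E d → ℝ := fun z => κ (z - x)
  have hκx : IsTest D κx := hκ.comp_sub x
  have hder : ∀ z, fderiv ℝ κ (z - x) = fderiv ℝ κx z := fun z => (fderiv_comp_sub x).symm
  have hi : ∀ a b, Integrable (fun z => fderiv ℝ κx z a * ⟪g z, b⟫_ℝ) (vol d D) := by
    intro a b
    have h1 := (hκx.fderiv.clm_comp (ContinuousLinearMap.apply ℝ ℝ a)).integrable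
    refine h1.mul_bdd (c := K * ‖b‖) (hg.continuous.inner continuous_const).aestronglyMeasurable
      (Eventually.of_forall fun z => (norm_inner_le_norm _ _).trans
        (mul_le_mul_of_nonneg_right (hg.norm_le z) (norm_nonneg _)))
  have hiL : Integrable (fun z => (-fderiv ℝ κx z).smulRight (g z)) (vol d D) := by
    refine (hκx.fderiv.integrable.norm.mul_const K).mono' ?_ (Eventually.of_forall fun z => ?_)
    · exact ((ContinuousLinearMap.smulRightL ℝ (E d) (E d)).continuous₂.comp
        (hκx.fderiv.1.continuous.neg.prodMk hg.continuous)).aestronglyMeasurable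
    · rw [ContinuousLinearMap.norm_smulRight_apply, norm_neg]
      exact mul_le_mul_of_nonneg_left (hg.norm_le _) (norm_nonneg _)
  have key : ∀ a b, ⟪fderiv ℝ (fieldMollify D κ g) x a, b⟫_ℝ =
      -∫ z, fderiv ℝ κx z a * ⟪g z, b⟫_ℝ ∂(vol d D) := by
    intro a b
    rw [(hasFDerivAt_fieldMollify hκ hg x).fderiv]
    simp only [hder]
    rw [ContinuousLinearMap.integral_apply hiL, real_inner_comm, ← integral_inner
      (hiL.apply_continuousLinearMap a), ← integral_neg]
    refine integral_congr_ae (Eventually.of_forall fun z => ?_)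
    simp [inner_smul_right, real_inner_comm]
  rw [key, key]
  have h := ho _ (isTest_curlField hκx a b) (divergence_curlField hκx.1 a b)
  have h2 : ∀ z, ⟪g z, curlField κx a b z⟫_ℝ =
      fderiv ℝ κx z a * ⟪g z, b⟫_ℝ - fderiv ℝ κx z b * ⟪g z, a⟫_ℝ := by
    intro z
    simp [curlField, inner_sub_right, inner_smul_right]
  simp only [h2] at h
  rw [integral_sub (hi a b) (hi b a)] at h
  linarith

end Mollification

end Kelvin

end

/-! ### The Leray projection is invisible to divergence-free measures. -/

noncomputable section

namespace Kelvin

variable {d : ℕ}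

section Leray

variable {D : Domain} {κ : E d → ℝ} {g : E d → E d} {K : ℝ}

/-- Constant fields are divergence-free test fields on the torus, so g has zero mean, and averaging
over translates preserves this. -/
theorem integral_inner_fieldMollify_torus (hκ : IsTest .torus κ) (hg : IsBddField .torus K g)
    (ho : OrthogonalToDivFree .torus g) (v : E d) :
    ∫ x, ⟪fieldMollify .torus κ g x, v⟫_ℝ ∂(vol d .torus) = 0 := by
  have h1 : ∀ x, ⟪fieldMollify .torus κ g x, v⟫_ℝ =
      ∫ z, κ z * ⟪g (z + x), v⟫_ℝ ∂(vol d .torus) := by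
    intro x
    rw [fieldMollify, real_inner_comm, ← integral_inner (hκ.integrable_smul hg x)]
    refine integral_congr_ae (Eventually.of_forall fun z => ?_)
    simp [inner_smul_right, real_inner_comm]
  have hconst : ∫ z, ⟪g z, v⟫_ℝ ∂(vol d .torus) = 0 :=
    ho (fun _ => v) ⟨contDiff_const, fun _ _ => rfl, trivial⟩ fun x => by simp [divergence]
  obtain ⟨M, hM0, hM, -⟩ := hκ.exists_bound
  have hi : Integrable (fun y : E d × E d => κ y.2 * ⟪g (y.2 + y.1), v⟫_ℝ)
      ((vol d .torus).prod (vol d .torus)) := by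
    refine Integrable.of_bound (C := M * (K * ‖v‖)) ?_ (Eventually.of_forall fun y => ?_)
    · exact ((hκ.1.continuous.comp continuous_snd).mul ((hg.continuous.comp
        (continuous_snd.add continuous_fst)).inner continuous_const)).aestronglyMeasurable
    · rw [norm_mul]
      exact mul_le_mul (hM _) ((norm_inner_le_norm _ _).trans
        (mul_le_mul_of_nonneg_right (hg.norm_le _) (norm_nonneg _))) (norm_nonneg _) hM0
  simp only [h1]
  rw [integral_integral_swap hi]
  refine integral_eq_zero_of_ae (Eventually.of_forall fun z => ?_)
  simp only [Pi.zero_apply]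
  rw [integral_const_mul]
  have h2 := integral_vol_add (f := fun x => ⟪g x, v⟫_ℝ) (hg.isOn.map fun y => ⟪y, v⟫_ℝ) z
  simp only [add_comm z]
  rw [h2, hconst, mul_zero]

/-- A potential of a periodic field of zero mean is periodic. -/
theorem isOn_of_hasFDerivAt (hg : IsBddField .torus K g)
    (h0 : ∀ v, ∫ x, ⟪g x, v⟫_ℝ ∂(vol d .torus) = 0) {p : E d → ℝ}
    (hp : ∀ x, HasFDerivAt p (innerSL ℝ (g x)) x) : IsOn .torus p := by
  intro x k
  set a : E d := intPoint k with ha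
  -- The increment over a period is constant because the gradient is periodic.
  have hq : ∀ x, HasFDerivAt (fun x => p (x + a) - p x) (0 : E d →L[ℝ] ℝ) x := by
    intro x
    have h1 := ((hasFDerivAt_comp_add_right a).2 (hp (x + a))).sub (hp x)
    have h2 : g (x + a) = g x := hg.isOn x k
    rwa [h2, sub_self] at h1
  have hc : ∀ x y, p (x + a) - p x = p (y + a) - p y :=
    is_const_of_fderiv_eq_zero (𝕜 := ℝ) (fun x => (hq x).differentiableAt) fun x => (hq x).fderiv
  have hg' : Continuous fun y : E d × ℝ => ⟪g (y.1 + y.2 • a), a⟫_ℝ :=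
    (hg.continuous.comp (by fun_prop)).inner continuous_const
  have hline : ∀ y, ∫ s in (0 : ℝ)..1, ⟪g (y + s • a), a⟫_ℝ = p (x + a) - p x := by
    intro y
    have h1 : ∀ s ∈ uIcc (0 : ℝ) 1,
        HasDerivAt (fun s : ℝ => p (y + s • a)) (⟪g (y + s • a), a⟫_ℝ) s := by
      intro s _
      have h2 : HasDerivAt (fun s : ℝ => y + s • a) a s := by
        simpa using ((hasDerivAt_id s).smul_const a).const_add y
      exact (hp (y + s • a)).comp_hasDerivAt s h2
    rw [intervalIntegral.integral_eq_sub_of_hasDerivAt h1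
      ((hg'.comp (by fun_prop : Continuous fun s : ℝ => (y, s))).intervalIntegrable _ _), hc x y]
    simp
  have hi : Integrable (fun y : E d × ℝ => ⟪g (y.1 + y.2 • a), a⟫_ℝ)
      ((vol d .torus).prod (volume.restrict (Ioc (0 : ℝ) 1))) :=
    Integrable.of_bound hg'.aestronglyMeasurable (K * ‖a‖) (Eventually.of_forall fun y =>
      (norm_inner_le_norm _ _).trans (mul_le_mul_of_nonneg_right (hg.norm_le _) (norm_nonneg _)))
  -- Each line integral equals that constant. Averaged over the base point it becomes the mean of g
  -- in the direction a, which is zero.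
  have h1 : ∫ y, (∫ s in (0 : ℝ)..1, ⟪g (y + s • a), a⟫_ℝ) ∂(vol d .torus) = 0 := by
    simp only [intervalIntegral.integral_of_le zero_le_one]
    rw [integral_integral_swap hi]
    refine integral_eq_zero_of_ae (Eventually.of_forall fun s => ?_)
    exact (integral_vol_add (f := fun x => ⟪g x, a⟫_ℝ) (hg.isOn.map fun y => ⟪y, a⟫_ℝ) _).trans
      (h0 a)
  simp only [hline] at h1
  rw [integral_const, probReal_univ, one_smul] at h1
  linarith

/-- The Poincaré lemma: a symmetric derivative on a convex set yields a C¹ potential. Its gradient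
is bounded, and on the torus the potential is periodic, so the measure annihilates it. -/
theorem integral_inner_fieldMollify {m : Measure (E d)} {h : E d → E d} (hh : Integrable h m)
    (ha : AnnihilatesGradients D m h) (hκ : IsTest D κ) (hκ0 : ∀ z, 0 ≤ κ z)
    (hg : IsBddField D K g) (ho : OrthogonalToDivFree D g) :
    ∫ x, ⟪fieldMollify D κ g x, h x⟫_ℝ ∂m = 0 := by
  have hG := isBddField_fieldMollify hκ hκ0 hg
  have hd := hasFDerivAt_fieldMollify hκ hg
  have hω : ∀ x, HasFDerivAt (fun x => innerSL ℝ (fieldMollify D κ g x))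
      ((innerSL ℝ).comp (fderiv ℝ (fieldMollify D κ g) x)) x := fun x =>
    (innerSL ℝ (E := E d)).hasFDerivAt.comp x (hd x).differentiableAt.hasFDerivAt
  obtain ⟨p, hp⟩ := convex_univ.exists_forall_hasFDerivAt_of_fderiv_symmetric isOpen_univ
    (ω := fun x => innerSL ℝ (fieldMollify D κ g x))
    (fun x _ => (hω x).differentiableAt.differentiableWithinAt) (fun x _ a b => by
      rw [(hω x).fderiv]
      exact fderiv_fieldMollify_symm hκ hg ho x a b)
  have hp' : ∀ x, HasFDerivAt p (innerSL ℝ (fieldMollify D κ g x)) x := fun x => hp x (mem_univ x)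
  have hpf : fderiv ℝ p = fun x => innerSL ℝ (fieldMollify D κ g x) := funext fun x => (hp' x).fderiv
  have hpc : ContDiff ℝ 1 p := by
    rw [contDiff_one_iff_fderiv]
    refine ⟨fun x => (hp' x).differentiableAt, ?_⟩
    rw [hpf]
    exact (innerSL ℝ).continuous.comp hG.continuous
  have hpo : IsOn D p := by
    cases D
    · trivial
    · exact isOn_of_hasFDerivAt hG (integral_inner_fieldMollify_torus hκ hg ho) hp'
  have h1 := ha.integral_eq_zero hh hpc hpo fun x => by
    rw [hpf, innerSL_apply_norm]; exact hG.norm_le x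
  rw [hpf] at h1
  exact h1

theorem integral_bumpFn_pos (D : Domain) (n : ℕ) : 0 < ∫ z, bumpFn D n (0 : E d) z ∂(vol d D) := by
  have hκ := isTest_bumpFn D n (0 : E d)
  refine lt_of_le_of_ne (integral_nonneg fun z => bumpFn_nonneg D n 0 z) fun h => ?_
  have h1 := (integral_eq_zero_iff_of_nonneg (fun z => bumpFn_nonneg D n 0 z) hκ.integrable).1 h.symm
  have h2 := eq_zero_of_ae_vol hκ.1.continuous hκ.2.1 h1
  have h3 : bumpFn D n (0 : E d) 0 = 1 := bumpFn_eq_one (by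
    have := gauge_le D (0 - 0 : E d)
    have h4 := gauge_nonneg D (0 - 0 : E d)
    simp only [sub_self, norm_zero] at this h4 ⊢
    nlinarith [(Nat.cast_nonneg n : (0 : ℝ) ≤ n)])
  rw [h2] at h3
  simp at h3

/-- A periodic approximation of the identity. -/
def bumpKernel (d : ℕ) (D : Domain) (n : ℕ) (z : E d) : ℝ :=
  (∫ z, bumpFn D n (0 : E d) z ∂(vol d D))⁻¹ * bumpFn D n 0 z

theorem bumpKernel_nonneg (D : Domain) (n : ℕ) (z : E d) : 0 ≤ bumpKernel d D n z :=
  mul_nonneg (inv_nonneg.2 (integral_bumpFn_pos D n).le) (bumpFn_nonneg D n 0 z)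

theorem isTest_bumpKernel (D : Domain) (n : ℕ) : IsTest D (bumpKernel d D n) :=
  (isTest_bumpFn D n 0).clm_comp
    (ContinuousLinearMap.mul ℝ ℝ (∫ z, bumpFn D n (0 : E d) z ∂(vol d D))⁻¹)

theorem integral_bumpKernel (D : Domain) (n : ℕ) : ∫ z, bumpKernel d D n z ∂(vol d D) = 1 := by
  unfold bumpKernel
  rw [integral_const_mul, inv_mul_cancel₀ (integral_bumpFn_pos D n).ne']

theorem tendsto_fieldMollify (hg : IsBddField D K g) (x : E d) :
    Tendsto (fun n => fieldMollify D (bumpKernel d D n) g x) atTop (𝓝 (g x)) := by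
  rw [Metric.tendsto_atTop']
  intro ε hε
  obtain ⟨δ, hδ, h⟩ := Metric.continuousAt_iff.1 hg.continuous.continuousAt (ε / 2) (half_pos hε)
  obtain ⟨N, hN⟩ := exists_nat_gt (2 / δ ^ 2)
  refine ⟨N, fun n hn => ?_⟩
  have hκ := isTest_bumpKernel (d := d) D n
  have h1 : fieldMollify D (bumpKernel d D n) g x - g x =
      ∫ z, bumpKernel d D n z • (g (z + x) - g x) ∂(vol d D) := by
    simp only [smul_sub]
    rw [integral_sub (hκ.integrable_smul hg x) (hκ.integrable.smul_const _), integral_smul_const,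
      integral_bumpKernel, one_smul, fieldMollify]
  have h2 : ∀ z, ‖bumpKernel d D n z • (g (z + x) - g x)‖ ≤ bumpKernel d D n z * (ε / 2) := by
    intro z
    rw [norm_smul, Real.norm_of_nonneg (bumpKernel_nonneg D n z)]
    by_cases hz : bumpFn D n 0 z = 0
    · simp [bumpKernel, hz]
    · refine mul_le_mul_of_nonneg_left ?_ (bumpKernel_nonneg D n z)
      obtain ⟨k, hk, hle⟩ := exists_lattice_of_bumpFn_ne_zero hz
      rw [sub_zero] at hle
      have h3 : g (z + x) = g (z - k + x) := by
        rw [sub_add_eq_add_sub, hg.isOn.sub_lattice hk]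
      have h4 : ‖z - k‖ < δ := by
        have hn' : (N : ℝ) < n := mod_cast hn
        have h5 : 2 < (n : ℝ) * δ ^ 2 := by
          rw [div_lt_iff₀ (by positivity)] at hN
          nlinarith [sq_nonneg δ]
        refine lt_of_pow_lt_pow_left₀ 2 hδ.le ?_
        by_contra! h6
        nlinarith [(Nat.cast_nonneg n : (0 : ℝ) ≤ n), sq_nonneg δ]
      have h5 := h (x := z - k + x) (by rwa [dist_eq_norm, add_sub_cancel_right])
      rw [h3, ← dist_eq_norm]
      exact h5.le
  rw [dist_eq_norm, h1]
  refine (norm_integral_le_of_norm_le (hκ.integrable.mul_const _)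
    (Eventually.of_forall h2)).trans_lt ?_
  rw [integral_mul_const, integral_bumpKernel]
  linarith

/-- A bounded field orthogonal to the divergence-free test fields is annihilated by the
divergence-free measures. -/
theorem integral_inner_eq_zero_of_orthogonal {m : Measure (E d)} {h : E d → E d}
    (hh : Integrable h m) (ha : AnnihilatesGradients D m h) (hg : IsBddField D K g)
    (ho : OrthogonalToDivFree D g) : ∫ x, ⟪g x, h x⟫_ℝ ∂m = 0 := by
  have hG := fun n => isBddField_fieldMollify (isTest_bumpKernel D n) (bumpKernel_nonneg D n) hg
  simp only [integral_bumpKernel, one_mul] at hG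
  have h1 : Tendsto (fun n => ∫ x, ⟪fieldMollify D (bumpKernel d D n) g x, h x⟫_ℝ ∂m) atTop
      (𝓝 (∫ x, ⟪g x, h x⟫_ℝ ∂m)) := by
    refine tendsto_integral_of_dominated_convergence (fun x => K * ‖h x‖)
      (fun n => (hG n).continuous.aestronglyMeasurable.inner hh.1) (hh.norm.const_mul K)
      (fun n => Eventually.of_forall fun x => (norm_inner_le_norm _ _).trans
        (mul_le_mul_of_nonneg_right ((hG n).norm_le x) (norm_nonneg _)))
      (Eventually.of_forall fun x => (tendsto_fieldMollify hg x).inner tendsto_const_nhds)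
  refine tendsto_nhds_unique h1 ?_
  simp only [integral_inner_fieldMollify hh ha (isTest_bumpKernel D _) (bumpKernel_nonneg D _) hg ho]
  exact tendsto_const_nhds

theorem IsTest.memLp {ψ : E d → E d} (hψ : IsTest D ψ) : MemLp ψ 2 (vol d D) := by
  cases D
  · have h : HasCompactSupport ψ := hψ.2.2
    exact (hψ.1.continuous.memLp_of_hasCompactSupport h).restrict _
  · obtain ⟨M, -, hM, -⟩ := hψ.exists_bound
    exact MemLp.of_bound hψ.1.continuous.aestronglyMeasurable M (Eventually.of_forall hM)

/-- The residual of an orthogonal projection is orthogonal to the closed subspace, which contains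
all divergence-free test fields. -/
theorem IsLerayProjection.orthogonalToDivFree {r : ℝ} {w z : E d → E d}
    (h : IsLerayProjection D r w z) : OrthogonalToDivFree D fun x => w x - z x := by
  obtain ⟨-, hw, hz⟩ := h
  intro ψ hψ hdiv
  have hm : hψ.memLp.toLp ψ ∈ solenoidalL2 d D :=
    Submodule.le_topologicalClosure _
      (Submodule.subset_span ⟨ψ, hψ.1, hψ.2.1, hdiv, hψ.memLp.coeFn_toLp⟩)
  have h1 := (solenoidalL2 d D).starProjection_inner_eq_zero (hw.toLp w) _ hm
  rw [L2.inner_def] at h1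
  rw [← h1]
  refine integral_congr_ae ?_
  filter_upwards [hψ.memLp.coeFn_toLp, hw.coeFn_toLp, hz,
    Lp.coeFn_sub (hw.toLp w) ((solenoidalL2 d D).starProjection (hw.toLp w))] with x h2 h3 h4 h5
  rw [h2, h5, Pi.sub_apply, h3, h4]

theorem MemSob.exists_isBddField {r : ℝ} {f : E d → E d} (hf : MemSob D r f)
    (hr : 1 + (d : ℝ) / 2 < r) : ∃ K, IsBddField D K f := by
  refine ⟨(sobConst d D r * sobNorm D r f).toReal, (hf.contDiff hr).continuous, hf.isOn,
    fun x => ?_⟩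
  have h1 : sobConst d D r * sobNorm D r f ≠ ∞ :=
    (ENNReal.mul_lt_top (sobConst_lt_top D hr) hf).ne
  have h2 := ENNReal.toReal_mono h1 (hf.enorm_le hr x)
  rwa [toReal_enorm] at h2

theorem IsBddField.sub {f : E d → E d} {K' : ℝ} (hf : IsBddField D K f) (hg : IsBddField D K' g) :
    IsBddField D (K + K') fun x => f x - g x :=
  ⟨hf.continuous.sub hg.continuous, hf.isOn.map₂ hg.isOn fun a b => a - b,
    fun x => (norm_sub_le _ _).trans (add_le_add (hf.norm_le x) (hg.norm_le x))⟩

theorem IsBddField.integrable_inner {m : Measure (E d)} {h : E d → E d} (hg : IsBddField D K g)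
    (hh : Integrable h m) : Integrable (fun x => ⟪g x, h x⟫_ℝ) m :=
  (hh.norm.const_mul K).mono' (hg.continuous.aestronglyMeasurable.inner hh.1)
    (Eventually.of_forall fun x => (norm_inner_le_norm _ _).trans
      (mul_le_mul_of_nonneg_right (hg.norm_le x) (norm_nonneg _)))

/-- The projection is given only almost everywhere, while `m` may be singular. Continuity of both
fields makes their pairings with `m` meaningful, and the mollification argument applies to their
difference. -/
theorem IsLerayProjection.integral_inner_eq {r : ℝ} {w z : E d → E d}
    (h : IsLerayProjection D r w z) (hr : 1 + (d : ℝ) / 2 < r) (hw : IsBddField D K w)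
    {m : Measure (E d)} {f : E d → E d} (hf : Integrable f m) (ha : AnnihilatesGradients D m f) :
    ∫ x, ⟪z x, f x⟫_ℝ ∂m = ∫ x, ⟪w x, f x⟫_ℝ ∂m := by
  obtain ⟨K', hz⟩ := h.1.exists_isBddField hr
  have h1 := integral_inner_eq_zero_of_orthogonal hf ha (hw.sub hz) h.orthogonalToDivFree
  simp only [inner_sub_left] at h1
  rw [integral_sub (hw.integrable_inner hf) (hz.integrable_inner hf)] at h1
  linarith

end Leray

end Kelvin

end

/-! ### The statistical Kelvin theorem. -/

noncomputable section

namespace Kelvin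

variable {d : ℕ}

section Statistical

variable {Ω : Type*} [MeasurableSpace Ω] {P : Measure Ω} {D : Domain} {T : ℝ}
  {u : ℝ → E d → E d} {X ξ : Ω → ℝ → E d → E d} {s ν : ℝ} {W : ℝ≥0 → Ω → E d}
  {S : (E d → E d) → Lp (E d) 2 (vol d D)}

theorem IsFlowSystem.aestronglyMeasurable_backToLabel {Cu C : ℝ}
    (h : IsFlowSystem D T Cu C P u X (noise ν W)) {t : ℝ} (ht : t ∈ Icc 0 T) (y : E d) :
    AEStronglyMeasurable (fun ω => backToLabel ν W X ω t y) P := by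
  refine aestronglyMeasurable_inverse (f := fun ω => noisyFlow ν W X ω t)
    (g := fun ω => backToLabel ν W X ω t) (fun x => (h.meas t ht x).add (h.noise_meas t ht)) ?_ y
  filter_upwards [ae_isBddDiffeo h.flow ν W] with ω hω
  have h1 := hω t ht
  exact ⟨h1.contDiff.continuous, h1.contDiff_inv.continuous, h1.leftInverse, h1.rightInverse⟩

/-- The statistical Kelvin theorem. -/
theorem IsCritical.exists_expectation_kelvin [IsProbabilityMeasure P]
    (hc : IsCritical D s T ν P W S u X ξ)
    (hW : IsBrownianMotion W P) (hS : IsInertia D (s + 1) S) (hs : 1 + (d : ℝ) / 2 < s)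
    (hT : 0 < T) (hX0 : ∀ᵐ ω ∂P, X ω 0 = id) {ξ₀ : E d → E d} (hξ₀ : ∀ᵐ ω ∂P, ξ ω 0 = ξ₀)
    {μ : VectorMeasure (E d) (E d)} (hμ : IsDivFreeMeasure D μ) {t : ℝ} (ht : t ∈ Icc 0 T) :
    ∃ N : VectorMeasure (E d) (E d),
      IsExpectation P (fun ω => pushMeasure D (backToLabel ν W X ω t) μ) N ∧
      IsDivFreeMeasure D N ∧
      pairMeasure (fun x => ∫ ω, ξ ω t (backToLabel ν W X ω t x) ∂P) μ = pairMeasure ξ₀ N ∧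
      ∀ ζ : E d → E d,
        IsLerayProjection D s (fun x => ∫ ω, ξ ω t (backToLabel ν W X ω t x) ∂P) ζ →
        pairMeasure ζ μ = pairMeasure ξ₀ N := by
  obtain ⟨Cu, C, h⟩ := hc.exists_isFlowSystem hW hs hT
  obtain ⟨R, -, hR⟩ := hc.momentum.exists_isBddMomentum hs
  obtain ⟨K, -, hK⟩ := hc.momentum.exists_isBddField_initial hs hT hξ₀
  obtain ⟨m, hm, g, hg, rfl⟩ := exists_withDensityᵥ_eq μ
  have ha := hμ.annihilatesGradients hg
  have hmeas := fun x => h.aestronglyMeasurable_backToLabel ht x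
  have hA : ∀ᵐ ω ∂P, IsBddDiffeo D C (noisyFlow ν W X ω t) (backToLabel ν W X ω t) :=
    (ae_isBddDiffeo h.flow ν W).mono fun ω h => h t ht
  have hZ : ∀ᵐ ω ∂P, ∀ y w, ⟪ξ ω t (backToLabel ν W X ω t y), w⟫_ℝ =
      ⟪ξ₀ (backToLabel ν W X ω t y), fderiv ℝ (backToLabel ν W X ω t) y w⟫_ℝ :=
    (hc.ae_transport hW hS hs hT hX0 hξ₀).mono fun ω h => h t ht
  have hZc : ∀ᵐ ω ∂P, Continuous (fun y => ξ ω t (backToLabel ν W X ω t y)) ∧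
      IsOn D fun y => ξ ω t (backToLabel ν W X ω t y) := by
    filter_upwards [hR, hA] with ω h1 h2
    have h3 := (h1.isBddField ht).comp h2.contDiff_inv.continuous h2.isOn_inv
    exact ⟨h3.continuous, h3.isOn⟩
  obtain ⟨N, hN, hNd, hNp⟩ := exists_isExpectation_pushMeasure hmeas hA hg ha
  have hw := isBddField_expectation (Z := fun ω y => ξ ω t (backToLabel ν W X ω t y))
    hmeas hA hK hZ hZc
  have hE := integral_inner_expectation (Z := fun ω y => ξ ω t (backToLabel ν W X ω t y))
    hmeas hA hK hZ (hZc.mono fun ω h => h.1) hg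
  -- Both sides are the expectation of the pairing of ξ₀(A) with ∇A applied to the density, once by
  -- the construction of `N` and once by Fubini's theorem for the averaged momentum.
  have hpair : pairMeasure ξ₀ N =
      ∫ x, ⟪∫ ω, ξ ω t (backToLabel ν W X ω t x) ∂P, g x⟫_ℝ ∂m := (hNp K ξ₀ hK).trans hE.symm
  refine ⟨N, hN, hNd, ?_, fun ζ hζ => ?_⟩
  · rw [hpair, pairMeasure_withDensityᵥ hg hw.continuous.stronglyMeasurable hw.norm_le]
  · obtain ⟨K', hz⟩ := hζ.1.exists_isBddField hs
    rw [hpair, pairMeasure_withDensityᵥ hg hz.continuous.stronglyMeasurable hz.norm_le]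
    exact hζ.integral_inner_eq hs hw hg ha

end Statistical

end Kelvin

end

theorem theorem3p11 {d : ℕ} (hd : d = 2 ∨ d = 3) (D : Kelvin.Domain)
    {Ω : Type*} [MeasurableSpace Ω] (P : Measure Ω) [IsProbabilityMeasure P]
    (W : ℝ≥0 → Ω → Kelvin.E d) (hW : Kelvin.IsBrownianMotion W P)
    (s T ν : ℝ) (hs : 1 + (d : ℝ) / 2 < s) (hT : 0 < T) (hν : 0 ≤ ν)
    (S : (Kelvin.E d → Kelvin.E d) → Lp (Kelvin.E d) 2 (Kelvin.vol d D))
    (hS : Kelvin.IsInertia D (s + 1) S)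
    (u : ℝ → Kelvin.E d → Kelvin.E d) (X ξt : Ω → ℝ → Kelvin.E d → Kelvin.E d)
    (hcrit : Kelvin.IsCritical D s T ν P W S u X ξt)
    -- initial conditions: `X_0 = id`, and the initial momentum is deterministic
    (hX0 : ∀ᵐ ω ∂P, X ω 0 = id)
    (ξ₀ : Kelvin.E d → Kelvin.E d) (hξ₀ : ∀ᵐ ω ∂P, ξt ω 0 = ξ₀) :
    -- (I) pathwise Kelvin theorem
    (∀ v : VectorMeasure (Kelvin.E d) (Kelvin.E d), Kelvin.IsDivFreeMeasure D v →
      ∀ᵐ ω ∂P, ∀ t ∈ Icc 0 T,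
        Kelvin.IsDivFreeMeasure D (Kelvin.pushMeasure D (Kelvin.noisyFlow ν W X ω t) v) ∧
        Kelvin.pairMeasure (fun x => ξt ω t (Kelvin.backToLabel ν W X ω t x))
          (Kelvin.pushMeasure D (Kelvin.noisyFlow ν W X ω t) v) = Kelvin.pairMeasure ξ₀ v) ∧
    -- (II) statistical Kelvin theorem for the averaged momentum `ξ_t = 𝐏 𝔼[ξ̃_t ∘ A_t^ν]`
    (∀ μ : VectorMeasure (Kelvin.E d) (Kelvin.E d), Kelvin.IsDivFreeMeasure D μ →
      ∀ t ∈ Icc 0 T, ∃ m : VectorMeasure (Kelvin.E d) (Kelvin.E d),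
        Kelvin.IsExpectation P
          (fun ω => Kelvin.pushMeasure D (Kelvin.backToLabel ν W X ω t) μ) m ∧
        Kelvin.IsDivFreeMeasure D m ∧
        Kelvin.pairMeasure (fun x => ∫ ω, ξt ω t (Kelvin.backToLabel ν W X ω t x) ∂P) μ =
          Kelvin.pairMeasure ξ₀ m ∧
        ∀ ξ : Kelvin.E d → Kelvin.E d,
          Kelvin.IsLerayProjection D s
            (fun x => ∫ ω, ξt ω t (Kelvin.backToLabel ν W X ω t x) ∂P) ξ →
          Kelvin.pairMeasure ξ μ = Kelvin.pairMeasure ξ₀ m) := by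
  exact ⟨fun v hv => hcrit.ae_kelvin hW hS hs hT hX0 hξ₀ hv,
    fun μ hμ t ht => hcrit.exists_expectation_kelvin hW hS hs hT hX0 hξ₀ hμ ht⟩
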